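/- **Setting.** Let $R=\mathbb C[x]$, $R'=\mathbb C[x'_1,\dots,x'_m]$ ($m\ge 0$), $W\in R$, $W'\in R'$. For a commutative $\mathbb C$-algebra $S$ let $S\text{-mod}^{\mathbb Z_2}$ be the category of pairs $(M,\sigma)$ of a free finite-rank $S$-module $M$ and an $S$-linear $\sigma:M\to M$ with $\sigma^2=1$; its morphisms are all $S$-linear maps. *Fusion functors.* A $(W',W)$-fusion functor is a $\mathbb C$-linear functor $U:R\text{-mod}^{\mathbb Z_2}\to R'\text{-mod}^{\mathbb Z_2}$ with $U(M,\sigma)=(U(M),U(\sigma))$ and $U(Wf)=W'U(f)$ for all $f$. A degree-$n$ morphism $\phi:U\to V$ assigns to each composable sequence $M_{n+1}\xleftarrow{f_n}\cdots\xleftarrow{f_1}M_1$ an $R'$-linear map $\phi(f_n,\dots,f_1):U(M_1)\to V(M_{n+1})$ (for $n=0$: maps $\phi(M):U(M)\to V(M)$ with $\phi(M)U(\sigma)=V(\sigma)\phi(M)$) which is $\mathbb C$-linear in each $f_i$, vanishes if some $f_i=1$, satisfies $\phi(\dots,Wf_i,\dots)=W'\phi(\dots,f_i,\dots)$ and is compatible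 with the gradings: $\phi(\dots,f_i\sigma_i,f_{i-1},\dots)=\phi(\dots,f_i,\sigma_if_{i-1},\dots)$, $\phi(\sigma_{n+1}f_n,\dots)=V(\sigma_{n+1})\phi(f_n,\dots)$, $\phi(\dots,f_1\sigma_1)=\phi(\dots,f_1)U(\sigma_1)$. A morphism is a finite sum of such homogeneous ones. Composition is $(\psi\phi)(f_n,\dots,f_1)=\sum_k\psi(f_n,\dots,f_{k+1})\phi(f_k,\dots,f_1)$, and the differential is $$(d\phi)(f_{n+1},\dots,f_1)=V(f_{n+1})\phi(f_n,\dots,f_1)+\sum_{i=1}^{n}(-1)^{n+1-i}\phi(\dots,f_{i+1}f_i,\dots)+(-1)^{n+1}\phi(f_{n+1},\dots,f_2)U(f_1).$$ $H^\bullet\mathrm{FF}_{W',W}$ has the fusion functors as objects and the $d$-cohomology of all morphisms (all degrees) as morphism spaces. *Matrix factorizations.* A finite-rank $(W',W)$-matrix factorization $(M,\sigma,Q)$ is a free finite-rank $R'\otimes_{\mathbb C}R$-module $M$ with linear maps $\sigma,Q$ such that $\sigma^2=1$, $Q\sigma+\sigma Q=0$, $Q^2=(W'\otimes1-1\otimes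 W)\,1_M$. Morphisms are all linear maps, $\varphi$ being even or odd if $\sigma_2\varphi=\pm\varphi\sigma_1$; $\delta\varphi=Q_2\varphi-\varphi Q_1$ for even and $\delta\varphi=Q_2\varphi+\varphi Q_1$ for odd $\varphi$. $H^\bullet\mathrm{mf}_{W',W}$ is the cohomology category. *The functor.* Let $\tilde R=\mathbb C[\tilde x]$ and $$I_W=\begin{pmatrix}0&x-\tilde x\\ \frac{W(x)-W(\tilde x)}{x-\tilde x}&0\end{pmatrix}\quad\text{on}\quad M_{I_W}=R\otimes\tilde R\,\oplus\,R\otimes\tilde R,\qquad \sigma=\mathrm{diag}(1,-1).$$ Functors and morphisms are extended to $R\otimes\tilde R$-linear maps by $U(f\otimes g)=U(f)\otimes g$ and $\phi(f_n\otimes g_n,\dots,f_1\otimes g_1)=\phi(f_n,\dots,f_1)\otimes g_n\cdots g_1$. Put $\Pi^{I_W}(U)=(U(R\oplus R)\otimes_{\mathbb C}\tilde R,\,U(\sigma),\,U(I_W))=:U(I_W)$ and $\Pi^{I_W}(\phi)=\sum_n\phi^{(n)}(I_W,\dots,I_W)$. This defines a functor $\Pi^{I_W}:H^\bullet\mathrm{FF}_{W',W}\to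 H^\bullet\mathrm{mf}_{W',W}$. *Notation.* Let $V(\mu):V(R)\otimes\tilde R\to V(R)$, $V(\mu)(v\otimes p)=V(p)v$, where $R$ is purely even and $p$ also denotes multiplication by $p$ on $R$. For a basis $(e_i)$ of $M$ let $\pi_i:M\to R$ be the $i$-th coordinate and $\iota_i:R\to M$, $p\mapsto pe_i$. **Theorem.** Let $U,V$ be $(W',W)$-fusion functors. 1. (Even.) Let $\varphi=\mathrm{diag}(\varphi^{(0)},\varphi^{(1)}):U(I_W)\to V(I_W)$ be an even $\delta$-closed morphism and $h_0(u)=V(\mu)\varphi^{(0)}(u\otimes1)$ for $u\in U(R)$. There is a closed fusion-functor morphism $\phi_{UV}$ of degree $0$ such that for every $M$ and every basis of $M$ $$\phi_{UV}(M)=\sum_iV(\iota_i)\,h_0\,U(\pi_i),$$ and $\Pi^{I_W}(\phi_{UV})=\varphi+\delta\chi$ for some odd $\chi$. 2. (Odd.) Every $(M,\sigma)$ in $R\text{-mod}^{\mathbb Z_2}$ has a basis of vectors that are even or odd. Fix any choice of such a basis for every $M$. Let $\psi=\begin{pmatrix}0&\psi^{(1)}\\ \psi^{(0)}&0\end{pmatrix}:U(I_W)\to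 V(I_W)$ be an odd $\delta$-closed morphism, and for $p\in R$ put $h(p)(u)=V(\mu)\,\psi^{(1)}\,U\!\left(\frac{p(x)-p(\tilde x)}{x-\tilde x}\right)(u\otimes1)$, $u\in U(R)$. There is a closed fusion-functor morphism $\phi_{UV}$ of degree $1$ such that for every $f:M\to N$ with matrix entries $f_{ji}$ in the chosen bases $$\phi_{UV}(f)=\sum_{i,j}V(\iota_j)\,h(f_{ji})\,U(\pi_i),$$ $\phi_{UV}(Wf)=W'\phi_{UV}(f)$, and $\Pi^{I_W}(\phi_{UV})=\psi+\delta\chi$ for some even $\chi$. 3. The functor $\Pi^{I_W}:H^\bullet\mathrm{FF}_{W',W}\to H^\bullet\mathrm{mf}_{W',W}$ is full. -/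

import Mathlib

open CategoryTheory
open scoped TensorProduct Polynomial

set_option linter.unusedSectionVars false

namespace LGFusion

/-- A free finite-rank `A`-module together with a `ℤ/2`-grading, encoded by an involution. -/
structure GrMod (A : Type) [CommRing A] : Type 1 where
  carrier : Type
  [addCommGroup : AddCommGroup carrier]
  [module : Module A carrier]
  [free : Module.Free A carrier]
  [finite : Module.Finite A carrier]
  σ : carrier →ₗ[A] carrier
  σ_sq : σ ∘ₗ σ = LinearMap.id

namespace GrMod

attribute [instance] addCommGroup module free finite

section
variable {A : Type} [CommRing A]

/-- Morphisms are all module homomorphisms, even, odd or inhomogeneous. -/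
instance : Category (GrMod A) where
  Hom M N := M.carrier →ₗ[A] N.carrier
  id M := LinearMap.id
  comp f g := g ∘ₗ f

instance : Preadditive (GrMod A) where
  homGroup M N := inferInstanceAs (AddCommGroup (M.carrier →ₗ[A] N.carrier))
  add_comp _ _ _ f f' g := LinearMap.comp_add f f' g
  comp_add _ _ _ f g g' := LinearMap.add_comp f g' g

/-- Multiplication of module homomorphisms by ring elements. -/
instance : CategoryTheory.Linear A (GrMod A) where
  homModule M N := inferInstanceAs (Module A (M.carrier →ₗ[A] N.carrier))
  smul_comp _ _ _ r f g := LinearMap.comp_smul g r f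
  comp_smul _ _ _ f r g := LinearMap.smul_comp r g f

/-- Multiplication of module homomorphisms by complex numbers. -/
instance [Algebra ℂ A] : CategoryTheory.Linear ℂ (GrMod A) where
  homModule _ _ := Module.compHom _ (algebraMap ℂ A)
  smul_comp _ _ _ r f g := LinearMap.comp_smul g (algebraMap ℂ A r) f
  comp_smul _ _ _ f r g := LinearMap.smul_comp (algebraMap ℂ A r) g f

/-- A morphism as a linear map. -/
def lin {M N : GrMod A} (f : M ⟶ N) : M.carrier →ₗ[A] N.carrier := f

/-- A linear map as a morphism. -/
def ofLin {M N : GrMod A} (f : M.carrier →ₗ[A] N.carrier) : M ⟶ N := f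

/-- The grading involution as a morphism. -/
def sgn (M : GrMod A) : M ⟶ M := ofLin M.σ

theorem sgn_sgn (M : GrMod A) : M.sgn ≫ M.sgn = 𝟙 M := M.σ_sq

theorem complex_smul [Algebra ℂ A] {M N : GrMod A} (c : ℂ) (f : M ⟶ N) :
    c • f = algebraMap ℂ A c • f := rfl

end
end GrMod

section Functors

variable {A A' : Type} [CommRing A] [CommRing A'] [Algebra ℂ A] [Algebra ℂ A']

/-- A `(W', W)`-fusion functor: a `ℂ`-linear functor with `U (M, σ) = (U (M), U (σ))` and
`U (W f) = W' U (f)`. -/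
structure FusionFunctor (W' : A') (W : A) : Type 1 where
  functor : GrMod A ⥤ GrMod A'
  additive : functor.Additive
  linear : functor.Linear ℂ
  map_sgn : ∀ M : GrMod A, functor.map M.sgn = (functor.obj M).sgn
  map_smul_potential : ∀ {M N : GrMod A} (f : M ⟶ N),
    functor.map (W • f) = W' • functor.map f

attribute [instance] FusionFunctor.additive FusionFunctor.linear

/-- Families of maps, of arbitrary and mixed degrees: a sequence of `n` composable homomorphisms
`M = M₁ → ⋯ → Mₙ₊₁ = N` is sent to a homomorphism `U M → V N`. -/
abbrev Cochain (U V : GrMod A ⥤ GrMod A') : Type 1 :=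
  ∀ ⦃M N : GrMod A⦄, Quiver.Path M N → (U.obj M ⟶ V.obj N)

/-- The terms of the differential except the one with `V`:
`- φ (fₙ₊₁ fₙ, …) + φ (fₙ₊₁, fₙ fₙ₋₁, …) - ⋯ + (-1)ⁿ⁺¹ φ (fₙ₊₁, …, f₂) U (f₁)`. -/
def lowerTerms (U : GrMod A ⥤ GrMod A') {Y : GrMod A'} {M : GrMod A} : ∀ {N : GrMod A},
    Quiver.Path M N → (∀ ⦃L : GrMod A⦄, Quiver.Path L N → (U.obj L ⟶ Y)) → (U.obj M ⟶ Y)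
  | _, .nil, _ => 0
  | _, .cons .nil f, φ => - (U.map f ≫ φ .nil)
  | _, .cons (.cons p g) f, φ =>
      - φ (p.cons (g ≫ f)) - lowerTerms U (p.cons g) (fun _ q => φ (q.cons f))

/-- The differential:
`(d φ) (fₙ₊₁, …, f₁) = V (fₙ₊₁) φ (fₙ, …, f₁) - φ (fₙ₊₁ fₙ, …, f₁) + ⋯
  + (-1)ⁿ⁺¹ φ (fₙ₊₁, …, f₂) U (f₁)`. -/
def d {U V : GrMod A ⥤ GrMod A'} (φ : Cochain U V) : Cochain U V
  | _, _, .nil => 0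
  | _, _, .cons p f => φ p ≫ V.map f + lowerTerms U (p.cons f) (fun _ q => φ q)

/-- `∑ ψ (fₙ, …, fₖ₊₁) φ (fₖ, …, f₁)` over all `k`. -/
def compAux {U V : GrMod A ⥤ GrMod A'} (φ : Cochain U V) {Y : GrMod A'} {M : GrMod A} :
    ∀ {N : GrMod A}, Quiver.Path M N → (∀ ⦃L : GrMod A⦄, Quiver.Path L N → (V.obj L ⟶ Y)) → (U.obj M ⟶ Y)
  | _, .nil, ψ => φ .nil ≫ ψ .nil
  | _, .cons p f, ψ => φ (p.cons f) ≫ ψ .nil + compAux φ p (fun _ q => ψ (q.cons f))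

/-- Composition, in diagrammatic order. -/
def Cochain.comp {U V T : GrMod A ⥤ GrMod A'} (φ : Cochain U V) (ψ : Cochain V T) : Cochain U T :=
  fun _ _ p => compAux φ p (fun _ q => ψ q)

/-- The identity, concentrated in degree `0`. -/
def Cochain.id (U : GrMod A ⥤ GrMod A') : Cochain U U
  | _, _, .nil => 𝟙 _
  | _, _, .cons _ _ => 0

/-- The homogeneous families of degree `n`. -/
def Cochain.IsHomogeneous {U V : GrMod A ⥤ GrMod A'} (φ : Cochain U V) (n : ℕ) : Prop :=
  ∀ ⦃M N : GrMod A⦄ (p : Quiver.Path M N), p.length ≠ n → φ p = 0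

/-- The conditions on a morphism of `(W', W)`-fusion functors. Only finitely many degrees occur; the
components are multilinear, vanish if an argument is an identity, turn multiplication of an argument
by `W` into multiplication by `W'`, and are compatible with the gradings: an involution `σ` may be
moved between neighbouring arguments, and out of the first and the last argument. In degree `0` the
last condition says that the components are even. -/
structure IsFusionMorphism (W' : A') (W : A) {U V : GrMod A ⥤ GrMod A'} (φ : Cochain U V) :
    Prop where
  bounded : ∃ n : ℕ, ∀ ⦃M N : GrMod A⦄ (p : Quiver.Path M N), n ≤ p.length → φ p = 0
  map_add : ∀ ⦃L M N P : GrMod A⦄ (p : Quiver.Path L M) (f g : M ⟶ N) (q : Quiver.Path N P),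
    φ ((p.cons (f + g)).comp q) = φ ((p.cons f).comp q) + φ ((p.cons g).comp q)
  map_smul : ∀ ⦃L M N P : GrMod A⦄ (p : Quiver.Path L M) (c : ℂ) (f : M ⟶ N) (q : Quiver.Path N P),
    φ ((p.cons (c • f)).comp q) = c • φ ((p.cons f).comp q)
  map_one : ∀ ⦃L M P : GrMod A⦄ (p : Quiver.Path L M) (q : Quiver.Path M P), φ ((p.cons (𝟙 M)).comp q) = 0
  map_potential : ∀ ⦃L M N P : GrMod A⦄ (p : Quiver.Path L M) (f : M ⟶ N) (q : Quiver.Path N P),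
    φ ((p.cons (W • f)).comp q) = W' • φ ((p.cons f).comp q)
  map_slide : ∀ ⦃L M N P S : GrMod A⦄ (p : Quiver.Path L M) (f : M ⟶ N) (g : N ⟶ P) (q : Quiver.Path P S),
    φ (((p.cons (f ≫ N.sgn)).cons g).comp q) = φ (((p.cons f).cons (N.sgn ≫ g)).comp q)
  map_last : ∀ ⦃L M N : GrMod A⦄ (p : Quiver.Path L M) (f : M ⟶ N),
    φ (p.cons (f ≫ N.sgn)) = φ (p.cons f) ≫ V.map N.sgn
  map_first : ∀ ⦃M N P : GrMod A⦄ (f : M ⟶ N) (q : Quiver.Path N P),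
    φ ((Quiver.Path.nil.cons (M.sgn ≫ f)).comp q) = U.map M.sgn ≫ φ ((Quiver.Path.nil.cons f).comp q)
  map_nil : ∀ M : GrMod A, U.map M.sgn ≫ φ (Quiver.Path.nil : Quiver.Path M M) = φ Quiver.Path.nil ≫ V.map M.sgn

section Lemmas

variable {U V T : GrMod A ⥤ GrMod A'} {W' : A'} {W : A}

theorem lowerTerms_add {Y : GrMod A'} {M N : GrMod A} (p : Quiver.Path M N)
    (φ ψ : ∀ ⦃L : GrMod A⦄, Quiver.Path L N → (U.obj L ⟶ Y)) :
    lowerTerms U p (fun _ q => φ q + ψ q) = lowerTerms U p φ + lowerTerms U p ψ := by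
  induction p with
  | nil => simp [lowerTerms]
  | cons p f ih =>
    cases p with
    | nil => simp only [lowerTerms, Preadditive.comp_add]; abel
    | cons p g =>
      simp only [lowerTerms]
      rw [ih (fun _ q => φ (q.cons f)) (fun _ q => ψ (q.cons f))]
      abel

theorem lowerTerms_smul {Y : GrMod A'} {M N : GrMod A} (p : Quiver.Path M N) (c : ℂ)
    (φ : ∀ ⦃L : GrMod A⦄, Quiver.Path L N → (U.obj L ⟶ Y)) :
    lowerTerms U p (fun _ q => c • φ q) = c • lowerTerms U p φ := by
  induction p with
  | nil => simp [lowerTerms]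
  | cons p f ih =>
    cases p with
    | nil => simp only [lowerTerms, Linear.comp_smul, smul_neg]
    | cons p g =>
      simp only [lowerTerms]
      rw [ih (fun _ q => φ (q.cons f)), smul_sub, smul_neg]

theorem lowerTerms_comp {Y Z : GrMod A'} (y : Y ⟶ Z) {M N : GrMod A} (p : Quiver.Path M N)
    (φ : ∀ ⦃L : GrMod A⦄, Quiver.Path L N → (U.obj L ⟶ Y)) :
    lowerTerms U p (fun _ q => φ q ≫ y) = lowerTerms U p φ ≫ y := by
  induction p with
  | nil => simp [lowerTerms]
  | cons p f ih =>
    cases p with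
    | nil => simp only [lowerTerms, Preadditive.neg_comp, Category.assoc]
    | cons p g =>
      simp only [lowerTerms]
      rw [ih (fun _ q => φ (q.cons f)), Preadditive.sub_comp, Preadditive.neg_comp]

theorem compAux_add (φ : Cochain U V) {Y : GrMod A'} {M N : GrMod A} (p : Quiver.Path M N)
    (ψ χ : ∀ ⦃L : GrMod A⦄, Quiver.Path L N → (V.obj L ⟶ Y)) :
    compAux φ p (fun _ q => ψ q + χ q) = compAux φ p ψ + compAux φ p χ := by
  induction p with
  | nil => simp [compAux]
  | cons p f ih =>
    simp only [compAux, Preadditive.comp_add]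
    rw [ih (fun _ q => ψ (q.cons f)) (fun _ q => χ (q.cons f))]
    abel

theorem compAux_comp (φ : Cochain U V) {Y Z : GrMod A'} (y : Y ⟶ Z) {M N : GrMod A}
    (p : Quiver.Path M N) (ψ : ∀ ⦃L : GrMod A⦄, Quiver.Path L N → (V.obj L ⟶ Y)) :
    compAux φ p (fun _ q => ψ q ≫ y) = compAux φ p ψ ≫ y := by
  induction p with
  | nil => simp [compAux]
  | cons p f ih =>
    simp only [compAux, Preadditive.add_comp, Category.assoc]
    rw [ih (fun _ q => ψ (q.cons f))]

theorem compAux_smul (φ : Cochain U V) {Y : GrMod A'} {M N : GrMod A} (p : Quiver.Path M N) (c : ℂ)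
    (ψ : ∀ ⦃L : GrMod A⦄, Quiver.Path L N → (V.obj L ⟶ Y)) :
    compAux φ p (fun _ q => c • ψ q) = c • compAux φ p ψ := by
  induction p with
  | nil => simp [compAux]
  | cons p f ih =>
    simp only [compAux, smul_add, Linear.comp_smul]
    rw [ih (fun _ q => ψ (q.cons f))]

theorem compAux_smul' (φ : Cochain U V) {Y : GrMod A'} {M N : GrMod A} (p : Quiver.Path M N) (c : A')
    (ψ : ∀ ⦃L : GrMod A⦄, Quiver.Path L N → (V.obj L ⟶ Y)) :
    compAux φ p (fun _ q => c • ψ q) = c • compAux φ p ψ := by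
  induction p with
  | nil => simp [compAux]
  | cons p f ih =>
    simp only [compAux, smul_add, Linear.comp_smul]
    rw [ih (fun _ q => ψ (q.cons f))]

theorem compAux_neg (φ : Cochain U V) {Y : GrMod A'} {M N : GrMod A} (p : Quiver.Path M N)
    (ψ : ∀ ⦃L : GrMod A⦄, Quiver.Path L N → (V.obj L ⟶ Y)) :
    compAux φ p (fun _ q => - ψ q) = - compAux φ p ψ := by
  simpa using compAux_smul φ p (-1) ψ

theorem compAux_zero (φ : Cochain U V) {Y : GrMod A'} {M N : GrMod A} (p : Quiver.Path M N) :
    compAux φ p (fun L (_ : Quiver.Path L N) => (0 : V.obj L ⟶ Y)) = 0 := by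
  simpa using compAux_smul φ p 0 (fun L (_ : Quiver.Path L N) => (0 : V.obj L ⟶ Y))

theorem compAux_add_left (φ φ' : Cochain U V) {Y : GrMod A'} {M N : GrMod A} (p : Quiver.Path M N)
    (ψ : ∀ ⦃L : GrMod A⦄, Quiver.Path L N → (V.obj L ⟶ Y)) :
    compAux (φ + φ') p ψ = compAux φ p ψ + compAux φ' p ψ := by
  induction p with
  | nil => simp [compAux]
  | cons p f ih =>
    simp only [compAux, Pi.add_apply, Preadditive.add_comp]
    rw [ih (fun _ q => ψ (q.cons f))]
    abel

theorem compAux_zero_left {Y : GrMod A'} {M N : GrMod A} (p : Quiver.Path M N)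
    (ψ : ∀ ⦃L : GrMod A⦄, Quiver.Path L N → (V.obj L ⟶ Y)) :
    compAux (0 : Cochain U V) p ψ = 0 := by
  have := compAux_add_left (0 : Cochain U V) 0 p ψ
  simpa using this

theorem Cochain.comp_assoc {S : GrMod A ⥤ GrMod A'} (φ : Cochain U V) (ψ : Cochain V T)
    (χ : Cochain T S) : (φ.comp ψ).comp χ = φ.comp (ψ.comp χ) := by
  have key : ∀ {Y : GrMod A'} {M N : GrMod A} (p : Quiver.Path M N)
      (χ : ∀ ⦃L : GrMod A⦄, Quiver.Path L N → (T.obj L ⟶ Y)),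
      compAux (φ.comp ψ) p χ = compAux φ p (fun _ q => compAux ψ q χ) := by
    intro Y M N p
    induction p with
    | nil => intro χ; simp [compAux, Cochain.comp]
    | cons p f ih =>
      intro χ
      simp only [compAux]
      rw [ih (fun _ q => χ (q.cons f)), compAux_add, compAux_comp]
      simp only [Cochain.comp, compAux, Preadditive.add_comp, Category.assoc, add_assoc]
  funext M N p
  exact key p _

theorem Cochain.id_comp (φ : Cochain U V) : (Cochain.id U).comp φ = φ := by
  have key : ∀ {Y : GrMod A'} {M N : GrMod A} (p : Quiver.Path M N)
      (χ : ∀ ⦃L : GrMod A⦄, Quiver.Path L N → (U.obj L ⟶ Y)),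
      compAux (Cochain.id U) p χ = χ p := by
    intro Y M N p
    induction p with
    | nil => intro χ; simp [compAux, Cochain.id]
    | cons p f ih =>
      intro χ
      simp only [compAux]
      rw [ih (fun _ q => χ (q.cons f))]
      simp [Cochain.id]
  funext M N p
  exact key p _

theorem Cochain.comp_id (φ : Cochain U V) : φ.comp (Cochain.id V) = φ := by
  funext M N p
  cases p with
  | nil => simp [Cochain.comp, compAux, Cochain.id]
  | cons p f =>
    simp only [Cochain.comp, compAux, Cochain.id, Category.comp_id]
    rw [compAux_zero, add_zero]

/-- Sign `(-1)ⁿ` in degree `n`. -/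
def Cochain.alternate (φ : Cochain U V) : Cochain U V :=
  fun _ _ p => (-1 : ℤ) ^ p.length • φ p

theorem lowerTerms_compAux (φ : Cochain U V) {Y : GrMod A'} {M N : GrMod A} (p : Quiver.Path M N)
    (ψ : ∀ ⦃L : GrMod A⦄, Quiver.Path L N → (V.obj L ⟶ Y)) :
    lowerTerms U p (fun _ q => compAux φ q ψ) =
      compAux φ p (fun _ q => lowerTerms V q ψ) +
      compAux (d φ) p (fun _ q => (-1 : ℤ) ^ q.length • ψ q) := by
  induction p with
  | nil => simp [lowerTerms, compAux, d]
  | cons p f ih =>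
    cases p with
    | nil => simp [lowerTerms, compAux, d]
    | cons p g =>
      have h1 := ih (fun _ q => ψ (q.cons f))
      simp only [compAux, lowerTerms, d, Quiver.Path.length_nil, Quiver.Path.length_cons, pow_zero, one_smul,
        pow_succ, mul_neg, mul_one, neg_smul, neg_neg, Limits.comp_zero, zero_add, Preadditive.comp_neg,
        Preadditive.add_comp, Preadditive.neg_comp, Category.assoc,
        lowerTerms_add, lowerTerms_comp, compAux_add, compAux_neg, sub_eq_add_neg] at h1 ⊢
      rw [h1]
      abel

theorem d_comp (φ : Cochain U V) (ψ : Cochain V T) :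
    d (φ.comp ψ) = φ.comp (d ψ) + (d φ).comp ψ.alternate := by
  funext M N p
  cases p with
  | nil => simp [d, Cochain.comp, compAux]
  | cons p f =>
    have h := lowerTerms_compAux φ (p.cons f) (fun _ q => ψ q)
    simp only [d, Cochain.comp, Pi.add_apply]
    rw [h]
    simp only [compAux, d, compAux_add, compAux_comp, lowerTerms, Cochain.alternate]
    simp only [Limits.comp_zero, zero_add]
    abel

theorem d_add (φ ψ : Cochain U V) : d (φ + ψ) = d φ + d ψ := by
  funext M N p
  cases p with
  | nil => simp [d]
  | cons p f =>
    simp only [d, Pi.add_apply, Preadditive.add_comp, lowerTerms_add]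
    abel

theorem d_smul (c : ℂ) (φ : Cochain U V) : d (c • φ) = c • d φ := by
  funext M N p
  cases p with
  | nil => simp [d]
  | cons p f =>
    simp only [d, Pi.smul_apply, Linear.smul_comp, lowerTerms_smul, smul_add]

theorem d_id : d (Cochain.id U) = 0 := by
  have key : ∀ {Y : GrMod A'} {M N : GrMod A} (p : Quiver.Path M N),
      lowerTerms U p (fun L (_ : Quiver.Path L N) => (0 : U.obj L ⟶ Y)) = 0 := by
    intro Y M N p
    simpa using lowerTerms_smul p (0 : ℂ) (fun L (_ : Quiver.Path L N) => (0 : U.obj L ⟶ Y))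
  funext M N p
  cases p with
  | nil => simp [d]
  | cons p f =>
    cases p with
    | nil => simp [d, lowerTerms, Cochain.id]
    | cons p g => simp [d, lowerTerms, Cochain.id, key]

/-- The differential as a linear map. -/
def dLin (U V : GrMod A ⥤ GrMod A') : Cochain U V →ₗ[ℂ] Cochain U V where
  toFun := d
  map_add' := d_add
  map_smul' := d_smul

namespace IsFusionMorphism

theorem add {φ ψ : Cochain U V} (hφ : IsFusionMorphism W' W φ) (hψ : IsFusionMorphism W' W ψ) :
    IsFusionMorphism W' W (φ + ψ) where
  bounded := by
    obtain ⟨n, hn⟩ := hφ.bounded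
    obtain ⟨k, hk⟩ := hψ.bounded
    refine ⟨max n k, fun M N p hp => ?_⟩
    simp only [Pi.add_apply]
    rw [hn p (le_trans (le_max_left _ _) hp), hk p (le_trans (le_max_right _ _) hp), add_zero]
  map_add L M N P p f g q := by
    simp only [Pi.add_apply]
    rw [hφ.map_add, hψ.map_add]; abel
  map_smul L M N P p c f q := by
    simp only [Pi.add_apply, smul_add]
    rw [hφ.map_smul, hψ.map_smul]
  map_one L M P p q := by
    simp only [Pi.add_apply]
    rw [hφ.map_one, hψ.map_one, add_zero]
  map_potential L M N P p f q := by
    simp only [Pi.add_apply, smul_add]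
    rw [hφ.map_potential, hψ.map_potential]
  map_slide L M N P S p f g q := by
    simp only [Pi.add_apply]
    rw [hφ.map_slide, hψ.map_slide]
  map_last L M N p f := by
    simp only [Pi.add_apply, Preadditive.add_comp]
    rw [hφ.map_last, hψ.map_last]
  map_first M N P f q := by
    simp only [Pi.add_apply, Preadditive.comp_add]
    rw [hφ.map_first, hψ.map_first]
  map_nil M := by
    simp only [Pi.add_apply, Preadditive.add_comp, Preadditive.comp_add]
    rw [hφ.map_nil, hψ.map_nil]

theorem smul (c : ℂ) {φ : Cochain U V} (hφ : IsFusionMorphism W' W φ) :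
    IsFusionMorphism W' W (c • φ) where
  bounded := by
    obtain ⟨n, hn⟩ := hφ.bounded
    refine ⟨n, fun M N p hp => ?_⟩
    simp only [Pi.smul_apply]
    rw [hn p hp, smul_zero]
  map_add L M N P p f g q := by
    simp only [Pi.smul_apply]
    rw [hφ.map_add, smul_add]
  map_smul L M N P p e f q := by
    simp only [Pi.smul_apply]
    rw [hφ.map_smul, smul_comm]
  map_one L M P p q := by
    simp only [Pi.smul_apply]
    rw [hφ.map_one, smul_zero]
  map_potential L M N P p f q := by
    simp only [Pi.smul_apply, GrMod.complex_smul]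
    rw [hφ.map_potential, smul_comm]
  map_slide L M N P S p f g q := by
    simp only [Pi.smul_apply]
    rw [hφ.map_slide]
  map_last L M N p f := by
    simp only [Pi.smul_apply, Linear.smul_comp]
    rw [hφ.map_last]
  map_first M N P f q := by
    simp only [Pi.smul_apply, Linear.comp_smul]
    rw [hφ.map_first]
  map_nil M := by
    simp only [Pi.smul_apply, Linear.smul_comp, Linear.comp_smul]
    rw [hφ.map_nil]

theorem zero : IsFusionMorphism W' W (0 : Cochain U V) where
  bounded := ⟨0, fun _ _ _ _ => rfl⟩
  map_add _ _ _ _ _ _ _ _ := by simp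
  map_smul _ _ _ _ _ _ _ _ := by simp
  map_one _ _ _ _ _ := by simp
  map_potential _ _ _ _ _ _ _ := by simp
  map_slide _ _ _ _ _ _ _ _ _ := by simp
  map_last _ _ _ _ _ := by simp
  map_first _ _ _ _ _ := by simp
  map_nil _ := by simp

theorem id : IsFusionMorphism W' W (Cochain.id U) where
  bounded := ⟨1, fun _ _ p hp => by cases p <;> simp_all [Cochain.id]⟩
  map_add _ _ _ _ _ _ _ q := by cases q <;> simp [Cochain.id]
  map_smul _ _ _ _ _ _ _ q := by cases q <;> simp [Cochain.id]
  map_one _ _ _ _ q := by cases q <;> simp [Cochain.id]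
  map_potential _ _ _ _ _ _ q := by cases q <;> simp [Cochain.id]
  map_slide _ _ _ _ _ _ _ _ q := by cases q <;> simp [Cochain.id]
  map_last _ _ _ _ _ := by simp [Cochain.id]
  map_first _ _ _ _ q := by cases q <;> simp [Cochain.id]
  map_nil _ := by simp [Cochain.id]

theorem alternate {φ : Cochain U V} (hφ : IsFusionMorphism W' W φ) :
    IsFusionMorphism W' W φ.alternate where
  bounded := by
    obtain ⟨n, hn⟩ := hφ.bounded
    refine ⟨n, fun M N p hp => ?_⟩
    simp only [Cochain.alternate]
    rw [hn p hp, smul_zero]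
  map_add L M N P p f g q := by
    simp only [Cochain.alternate, Quiver.Path.length_comp, Quiver.Path.length_cons]
    rw [hφ.map_add, smul_add]
  map_smul L M N P p e f q := by
    simp only [Cochain.alternate, Quiver.Path.length_comp, Quiver.Path.length_cons]
    rw [hφ.map_smul, smul_comm]
  map_one L M P p q := by
    simp only [Cochain.alternate, Quiver.Path.length_comp, Quiver.Path.length_cons]
    rw [hφ.map_one, smul_zero]
  map_potential L M N P p f q := by
    simp only [Cochain.alternate, Quiver.Path.length_comp, Quiver.Path.length_cons]
    rw [hφ.map_potential, smul_comm]
  map_slide L M N P S p f g q := by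
    simp only [Cochain.alternate, Quiver.Path.length_comp, Quiver.Path.length_cons]
    rw [hφ.map_slide]
  map_last L M N p f := by
    simp only [Cochain.alternate, Quiver.Path.length_cons, Linear.smul_comp]
    rw [hφ.map_last]
  map_first M N P f q := by
    simp only [Cochain.alternate, Quiver.Path.length_comp, Quiver.Path.length_cons, Linear.comp_smul]
    rw [hφ.map_first]
  map_nil M := by
    simp only [Cochain.alternate, Linear.smul_comp, Linear.comp_smul]
    rw [hφ.map_nil]

theorem comp {φ : Cochain U V} {ψ : Cochain V T} (hφ : IsFusionMorphism W' W φ)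
    (hψ : IsFusionMorphism W' W ψ) : IsFusionMorphism W' W (φ.comp ψ) where
  bounded := by
    obtain ⟨n, hn⟩ := hφ.bounded
    obtain ⟨k, hk⟩ := hψ.bounded
    have key : ∀ {Y : GrMod A'} {M N : GrMod A} (p : Quiver.Path M N) (k : ℕ)
        (χ : ∀ ⦃L : GrMod A⦄, Quiver.Path L N → (V.obj L ⟶ Y)),
        (∀ ⦃L⦄ (q : Quiver.Path L N), k ≤ q.length → χ q = 0) → n + k ≤ p.length →
        compAux φ p χ = 0 := by
      intro Y M N p
      induction p with
      | nil =>
        intro k χ hχ h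
        simp only [Quiver.Path.length_nil] at h
        simp [compAux, hn .nil (by simp; omega)]
      | cons p f ih =>
        intro k χ hχ h
        simp only [Quiver.Path.length_cons] at h
        simp only [compAux]
        rw [hn (p.cons f) (by simp; omega), Limits.zero_comp, zero_add]
        rcases Nat.eq_zero_or_pos k with rfl | hk
        · have : (fun L (q : Quiver.Path L _) => χ (q.cons f)) = fun _ _ => 0 := by
            funext L q
            exact hχ _ (Nat.zero_le _)
          rw [this, compAux_zero]
        · exact ih (k - 1) (fun _ q => χ (q.cons f))
            (fun L q hq => hχ _ (by simp; omega)) (by omega)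
    exact ⟨n + k, fun M N p hp => key p k _ (fun L q hq => hk q hq) hp⟩
  map_add L M N P p f g q := by
    have key : ∀ {Y : GrMod A'} {P : GrMod A} (q : Quiver.Path N P)
        (χ : ∀ ⦃S : GrMod A⦄, Quiver.Path S P → (V.obj S ⟶ Y)),
        (∀ ⦃S⦄ (p : Quiver.Path S M), χ ((p.cons (f + g)).comp q) =
          χ ((p.cons f).comp q) + χ ((p.cons g).comp q)) →
        compAux φ ((p.cons (f + g)).comp q) χ =
          compAux φ ((p.cons f).comp q) χ + compAux φ ((p.cons g).comp q) χ := by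
      intro Y P q
      induction q with
      | nil =>
        intro χ hχ
        simp only [Quiver.Path.comp_nil, compAux] at hχ ⊢
        have h := hφ.map_add p f g .nil
        simp only [Quiver.Path.comp_nil] at h
        simp only [h, hχ, compAux_add, Preadditive.add_comp]
        abel
      | cons q e ih =>
        intro χ hχ
        simp only [Quiver.Path.comp_cons, compAux]
        have h := hφ.map_add p f g (q.cons e)
        simp only [Quiver.Path.comp_cons] at h
        rw [h, ih (fun _ q => χ (q.cons e)) (fun S p => by simpa using hχ p), Preadditive.add_comp]
        abel
    exact key q _ (fun S p => hψ.map_add p f g q)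
  map_smul L M N P p c f q := by
    have key : ∀ {Y : GrMod A'} {P : GrMod A} (q : Quiver.Path N P)
        (χ : ∀ ⦃S : GrMod A⦄, Quiver.Path S P → (V.obj S ⟶ Y)),
        (∀ ⦃S⦄ (p : Quiver.Path S M), χ ((p.cons (c • f)).comp q) = c • χ ((p.cons f).comp q)) →
        compAux φ ((p.cons (c • f)).comp q) χ = c • compAux φ ((p.cons f).comp q) χ := by
      intro Y P q
      induction q with
      | nil =>
        intro χ hχ
        simp only [Quiver.Path.comp_nil, compAux] at hχ ⊢
        have h := hφ.map_smul p c f .nil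
        simp only [Quiver.Path.comp_nil] at h
        simp only [h, hχ, compAux_smul, Linear.smul_comp, smul_add]
      | cons q e ih =>
        intro χ hχ
        simp only [Quiver.Path.comp_cons, compAux]
        have h := hφ.map_smul p c f (q.cons e)
        simp only [Quiver.Path.comp_cons] at h
        rw [h, ih (fun _ q => χ (q.cons e)) (fun S p => by simpa using hχ p), Linear.smul_comp,
          smul_add]
    exact key q _ (fun S p => hψ.map_smul p c f q)
  map_one L M P p q := by
    have key : ∀ {Y : GrMod A'} {P : GrMod A} (q : Quiver.Path M P)
        (χ : ∀ ⦃S : GrMod A⦄, Quiver.Path S P → (V.obj S ⟶ Y)),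
        (∀ ⦃S⦄ (p : Quiver.Path S M), χ ((p.cons (𝟙 M)).comp q) = 0) →
        compAux φ ((p.cons (𝟙 M)).comp q) χ = 0 := by
      intro Y P q
      induction q with
      | nil =>
        intro χ hχ
        simp only [Quiver.Path.comp_nil, compAux] at hχ ⊢
        have h := hφ.map_one p .nil
        simp only [Quiver.Path.comp_nil] at h
        simp only [h, hχ, compAux_zero, Limits.zero_comp, add_zero]
      | cons q e ih =>
        intro χ hχ
        simp only [Quiver.Path.comp_cons, compAux]
        have h := hφ.map_one p (q.cons e)
        simp only [Quiver.Path.comp_cons] at h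
        rw [h, ih (fun _ q => χ (q.cons e)) (fun S p => by simpa using hχ p), Limits.zero_comp,
          add_zero]
    exact key q _ (fun S p => hψ.map_one p q)
  map_potential L M N P p f q := by
    have key : ∀ {Y : GrMod A'} {P : GrMod A} (q : Quiver.Path N P)
        (χ : ∀ ⦃S : GrMod A⦄, Quiver.Path S P → (V.obj S ⟶ Y)),
        (∀ ⦃S⦄ (p : Quiver.Path S M), χ ((p.cons (W • f)).comp q) = W' • χ ((p.cons f).comp q)) →
        compAux φ ((p.cons (W • f)).comp q) χ = W' • compAux φ ((p.cons f).comp q) χ := by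
      intro Y P q
      induction q with
      | nil =>
        intro χ hχ
        simp only [Quiver.Path.comp_nil, compAux] at hχ ⊢
        have h := hφ.map_potential p f .nil
        simp only [Quiver.Path.comp_nil] at h
        simp only [h, hχ, compAux_smul', Linear.smul_comp, smul_add]
      | cons q e ih =>
        intro χ hχ
        simp only [Quiver.Path.comp_cons, compAux]
        have h := hφ.map_potential p f (q.cons e)
        simp only [Quiver.Path.comp_cons] at h
        rw [h, ih (fun _ q => χ (q.cons e)) (fun S p => by simpa using hχ p), Linear.smul_comp,
          smul_add]
    exact key q _ (fun S p => hψ.map_potential p f q)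
  map_slide L M N P S p f g q := by
    have key : ∀ {Y : GrMod A'} {S : GrMod A} (q : Quiver.Path P S)
        (χ : ∀ ⦃X : GrMod A⦄, Quiver.Path X S → (V.obj X ⟶ Y)),
        (∀ ⦃X⦄ (p : Quiver.Path X M), χ (((p.cons (f ≫ N.sgn)).cons g).comp q) =
          χ (((p.cons f).cons (N.sgn ≫ g)).comp q)) →
        (χ ((Quiver.Path.nil.cons (N.sgn ≫ g)).comp q) =
          V.map N.sgn ≫ χ ((Quiver.Path.nil.cons g).comp q)) →
        compAux φ (((p.cons (f ≫ N.sgn)).cons g).comp q) χ =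
          compAux φ (((p.cons f).cons (N.sgn ≫ g)).comp q) χ := by
      intro Y S q
      induction q with
      | nil =>
        intro χ hχ hχ'
        simp only [Quiver.Path.comp_nil, compAux] at hχ hχ' ⊢
        have h := hφ.map_slide p f g .nil
        simp only [Quiver.Path.comp_nil] at h
        simp only [h, hχ, hχ', hφ.map_last, Category.assoc]
      | cons q e ih =>
        intro χ hχ hχ'
        simp only [Quiver.Path.comp_cons, compAux]
        have h := hφ.map_slide p f g (q.cons e)
        simp only [Quiver.Path.comp_cons] at h
        rw [h, ih (fun _ q => χ (q.cons e)) (fun S p => by simpa using hχ p)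
          (by simpa using hχ')]
    exact key q _ (fun S p => hψ.map_slide p f g q) (hψ.map_first g q)
  map_last L M N p f := by
    have h1 : ∀ {S : GrMod A} (q : Quiver.Path S M),
        ψ (q.cons (f ≫ N.sgn)) = ψ (q.cons f) ≫ T.map N.sgn := fun q => hψ.map_last q f
    simp only [Cochain.comp, compAux]
    simp only [h1, compAux_comp, hφ.map_last, Preadditive.add_comp, Category.assoc, hψ.map_nil]
  map_first M N P f q := by
    have key : ∀ {Y : GrMod A'} {P : GrMod A} (q : Quiver.Path N P)
        (χ : ∀ ⦃X : GrMod A⦄, Quiver.Path X P → (V.obj X ⟶ Y)),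
        (χ ((Quiver.Path.nil.cons (M.sgn ≫ f)).comp q) =
          V.map M.sgn ≫ χ ((Quiver.Path.nil.cons f).comp q)) →
        compAux φ ((Quiver.Path.nil.cons (M.sgn ≫ f)).comp q) χ =
          U.map M.sgn ≫ compAux φ ((Quiver.Path.nil.cons f).comp q) χ := by
      intro Y P q
      induction q with
      | nil =>
        intro χ hχ
        simp only [Quiver.Path.comp_nil, compAux] at hχ ⊢
        have h := hφ.map_first f .nil
        simp only [Quiver.Path.comp_nil] at h
        have h2 := hφ.map_nil M
        simp only [h, hχ, Preadditive.comp_add, Category.assoc]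
        rw [← Category.assoc (φ Quiver.Path.nil), ← h2, Category.assoc]
      | cons q e ih =>
        intro χ hχ
        simp only [Quiver.Path.comp_cons, compAux]
        have h := hφ.map_first f (q.cons e)
        simp only [Quiver.Path.comp_cons] at h
        rw [h, ih (fun _ q => χ (q.cons e)) (by simpa using hχ), Preadditive.comp_add,
          Category.assoc]
    exact key q _ (hψ.map_first f q)
  map_nil M := by
    simp only [Cochain.comp, compAux]
    rw [← Category.assoc, hφ.map_nil, Category.assoc, hψ.map_nil, Category.assoc]

end IsFusionMorphism

/-- The morphisms between two `(W', W)`-fusion functors, of all degrees. -/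
def fusionHom {W' : A'} {W : A} (U V : FusionFunctor W' W) :
    Submodule ℂ (Cochain U.functor V.functor) where
  carrier := {φ | IsFusionMorphism W' W φ}
  add_mem' := IsFusionMorphism.add
  zero_mem' := IsFusionMorphism.zero
  smul_mem' c _ h := IsFusionMorphism.smul c h

/-- Closed morphisms. -/
def fusionCocycles {W' : A'} {W : A} (U V : FusionFunctor W' W) :
    Submodule ℂ (Cochain U.functor V.functor) :=
  fusionHom U V ⊓ LinearMap.ker (dLin U.functor V.functor)

/-- Exact morphisms. -/
def fusionCoboundaries {W' : A'} {W : A} (U V : FusionFunctor W' W) :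
    Submodule ℂ (Cochain U.functor V.functor) :=
  (fusionHom U V).map (dLin U.functor V.functor)

/-- The cohomology of the morphism spaces, all degrees together. -/
abbrev fusionCohomology {W' : A'} {W : A} (U V : FusionFunctor W' W) : Type 1 :=
  fusionCocycles U V ⧸ (fusionCoboundaries U V).comap (fusionCocycles U V).subtype

theorem d_alternate (φ : Cochain U V) : d φ.alternate = - (d φ).alternate := by
  have key : ∀ {Y : GrMod A'} {M N : GrMod A} (p : Quiver.Path M N)
      (χ : ∀ ⦃L : GrMod A⦄, Quiver.Path L N → (U.obj L ⟶ Y)),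
      lowerTerms U p (fun _ q => (-1 : ℤ) ^ q.length • χ q) =
        - ((-1 : ℤ) ^ p.length • lowerTerms U p χ) := by
    intro Y M N p
    induction p with
    | nil => intro χ; simp [lowerTerms]
    | cons p f ih =>
      intro χ
      cases p with
      | nil => simp [lowerTerms]
      | cons p g =>
        have h := ih (fun _ q => (-1 : ℤ) • χ (q.cons f))
        have h2 := lowerTerms_smul (U := U) (p.cons g) (-1 : ℂ) (fun _ q => χ (q.cons f))
        simp only [neg_smul, one_smul] at h h2
        simp only [lowerTerms, Quiver.Path.length_cons, pow_succ, mul_neg, mul_one, neg_smul, neg_neg,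
          smul_neg, smul_sub] at h ⊢
        rw [h2] at h
        simp only [smul_neg] at h
        rw [h]
        abel
  funext M N p
  cases p with
  | nil => simp [d, Cochain.alternate]
  | cons p f =>
    have h := key (p.cons f) (fun _ q => φ q)
    simp only [d, Cochain.alternate, Pi.neg_apply]
    rw [h]
    simp only [Quiver.Path.length_cons, pow_succ, mul_neg, mul_one, neg_smul, smul_add, Linear.smul_comp]
    abel

theorem Cochain.add_comp (φ φ' : Cochain U V) (ψ : Cochain V T) :
    (φ + φ').comp ψ = φ.comp ψ + φ'.comp ψ := by
  funext M N p
  exact compAux_add_left φ φ' p _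

theorem Cochain.comp_add (φ : Cochain U V) (ψ ψ' : Cochain V T) :
    φ.comp (ψ + ψ') = φ.comp ψ + φ.comp ψ' := by
  funext M N p
  exact compAux_add φ p _ _

theorem Cochain.zero_comp (ψ : Cochain V T) : (0 : Cochain U V).comp ψ = 0 := by
  funext M N p
  exact compAux_zero_left p _

theorem Cochain.comp_zero (φ : Cochain U V) : φ.comp (0 : Cochain V T) = 0 := by
  funext M N p
  exact compAux_zero φ p

theorem Cochain.alternate_alternate (φ : Cochain U V) : φ.alternate.alternate = φ := by
  funext M N p
  simp only [Cochain.alternate, smul_smul]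
  rw [← mul_pow]; simp

section Cohomology

variable {W' : A'} {W : A} {U V T : FusionFunctor W' W}

/-- Composition of closed morphisms. -/
def cocycleComp (φ : fusionCocycles U V) (ψ : fusionCocycles V T) : fusionCocycles U T :=
  ⟨φ.1.comp ψ.1, φ.2.1.comp ψ.2.1, by
    have h1 : d φ.1 = 0 := φ.2.2
    have h2 : d ψ.1 = 0 := ψ.2.2
    change d _ = 0
    rw [d_comp, h1, h2, Cochain.zero_comp, Cochain.comp_zero, add_zero]⟩

/-- Composition of cohomology classes. -/
def cohomologyComp : fusionCohomology U V → fusionCohomology V T → fusionCohomology U T :=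
  Quotient.map₂ cocycleComp (by
    intro φ φ' h ψ ψ' h'
    replace h := (Submodule.quotientRel_def _).1 h
    replace h' := (Submodule.quotientRel_def _).1 h'
    refine (Submodule.quotientRel_def _).2 ?_
    obtain ⟨χ, hχ, e⟩ := h
    obtain ⟨χ', hχ', e'⟩ := h'
    have h1 : d φ'.1 = 0 := φ'.2.2
    have h2 : d ψ.1 = 0 := ψ.2.2
    replace e : d χ = φ.1 - φ'.1 := e
    replace e' : d χ' = ψ.1 - ψ'.1 := e'
    have e1 : φ.1 = d χ + φ'.1 := by rw [e]; abel
    have e2 : ψ.1 = d χ' + ψ'.1 := by rw [e']; abel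
    refine ⟨χ.comp ψ.1.alternate + φ'.1.comp χ', ?_, ?_⟩
    · exact (IsFusionMorphism.comp hχ (IsFusionMorphism.alternate ψ.2.1)).add
        (IsFusionMorphism.comp φ'.2.1 hχ')
    · change d _ = φ.1.comp ψ.1 - φ'.1.comp ψ'.1
      rw [d_add, d_comp, d_comp, d_alternate, h1, h2, Cochain.alternate_alternate]
      have : -(Cochain.alternate (0 : Cochain V.functor T.functor)) = 0 := by
        funext M N p; simp [Cochain.alternate]
      rw [this, Cochain.comp_zero, Cochain.zero_comp, e1, Cochain.add_comp, zero_add, add_zero]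
      conv_rhs => rw [e2]
      rw [Cochain.comp_add, e2]
      simp only [Cochain.comp_add]
      abel)

end Cohomology

/-- The cohomology category of `(W', W)`-fusion functors. -/
def HFF (W' : A') (W : A) : Type 1 := FusionFunctor W' W

instance (W' : A') (W : A) : Category (HFF W' W) where
  Hom U V := fusionCohomology (W' := W') (W := W) U V
  id U := Submodule.Quotient.mk ⟨Cochain.id _, IsFusionMorphism.id, d_id⟩
  comp f g := cohomologyComp f g
  id_comp := by
    rintro U V ⟨φ⟩
    exact congrArg (Quotient.mk _) (Subtype.ext (Cochain.id_comp φ.1))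
  comp_id := by
    rintro U V ⟨φ⟩
    exact congrArg (Quotient.mk _) (Subtype.ext (Cochain.comp_id φ.1))
  assoc := by
    rintro U V T S ⟨φ⟩ ⟨ψ⟩ ⟨χ⟩
    exact congrArg (Quotient.mk _) (Subtype.ext (Cochain.comp_assoc φ.1 ψ.1 χ.1))

end Lemmas

end Functors

section MF

variable {A B : Type} [CommRing A] [CommRing B] [Algebra ℂ A] [Algebra ℂ B]

/-- A finite-rank `(W', W)`-matrix factorization; `(A, B)`-bimodules are `A ⊗ B`-modules. -/
structure MatFact (W' : A) (W : B) : Type 1 where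
  carrier : Type
  [addCommGroup : AddCommGroup carrier]
  [module : Module (A ⊗[ℂ] B) carrier]
  [free : Module.Free (A ⊗[ℂ] B) carrier]
  [finite : Module.Finite (A ⊗[ℂ] B) carrier]
  σ : carrier →ₗ[A ⊗[ℂ] B] carrier
  σ_sq : σ ∘ₗ σ = LinearMap.id
  Q : carrier →ₗ[A ⊗[ℂ] B] carrier
  odd : Q ∘ₗ σ + σ ∘ₗ Q = 0
  sq : Q ∘ₗ Q = (W' ⊗ₜ[ℂ] (1 : B) - (1 : A) ⊗ₜ[ℂ] W) • LinearMap.id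

namespace MatFact

attribute [instance] addCommGroup module free finite

variable {W' : A} {W : B}

/-- Morphisms of matrix factorizations are all module homomorphisms. -/
abbrev Hom (M N : MatFact W' W) : Type := M.carrier →ₗ[A ⊗[ℂ] B] N.carrier

variable {M N P S : MatFact W' W}

/-- Even homomorphisms. -/
def IsEven (φ : M.Hom N) : Prop := N.σ ∘ₗ φ = φ ∘ₗ M.σ

/-- Odd homomorphisms. -/
def IsOdd (φ : M.Hom N) : Prop := N.σ ∘ₗ φ = - (φ ∘ₗ M.σ)

/-- The differential `δ φ = Q_N φ - (σ_N φ σ_M) Q_M`. This is `Q_N φ - φ Q_M` for even `φ` and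
`Q_N φ + φ Q_M` for odd `φ`. -/
def δ (M N : MatFact W' W) : M.Hom N →ₗ[A ⊗[ℂ] B] M.Hom N where
  toFun φ := N.Q ∘ₗ φ - (N.σ ∘ₗ φ ∘ₗ M.σ) ∘ₗ M.Q
  map_add' φ ψ := by
    simp only [LinearMap.comp_add, LinearMap.add_comp]; abel
  map_smul' r φ := by
    simp only [LinearMap.comp_smul, LinearMap.smul_comp, RingHom.id_apply, smul_sub]

theorem δ_apply (φ : M.Hom N) (m : M.carrier) :
    δ M N φ m = N.Q (φ m) - N.σ (φ (M.σ (M.Q m))) := rfl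

theorem σσ (M : MatFact W' W) (m : M.carrier) : M.σ (M.σ m) = m :=
  LinearMap.congr_fun M.σ_sq m

theorem Qσ (M : MatFact W' W) (m : M.carrier) : M.Q (M.σ m) = - M.σ (M.Q m) :=
  eq_neg_of_add_eq_zero_left (LinearMap.congr_fun M.odd m)

theorem δ_comp (ψ : N.Hom P) (φ : M.Hom N) :
    δ M P (ψ ∘ₗ φ) = δ N P ψ ∘ₗ φ + (P.σ ∘ₗ ψ ∘ₗ N.σ) ∘ₗ δ M N φ := by
  ext m
  simp [δ_apply, σσ]

theorem δ_conj (ψ : N.Hom P) : δ N P (P.σ ∘ₗ ψ ∘ₗ N.σ) = - (P.σ ∘ₗ δ N P ψ ∘ₗ N.σ) := by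
  ext m
  simp [δ_apply, σσ, Qσ]
  abel

/-- Cohomology of the morphism spaces, even and odd together. -/
abbrev cohomology (M N : MatFact W' W) : Type :=
  LinearMap.ker (δ M N) ⧸
    (LinearMap.range (δ M N)).comap (LinearMap.ker (δ M N)).subtype

/-- Composition of closed homomorphisms. -/
def cocycleComp (φ : LinearMap.ker (δ M N))
    (ψ : LinearMap.ker (δ N P)) : LinearMap.ker (δ M P) :=
  ⟨ψ.1 ∘ₗ φ.1, by
    have h1 : δ M N φ.1 = 0 := φ.2
    have h2 : δ N P ψ.1 = 0 := ψ.2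
    change δ M P _ = 0
    rw [δ_comp, h1, h2, LinearMap.zero_comp, LinearMap.comp_zero, add_zero]⟩

/-- Composition of cohomology classes. -/
def cohomologyComp : cohomology M N → cohomology N P → cohomology M P :=
  Quotient.map₂ cocycleComp (by
    intro φ φ' h ψ ψ' h'
    replace h := (Submodule.quotientRel_def _).1 h
    replace h' := (Submodule.quotientRel_def _).1 h'
    refine (Submodule.quotientRel_def _).2 ?_
    obtain ⟨χ, e⟩ := h
    obtain ⟨χ', e'⟩ := h'
    have h1 : δ M N φ.1 = 0 := φ.2
    have h2 : δ N P ψ'.1 = 0 := ψ'.2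
    replace e : δ M N χ = φ.1 - φ'.1 := e
    replace e' : δ N P χ' = ψ.1 - ψ'.1 := e'
    have h3 : δ N P (P.σ ∘ₗ ψ'.1 ∘ₗ N.σ) = 0 := by rw [δ_conj, h2]; simp
    have h4 : P.σ ∘ₗ (P.σ ∘ₗ ψ'.1 ∘ₗ N.σ) ∘ₗ N.σ = ψ'.1 := by
      ext m; simp [σσ]
    refine ⟨χ' ∘ₗ φ.1 + (P.σ ∘ₗ ψ'.1 ∘ₗ N.σ) ∘ₗ χ, ?_⟩
    change δ M P _ = ψ.1 ∘ₗ φ.1 - ψ'.1 ∘ₗ φ'.1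
    rw [_root_.map_add, δ_comp, δ_comp, h3, h4, h1, e, e']
    ext m
    simp)

/-- The class of the identity. -/
def cohomologyId (M : MatFact W' W) : cohomology M M :=
  Submodule.Quotient.mk ⟨LinearMap.id, by
    ext m
    simp [δ_apply, σσ]⟩

end MatFact

/-- The cohomology category of finite-rank `(W', W)`-matrix factorizations. -/
def Hmf (W' : A) (W : B) : Type 1 := MatFact W' W

instance (W' : A) (W : B) : Category (Hmf W' W) where
  Hom M N := MatFact.cohomology (W' := W') (W := W) M N
  id M := MatFact.cohomologyId M
  comp f g := MatFact.cohomologyComp f g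
  id_comp := by rintro M N ⟨φ⟩; rfl
  comp_id := by rintro M N ⟨φ⟩; rfl
  assoc := by rintro M N P S ⟨φ⟩ ⟨ψ⟩ ⟨χ⟩; rfl

end MF

section Extension

open Polynomial

variable {A A' : Type} [CommRing A] [CommRing A'] [Algebra ℂ A] [Algebra ℂ A']

/-- The `(A, ℂ[x̃])`-bimodule `M ⊗ ℂ[x̃]`, as the base change of `M` to `A ⊗ ℂ[x̃]`. -/
def Bi (M : GrMod A) : Type := (A ⊗[ℂ] ℂ[X]) ⊗[A] M.carrier

noncomputable instance (M : GrMod A) : AddCommGroup (Bi M) :=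
  inferInstanceAs (AddCommGroup ((A ⊗[ℂ] ℂ[X]) ⊗[A] M.carrier))

noncomputable instance (M : GrMod A) : Module (A ⊗[ℂ] ℂ[X]) (Bi M) :=
  inferInstanceAs (Module (A ⊗[ℂ] ℂ[X]) ((A ⊗[ℂ] ℂ[X]) ⊗[A] M.carrier))

noncomputable instance (M : GrMod A) : Module A (Bi M) :=
  inferInstanceAs (Module A ((A ⊗[ℂ] ℂ[X]) ⊗[A] M.carrier))

noncomputable instance (M : GrMod A) : IsScalarTower A (A ⊗[ℂ] ℂ[X]) (Bi M) :=
  inferInstanceAs (IsScalarTower A (A ⊗[ℂ] ℂ[X]) ((A ⊗[ℂ] ℂ[X]) ⊗[A] M.carrier))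

instance (M : GrMod A) : Module.Free (A ⊗[ℂ] ℂ[X]) (Bi M) :=
  inferInstanceAs (Module.Free (A ⊗[ℂ] ℂ[X]) ((A ⊗[ℂ] ℂ[X]) ⊗[A] M.carrier))

instance (M : GrMod A) : Module.Finite (A ⊗[ℂ] ℂ[X]) (Bi M) :=
  inferInstanceAs (Module.Finite (A ⊗[ℂ] ℂ[X]) ((A ⊗[ℂ] ℂ[X]) ⊗[A] M.carrier))

/-- `M → M ⊗ ℂ[x̃]`, `m ↦ m ⊗ 1`. -/
noncomputable def incl (M : GrMod A) : M.carrier →ₗ[A] Bi M :=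
  TensorProduct.mk A (A ⊗[ℂ] ℂ[X]) M.carrier 1

/-- The inclusion of the first factor. -/
noncomputable def jL (A : Type) [CommRing A] [Algebra ℂ A] : A →+* A ⊗[ℂ] ℂ[X] :=
  Algebra.TensorProduct.includeLeftRingHom

/-- The inclusion of the second factor. -/
noncomputable def jR (A : Type) [CommRing A] [Algebra ℂ A] : ℂ[X] →+* A ⊗[ℂ] ℂ[X] :=
  (Algebra.TensorProduct.includeRight : ℂ[X] →ₐ[ℂ] A ⊗[ℂ] ℂ[X]).toRingHom

theorem jL_mul_jR (a : A) (p : ℂ[X]) : jL A a * jR A p = a ⊗ₜ[ℂ] p := by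
  change (a ⊗ₜ[ℂ] 1) * (1 ⊗ₜ[ℂ] p) = _
  rw [Algebra.TensorProduct.tmul_mul_tmul, mul_one, one_mul]

theorem jR_C (c : ℂ) : jR A (C c) = jL A (algebraMap ℂ A c) := by
  change (1 : A) ⊗ₜ[ℂ] (algebraMap ℂ ℂ[X] c) = algebraMap ℂ A c ⊗ₜ[ℂ] 1
  rw [Algebra.algebraMap_eq_smul_one, Algebra.algebraMap_eq_smul_one, TensorProduct.smul_tmul]

theorem bi_induction {M : GrMod A} {motive : Bi M → Prop} (zero : motive 0)
    (add : ∀ x y, motive x → motive y → motive (x + y))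
    (smul : ∀ (a : A) (p : ℂ[X]) m, motive ((jL A a * jR A p) • incl M m)) (z : Bi M) : motive z := by
  have e : ∀ (t : A ⊗[ℂ] ℂ[X]) (m : M.carrier),
      (t ⊗ₜ[A] m : (A ⊗[ℂ] ℂ[X]) ⊗[A] M.carrier) = t • (incl M m : Bi M) := by
    intro t m
    have := TensorProduct.smul_tmul' (R := A) t (1 : A ⊗[ℂ] ℂ[X]) m
    rw [smul_eq_mul, mul_one] at this
    exact this.symm
  refine TensorProduct.induction_on (motive := motive) z zero (fun t m => ?_) add
  rw [e]
  refine TensorProduct.induction_on (motive := fun t => motive (t • incl M m)) t ?_ ?_ ?_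
  · exact Eq.mpr (congrArg motive (zero_smul (A ⊗[ℂ] ℂ[X]) (incl M m))) zero
  · intro a p
    rw [← jL_mul_jR]
    exact smul a p m
  · intro x y hx hy
    exact Eq.mpr (congrArg motive (add_smul x y (incl M m))) (add _ _ hx hy)

theorem bi_hom_ext {M : GrMod A} {Z : Type} [AddCommGroup Z] [Module (A ⊗[ℂ] ℂ[X]) Z]
    {F G : Bi M →ₗ[A ⊗[ℂ] ℂ[X]] Z} (h : ∀ m, F (incl M m) = G (incl M m)) : F = G := by
  refine LinearMap.ext fun z => ?_
  induction z using bi_induction with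
  | zero => rw [map_zero, map_zero]
  | add x y hx hy => rw [map_add, map_add, hx, hy]
  | smul a p m => rw [map_smul, map_smul, h]

/-- `f ⊗ 1`. -/
noncomputable def bi {M N : GrMod A} (f : M ⟶ N) : Bi M →ₗ[A ⊗[ℂ] ℂ[X]] Bi N :=
  LinearMap.baseChange (A ⊗[ℂ] ℂ[X]) (GrMod.lin f)

/-- The power `x̃ ^ k` of the second variable. -/
noncomputable def xt (A : Type) [CommRing A] [Algebra ℂ A] (k : ℕ) : A ⊗[ℂ] ℂ[X] :=
  jR A (X ^ k)

theorem xt_eq (k : ℕ) : xt A k = jR A (X ^ k) := rfl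

theorem xt_add (k l : ℕ) : xt A (k + l) = xt A k * xt A l := by
  rw [xt_eq, xt_eq, xt_eq, pow_add, map_mul]

theorem xt_zero : xt A 0 = 1 := by
  rw [xt_eq, pow_zero, map_one]

/-- The coefficient of `x̃ ^ k`, as a map `M ⊗ ℂ[x̃] → M`. -/
noncomputable def biCoeff (M : GrMod A) (k : ℕ) : Bi M →ₗ[A] M.carrier :=
  (TensorProduct.lid A M.carrier).toLinearMap ∘ₗ LinearMap.rTensor M.carrier
    ((TensorProduct.AlgebraTensorModule.rid ℂ A A).toLinearMap ∘ₗ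
      TensorProduct.AlgebraTensorModule.map (LinearMap.id : A →ₗ[A] A) (lcoeff ℂ k))

theorem biCoeff_smul_incl (M : GrMod A) (k : ℕ) (a : A) (p : ℂ[X]) (m : M.carrier) :
    biCoeff M k ((jL A a * jR A p) • incl M m) = (p.coeff k • a) • m := by
  rw [jL_mul_jR]
  have : (a ⊗ₜ[ℂ] p : A ⊗[ℂ] ℂ[X]) • incl M m =
    ((a ⊗ₜ[ℂ] p) ⊗ₜ m : (A ⊗[ℂ] ℂ[X]) ⊗[A] M.carrier) := by
    have := TensorProduct.smul_tmul' (R := A) (a ⊗ₜ[ℂ] p) (1 : A ⊗[ℂ] ℂ[X]) m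
    rw [smul_eq_mul, mul_one] at this
    exact this
  rw [this]
  change (TensorProduct.lid A M.carrier) ((LinearMap.rTensor M.carrier _) ((a ⊗ₜ[ℂ] p) ⊗ₜ m)) = _
  rw [LinearMap.rTensor_tmul, TensorProduct.lid_tmul]
  simp

theorem bi_incl {M N : GrMod A} (f : M ⟶ N) (m : M.carrier) :
    bi f (incl M m) = incl N (GrMod.lin f m) := rfl

theorem bi_id (M : GrMod A) : bi (𝟙 M) = LinearMap.id := bi_hom_ext fun _ => rfl

theorem bi_comp {M N P : GrMod A} (f : M ⟶ N) (g : N ⟶ P) : bi (f ≫ g) = bi g ∘ₗ bi f :=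
  bi_hom_ext fun _ => rfl

theorem bi_add {M N : GrMod A} (f g : M ⟶ N) : bi (f + g) = bi f + bi g :=
  bi_hom_ext fun m => map_add (incl N) (GrMod.lin f m) (GrMod.lin g m)

theorem bi_zero (M N : GrMod A) : bi (0 : M ⟶ N) = 0 :=
  bi_hom_ext fun _ => map_zero (incl N)

theorem bi_neg {M N : GrMod A} (f : M ⟶ N) : bi (-f) = - bi f :=
  bi_hom_ext fun m => map_neg (incl N) (GrMod.lin f m)

theorem incl_smul (M : GrMod A) (a : A) (m : M.carrier) :
    incl M (a • m) = jL A a • incl M m := by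
  rw [map_smul, ← one_smul (A ⊗[ℂ] ℂ[X]) (incl M m), ← smul_assoc, smul_smul, mul_one]
  congr 1
  exact (Algebra.smul_def a (1 : A ⊗[ℂ] ℂ[X])).trans (mul_one _)

theorem bi_smul {M N : GrMod A} (a : A) (f : M ⟶ N) :
    bi (a • f) = jL A a • bi f :=
  bi_hom_ext fun m => incl_smul N a (GrMod.lin f m)

theorem exists_biCoeff_bound {M : GrMod A} (z : Bi M) :
    ∃ n, (∀ k, n ≤ k → biCoeff M k z = 0) ∧
      z = ∑ k ∈ Finset.range n, xt A k • incl M (biCoeff M k z) := by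
  suffices h : ∃ n, ∀ l, n ≤ l → (∀ k, l ≤ k → biCoeff M k z = 0) ∧
      z = ∑ k ∈ Finset.range l, xt A k • incl M (biCoeff M k z) by
    obtain ⟨n, hn⟩ := h
    exact ⟨n, hn n le_rfl⟩
  induction z using bi_induction with
  | zero => exact ⟨0, fun l _ => ⟨fun k _ => map_zero _, by simp⟩⟩
  | add y z hy hz =>
    obtain ⟨n, hn⟩ := hy
    obtain ⟨k, hk⟩ := hz
    refine ⟨max n k, fun l hl => ?_⟩
    obtain ⟨h1, h2⟩ := hn l (le_trans (le_max_left _ _) hl)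
    obtain ⟨h3, h4⟩ := hk l (le_trans (le_max_right _ _) hl)
    refine ⟨fun j hj => by rw [map_add, h1 j hj, h3 j hj, add_zero], ?_⟩
    conv_lhs => rw [h2, h4]
    rw [← Finset.sum_add_distrib]
    simp only [map_add, smul_add]
  | smul a p m =>
    refine ⟨p.natDegree + 1, fun l hl => ⟨fun k hk => ?_, ?_⟩⟩
    · rw [biCoeff_smul_incl, coeff_eq_zero_of_natDegree_lt (by omega), zero_smul, zero_smul]
    · conv_lhs => rw [p.as_sum_range' l (by omega)]
      rw [map_sum, Finset.mul_sum, Finset.sum_smul]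
      refine Finset.sum_congr rfl fun k _ => ?_
      rw [biCoeff_smul_incl, incl_smul, smul_smul, xt_eq, Algebra.smul_def, map_mul, ← jR_C,
        ← C_mul_X_pow_eq_monomial, map_mul]
      congr 1
      ring

variable {M N P : GrMod A}

/-- The coefficient of `x̃ ^ k` in a homomorphism of bimodules. -/
noncomputable def coeffHom (F : Bi M →ₗ[A ⊗[ℂ] ℂ[X]] Bi N) (k : ℕ) : M ⟶ N :=
  GrMod.ofLin (biCoeff N k ∘ₗ F.restrictScalars A ∘ₗ incl M)

theorem exists_coeffHom_bound (F : Bi M →ₗ[A ⊗[ℂ] ℂ[X]] Bi N) :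
    ∃ n, ∀ k, coeffHom F k ≠ 0 → k ∈ Finset.range n := by
  obtain ⟨s, hs⟩ := (inferInstance : Module.Finite A M.carrier).fg_top
  choose b hb _ using fun m : M.carrier => exists_biCoeff_bound (F (incl M m))
  refine ⟨s.sup b, fun k hk => ?_⟩
  by_contra hlt
  rw [Finset.mem_range, not_lt] at hlt
  apply hk
  have : GrMod.lin (coeffHom F k) = 0 := by
    apply LinearMap.ext_on hs
    intro m hm
    exact hb m k (le_trans (Finset.le_sup hm) hlt)
  exact this

/-- The coefficients of a homomorphism of bimodules; `F = ∑ k, x̃ ^ k • (coeffs F k ⊗ 1)`. -/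
noncomputable def coeffs (F : Bi M →ₗ[A ⊗[ℂ] ℂ[X]] Bi N) : ℕ →₀ (M ⟶ N) :=
  Finsupp.onFinset (Finset.range (exists_coeffHom_bound F).choose) (coeffHom F)
    (exists_coeffHom_bound F).choose_spec

/-- `∑ k, x̃ ^ k • g (F_k)` where `F = ∑ k, x̃ ^ k • (F_k ⊗ 1)`. -/
noncomputable def expand {Z : Type} [AddCommGroup Z] [Module (A' ⊗[ℂ] ℂ[X]) Z]
    (F : Bi M →ₗ[A ⊗[ℂ] ℂ[X]] Bi N) (g : (M ⟶ N) → Z) : Z :=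
  (coeffs F).sum fun k f => xt A' k • g f

theorem coeffs_apply (F : Bi M →ₗ[A ⊗[ℂ] ℂ[X]] Bi N) (k : ℕ) : coeffs F k = coeffHom F k := rfl

theorem coeffs_add (F G : Bi M →ₗ[A ⊗[ℂ] ℂ[X]] Bi N) :
    coeffs (F + G) = coeffs F + coeffs G := by
  ext k
  change coeffHom (F + G) k = coeffHom F k + coeffHom G k
  refine LinearMap.ext fun m => ?_
  exact map_add (biCoeff N k) (F (incl M m)) (G (incl M m))

theorem coeffs_xt_smul_bi (k : ℕ) (f : M ⟶ N) :
    coeffs (xt A k • bi f) = Finsupp.single k f := by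
  ext l
  rw [coeffs_apply]
  refine LinearMap.ext fun m => ?_
  change biCoeff N l (xt A k • incl N (GrMod.lin f m)) = _
  rw [xt_eq, ← one_mul (jR A (X ^ k)), ← map_one (jL A), biCoeff_smul_incl, coeff_X_pow]
  by_cases h : l = k
  · subst h; simp; rfl
  · rw [if_neg h, Finsupp.single_eq_of_ne h, zero_smul, zero_smul]; rfl

section
variable {Z : Type} [AddCommGroup Z] [Module (A' ⊗[ℂ] ℂ[X]) Z]

theorem expand_add (F G : Bi M →ₗ[A ⊗[ℂ] ℂ[X]] Bi N) (g : (M ⟶ N) → Z) (h0 : g 0 = 0)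
    (hg : ∀ a b, g (a + b) = g a + g b) :
    expand (A' := A') (F + G) g = expand (A' := A') F g + expand (A' := A') G g := by
  rw [expand, coeffs_add]
  exact Finsupp.sum_add_index' (fun k => by rw [h0, smul_zero]) (fun k a b => by rw [hg, smul_add])

theorem expand_xt_smul_bi (k : ℕ) (f : M ⟶ N) (g : (M ⟶ N) → Z) (h0 : g 0 = 0) :
    expand (A' := A') (xt A k • bi f) g = xt A' k • g f := by
  rw [expand, coeffs_xt_smul_bi]
  exact Finsupp.sum_single_index (by rw [h0, smul_zero])

theorem expand_bi_left (f : M ⟶ N) (g : (M ⟶ N) → Z) (h0 : g 0 = 0) :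
    expand (A' := A') (bi f) g = g f := by
  have := expand_xt_smul_bi (A' := A') 0 f g h0
  have e : xt A 0 • bi f = bi f := by
    refine bi_hom_ext fun m => ?_
    rw [LinearMap.smul_apply, xt_zero, one_smul]
  rwa [e, xt_zero, one_smul] at this

theorem expand_zero (g : (M ⟶ N) → Z) (h0 : g 0 = 0) :
    expand (A' := A') (0 : Bi M →ₗ[A ⊗[ℂ] ℂ[X]] Bi N) g = 0 := by
  rw [← bi_zero, expand_bi_left _ _ h0, h0]

theorem expand_sum {ι : Type} (s : Finset ι) (F : ι → (Bi M →ₗ[A ⊗[ℂ] ℂ[X]] Bi N))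
    (g : (M ⟶ N) → Z) (h0 : g 0 = 0) (hg : ∀ a b, g (a + b) = g a + g b) :
    expand (A' := A') (∑ i ∈ s, F i) g = ∑ i ∈ s, expand (A' := A') (F i) g := by
  classical
  induction s using Finset.induction_on with
  | empty => simpa using expand_zero (A' := A') g h0
  | insert i s hi ih =>
    rw [Finset.sum_insert hi, Finset.sum_insert hi, expand_add (A' := A') _ _ g h0 hg, ih]

theorem expand_add_right (F : Bi M →ₗ[A ⊗[ℂ] ℂ[X]] Bi N) (g h : (M ⟶ N) → Z) :
    expand (A' := A') F (fun f => g f + h f) =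
      expand (A' := A') F g + expand (A' := A') F h := by
  simp only [expand, smul_add]
  exact Finsupp.sum_add

/-- Linear maps may be applied to all terms of an expansion. -/
theorem map_expand {Y : Type} [AddCommGroup Y] [Module (A' ⊗[ℂ] ℂ[X]) Y]
    (L : Z →ₗ[A' ⊗[ℂ] ℂ[X]] Y) (F : Bi M →ₗ[A ⊗[ℂ] ℂ[X]] Bi N) (g : (M ⟶ N) → Z) :
    L (expand (A' := A') F g) = expand (A' := A') F (fun f => L (g f)) := by
  simp only [expand, Finsupp.sum, map_sum, map_smul]

end

theorem expand_bi (F : Bi M →ₗ[A ⊗[ℂ] ℂ[X]] Bi N) : expand (A' := A) F bi = F := by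
  refine bi_hom_ext fun m => ?_
  obtain ⟨n, hn, hm⟩ := exists_biCoeff_bound (F (incl M m))
  rw [expand, Finsupp.sum_of_support_subset (s := (coeffs F).support ∪ Finset.range n) _
    Finset.subset_union_left _ (fun k _ => by rw [bi_zero, smul_zero])]
  rw [LinearMap.sum_apply]
  conv_rhs => rw [hm]
  symm
  refine Finset.sum_subset_zero_on_sdiff Finset.subset_union_right ?_ ?_
  · intro k hk
    rw [Finset.mem_sdiff, Finset.mem_range, not_lt] at hk
    change xt A k • incl N (biCoeff N k (F (incl M m))) = 0
    rw [hn k hk.2, map_zero, smul_zero]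
  · intro k _
    rfl

theorem expand_comp {Z : Type} [AddCommGroup Z] [Module (A' ⊗[ℂ] ℂ[X]) Z]
    (F : Bi M →ₗ[A ⊗[ℂ] ℂ[X]] Bi N) (G : Bi N →ₗ[A ⊗[ℂ] ℂ[X]] Bi P) (g : (M ⟶ P) → Z)
    (h0 : g 0 = 0) (hg : ∀ a b, g (a + b) = g a + g b) :
    expand (A' := A') (G ∘ₗ F) g =
      expand (A' := A') G fun b => expand (A' := A') F fun a => g (a ≫ b) := by
  conv_lhs => rw [← expand_bi F, ← expand_bi G]
  have h1 : expand (A' := A) G bi ∘ₗ expand (A' := A) F bi =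
      ∑ l ∈ (coeffs G).support, ∑ k ∈ (coeffs F).support,
        xt A (l + k) • bi (coeffs F k ≫ coeffs G l) := by
    simp only [expand, Finsupp.sum]
    refine LinearMap.ext fun m => ?_
    simp only [LinearMap.sum_apply, LinearMap.comp_apply, LinearMap.smul_apply, map_sum, map_smul,
      bi_comp, Finset.smul_sum, smul_smul, xt_add]
    rw [Finset.sum_comm]
    refine Finset.sum_congr rfl fun l _ => Finset.sum_congr rfl fun k _ => ?_
    rw [mul_comm]
  rw [h1, expand_sum _ _ g h0 hg]
  rw [expand, Finsupp.sum]
  refine Finset.sum_congr rfl fun l _ => ?_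
  rw [expand_sum _ _ g h0 hg, expand, Finsupp.sum, Finset.smul_sum]
  refine Finset.sum_congr rfl fun k _ => ?_
  rw [expand_xt_smul_bi _ _ g h0, smul_smul, xt_add]

/-- For `ℂ`-linear `g`, extension to `Hom (M, N) ⊗ ℂ[x̃]` is `ℂ[x̃]`-linear. -/
theorem expand_jR_smul_bi {Z : Type} [AddCommGroup Z] [Module (A' ⊗[ℂ] ℂ[X]) Z]
    (p : ℂ[X]) (f : M ⟶ N) (g : (M ⟶ N) → Z)
    (h0 : g 0 = 0) (hg : ∀ a b, g (a + b) = g a + g b)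
    (hs : ∀ (c : ℂ) a, g (c • a) = jL A' (algebraMap ℂ A' c) • g a) :
    expand (A' := A') (jR A p • bi f) g = jR A' p • g f := by
  induction p using Polynomial.induction_on' with
  | add p q hp hq =>
    have : jR A (p + q) • bi f = jR A p • bi f + jR A q • bi f := by
      refine bi_hom_ext fun m => ?_
      rw [LinearMap.add_apply, LinearMap.smul_apply, LinearMap.smul_apply, LinearMap.smul_apply,
        map_add, add_smul]
    rw [this, expand_add _ _ g h0 hg, hp, hq, ← add_smul, map_add]
  | monomial n c =>
    have : jR A (monomial n c) • bi f = xt A n • bi (c • f) := by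
      refine bi_hom_ext fun m => ?_
      rw [GrMod.complex_smul, bi_smul, LinearMap.smul_apply, LinearMap.smul_apply,
        LinearMap.smul_apply, smul_smul, xt_eq, ← jR_C, ← map_mul, X_pow_mul_C,
        C_mul_X_pow_eq_monomial]
    rw [this, expand_xt_smul_bi _ _ g h0, hs, smul_smul, xt_eq, ← jR_C, ← map_mul, X_pow_mul_C,
      C_mul_X_pow_eq_monomial]

end Extension
section Identity

open Polynomial

/-- The graded module `ℂ[x] ⊕ ℂ[x]`, whose second summand is odd. -/
noncomputable def MI : GrMod ℂ[X] where
  carrier := ℂ[X] × ℂ[X]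
  σ := LinearMap.prodMap LinearMap.id (-LinearMap.id)
  σ_sq := by ext <;> simp

/-- The matrix unit `(a, b) ↦ (b, 0)`. -/
noncomputable def E01 : MI ⟶ MI :=
  GrMod.ofLin (LinearMap.inl ℂ[X] ℂ[X] ℂ[X] ∘ₗ LinearMap.snd ℂ[X] ℂ[X] ℂ[X])

/-- The matrix unit `(a, b) ↦ (0, a)`. -/
noncomputable def E10 : MI ⟶ MI :=
  GrMod.ofLin (LinearMap.inr ℂ[X] ℂ[X] ℂ[X] ∘ₗ LinearMap.fst ℂ[X] ℂ[X] ℂ[X])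

/-- The divided difference `(p (x) - p (x̃)) / (x - x̃)`. -/
noncomputable def divDiff (p : ℂ[X]) : ℂ[X] ⊗[ℂ] ℂ[X] :=
  p.sum fun k a => ∑ i ∈ Finset.range k, jL ℂ[X] (C a * X ^ i) * jR ℂ[X] (X ^ (k - 1 - i))

theorem mul_divDiff (p : ℂ[X]) :
    (jL ℂ[X] X - jR ℂ[X] X) * divDiff p = jL ℂ[X] p - jR ℂ[X] p := by
  have h : ∀ (k : ℕ) (a : ℂ), (jL ℂ[X] X - jR ℂ[X] X) *
      (∑ i ∈ Finset.range k, jL ℂ[X] (C a * X ^ i) * jR ℂ[X] (X ^ (k - 1 - i))) =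
      jL ℂ[X] (C a * X ^ k) - jR ℂ[X] (C a * X ^ k) := by
    intro k a
    have : (∑ i ∈ Finset.range k, jL ℂ[X] (C a * X ^ i) * jR ℂ[X] (X ^ (k - 1 - i))) =
        jL ℂ[X] (C a) * ∑ i ∈ Finset.range k, jL ℂ[X] X ^ i * jR ℂ[X] X ^ (k - 1 - i) := by
      rw [Finset.mul_sum]
      refine Finset.sum_congr rfl fun i _ => ?_
      rw [map_mul, map_pow, map_pow, mul_assoc]
    have e : jR ℂ[X] (C a) = jL ℂ[X] (C a) := jR_C a
    rw [this, map_mul, map_mul, e, map_pow, map_pow]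
    have g := (Commute.all (jL ℂ[X] X) (jR ℂ[X] X)).geom_sum₂_mul k
    linear_combination (jL ℂ[X] (C a)) * g
  have h' : (jL ℂ[X] X - jR ℂ[X] X) * divDiff p = ∑ k ∈ p.support,
      (jL ℂ[X] (C (p.coeff k) * X ^ k) - jR ℂ[X] (C (p.coeff k) * X ^ k)) :=
    (Finset.mul_sum _ _ _).trans (Finset.sum_congr rfl fun k _ => h k (p.coeff k))
  rw [h', Finset.sum_sub_distrib, ← map_sum, ← map_sum, ← p.as_sum_support_C_mul_X_pow]

/-- The identity matrix factorization
`I_W = [[0, x - x̃], [(W (x) - W (x̃)) / (x - x̃), 0]]` on `ℂ[x, x̃] ⊕ ℂ[x, x̃]`. -/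
noncomputable def IW (W : ℂ[X]) : Bi MI →ₗ[ℂ[X] ⊗[ℂ] ℂ[X]] Bi MI :=
  (jL ℂ[X] X - jR ℂ[X] X) • bi E01 + divDiff W • bi E10

theorem IW_incl (W : ℂ[X]) (m : MI.carrier) : IW W (incl MI m) =
    (jL ℂ[X] X - jR ℂ[X] X) • incl MI (GrMod.lin E01 m) +
      divDiff W • incl MI (GrMod.lin E10 m) := rfl

theorem E01_E01 (m : MI.carrier) : GrMod.lin E01 (GrMod.lin E01 m) = 0 := rfl

theorem E10_E10 (m : MI.carrier) : GrMod.lin E10 (GrMod.lin E10 m) = 0 := rfl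

theorem E01_E10_add (m : MI.carrier) :
    GrMod.lin E01 (GrMod.lin E10 m) + GrMod.lin E10 (GrMod.lin E01 m) = m := by
  obtain ⟨a, b⟩ := m
  change ((a + 0, 0 + b) : ℂ[X] × ℂ[X]) = (a, b)
  rw [add_zero, zero_add]

theorem sgn_E01 (m : MI.carrier) : GrMod.lin MI.sgn (GrMod.lin E01 m) = GrMod.lin E01 m := by
  obtain ⟨a, b⟩ := m
  change ((b, -0) : ℂ[X] × ℂ[X]) = (b, 0)
  rw [neg_zero]

theorem sgn_E10 (m : MI.carrier) : GrMod.lin MI.sgn (GrMod.lin E10 m) = - GrMod.lin E10 m := by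
  obtain ⟨a, b⟩ := m
  change ((0, -a) : ℂ[X] × ℂ[X]) = (-0, -a)
  rw [neg_zero]

theorem E01_sgn (m : MI.carrier) : GrMod.lin E01 (GrMod.lin MI.sgn m) = - GrMod.lin E01 m := by
  obtain ⟨a, b⟩ := m
  change ((-b, 0) : ℂ[X] × ℂ[X]) = (-b, -0)
  rw [neg_zero]

theorem E10_sgn (m : MI.carrier) : GrMod.lin E10 (GrMod.lin MI.sgn m) = GrMod.lin E10 m := rfl

theorem IW_sq (W : ℂ[X]) :
    IW W ∘ₗ IW W = bi (W • 𝟙 MI) + jR ℂ[X] (-W) • bi (𝟙 MI) := by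
  refine bi_hom_ext fun m => ?_
  have hm := congrArg (incl MI) (E01_E10_add m)
  rw [map_add] at hm
  rw [LinearMap.comp_apply, IW_incl, map_add, map_smul, map_smul, IW_incl, IW_incl,
    LinearMap.add_apply, LinearMap.smul_apply, bi_smul, bi_id, LinearMap.smul_apply,
    E01_E01, E10_E10, map_zero, smul_zero, smul_zero, zero_add, add_zero, smul_smul, smul_smul,
    mul_comm (divDiff W), mul_divDiff, ← smul_add, add_comm (incl MI _), hm, map_neg]
  exact (congrArg (· • incl MI m) (sub_eq_add_neg _ _)).trans (add_smul _ _ _)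

theorem IW_odd (W : ℂ[X]) : bi MI.sgn ∘ₗ IW W = - (IW W ∘ₗ bi MI.sgn) := by
  refine bi_hom_ext fun m => ?_
  rw [LinearMap.comp_apply, LinearMap.neg_apply, LinearMap.comp_apply, bi_incl, IW_incl, IW_incl,
    map_add, map_smul, map_smul, bi_incl, bi_incl, sgn_E01, sgn_E10, E01_sgn, E10_sgn, map_neg,
    map_neg, smul_neg, smul_neg, neg_add, neg_neg]

end Identity
section Expansion

open Polynomial

variable {A A' : Type} [CommRing A] [CommRing A'] [Algebra ℂ A] [Algebra ℂ A']

theorem bi_complex_smul {M N : GrMod A} (c : ℂ) (f : M ⟶ N) :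
    bi (c • f) = jL A (algebraMap ℂ A c) • bi f :=
  bi_smul _ f

theorem coeffs_bi_comp {M N P : GrMod A} (F : Bi M →ₗ[A ⊗[ℂ] ℂ[X]] Bi N) (s : N ⟶ P) (k : ℕ) :
    coeffs (bi s ∘ₗ F) k = coeffs F k ≫ s := by
  refine LinearMap.ext fun m => ?_
  change biCoeff P k (bi s (F (incl M m))) = GrMod.lin s (biCoeff N k (F (incl M m)))
  generalize F (incl M m) = z
  induction z using bi_induction with
  | zero => rw [map_zero, map_zero, map_zero, map_zero]
  | add x y hx hy => rw [map_add, map_add, map_add, map_add, hx, hy]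
  | smul a p m => rw [map_smul, bi_incl, biCoeff_smul_incl, biCoeff_smul_incl, map_smul]

theorem coeffs_comp_bi {M N P : GrMod A} (F : Bi N →ₗ[A ⊗[ℂ] ℂ[X]] Bi P) (s : M ⟶ N) (k : ℕ) :
    coeffs (F ∘ₗ bi s) k = s ≫ coeffs F k := rfl

theorem expand_congr {Z : Type} [AddCommGroup Z] [Module (A' ⊗[ℂ] ℂ[X]) Z] {M N : GrMod A}
    (F : Bi M →ₗ[A ⊗[ℂ] ℂ[X]] Bi N) {g h : (M ⟶ N) → Z} (e : ∀ f, g f = h f) :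
    expand (A' := A') F g = expand (A' := A') F h :=
  congrArg _ (funext e)

theorem expand_smul_right {Z : Type} [AddCommGroup Z] [Module (A' ⊗[ℂ] ℂ[X]) Z] {M N : GrMod A}
    (r : A' ⊗[ℂ] ℂ[X]) (F : Bi M →ₗ[A ⊗[ℂ] ℂ[X]] Bi N) (g : (M ⟶ N) → Z) :
    expand (A' := A') F (fun f => r • g f) = r • expand (A' := A') F g := by
  simp only [expand, Finsupp.sum, Finset.smul_sum]
  exact Finset.sum_congr rfl fun k _ => smul_comm _ _ _

theorem expand_neg_right {Z : Type} [AddCommGroup Z] [Module (A' ⊗[ℂ] ℂ[X]) Z] {M N : GrMod A}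
    (F : Bi M →ₗ[A ⊗[ℂ] ℂ[X]] Bi N) (g : (M ⟶ N) → Z) :
    expand (A' := A') F (fun f => - g f) = - expand (A' := A') F g := by
  simp only [expand, Finsupp.sum, smul_neg, Finset.sum_neg_distrib]

/-- The extension of a functor to bimodules: `U (f ⊗ x̃ ^ k) = U (f) ⊗ x̃ ^ k`. -/
noncomputable def extMap (U : GrMod A ⥤ GrMod A') {M N : GrMod A}
    (F : Bi M →ₗ[A ⊗[ℂ] ℂ[X]] Bi N) : Bi (U.obj M) →ₗ[A' ⊗[ℂ] ℂ[X]] Bi (U.obj N) :=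
  expand (A' := A') F fun f => bi (U.map f)

/-- The extension of a multilinear family to bimodules, evaluated on the sequence `(F, …, F)` of
length `n`: `φ (fₙ ⊗ gₙ, …, f₁ ⊗ g₁) = φ (fₙ, …, f₁) ⊗ gₙ ⋯ g₁`. -/
noncomputable def extEval {M : GrMod A} {X Y : GrMod A'}
    (F : Bi M →ₗ[A ⊗[ℂ] ℂ[X]] Bi M) :
    ℕ → (Quiver.Path M M → (X ⟶ Y)) → (Bi X →ₗ[A' ⊗[ℂ] ℂ[X]] Bi Y)
  | 0, φ => bi (φ .nil)
  | n + 1, φ => expand (A' := A') F fun f => extEval F n fun p => φ (p.cons f)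

section
variable {U V T : GrMod A ⥤ GrMod A'} {M N P : GrMod A} {X Y Z : GrMod A'}
variable (F : Bi M →ₗ[A ⊗[ℂ] ℂ[X]] Bi M)

theorem extEval_add (n : ℕ) (φ ψ : Quiver.Path M M → (X ⟶ Y)) :
    extEval F n (fun p => φ p + ψ p) = extEval F n φ + extEval F n ψ := by
  induction n generalizing φ ψ with
  | zero => exact bi_add _ _
  | succ n ih =>
    simp only [extEval]
    rw [← expand_add_right]
    exact expand_congr F fun f => ih _ _

theorem extEval_smul (n : ℕ) (a : A') (φ : Quiver.Path M M → (X ⟶ Y)) :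
    extEval F n (fun p => a • φ p) = jL A' a • extEval F n φ := by
  induction n generalizing φ with
  | zero => exact bi_smul _ _
  | succ n ih =>
    simp only [extEval]
    rw [← expand_smul_right]
    exact expand_congr F fun f => ih _

theorem extEval_complex_smul (n : ℕ) (c : ℂ) (φ : Quiver.Path M M → (X ⟶ Y)) :
    extEval F n (fun p => c • φ p) = jL A' (algebraMap ℂ A' c) • extEval F n φ :=
  extEval_smul F n _ φ

theorem extEval_zero (n : ℕ) : extEval F n (fun _ => (0 : X ⟶ Y)) = 0 := by
  have := extEval_add F n (fun _ => (0 : X ⟶ Y)) (fun _ => 0)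
  simpa using this

theorem extEval_neg (n : ℕ) (φ : Quiver.Path M M → (X ⟶ Y)) :
    extEval F n (fun p => - φ p) = - extEval F n φ := by
  have := extEval_add F n (fun p => - φ p) φ
  rw [eq_neg_iff_add_eq_zero, ← this, ← extEval_zero F n]
  exact congrArg _ (funext fun p => neg_add_cancel _)

theorem extEval_comp_right (n : ℕ) (φ : Quiver.Path M M → (X ⟶ Y)) (y : Y ⟶ Z) :
    extEval F n (fun p => φ p ≫ y) = bi y ∘ₗ extEval F n φ := by
  induction n generalizing φ with
  | zero => exact bi_comp _ _
  | succ n ih =>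
    simp only [extEval]
    rw [← LinearMap.compRight_apply (S := A' ⊗[ℂ] ℂ[X]), map_expand]
    exact expand_congr F fun f => ih _

theorem extEval_of_length (n : ℕ) (φ ψ : Quiver.Path M M → (X ⟶ Y))
    (h : ∀ p, p.length = n → φ p = ψ p) : extEval F n φ = extEval F n ψ := by
  induction n generalizing φ ψ with
  | zero => exact congrArg bi (h _ rfl)
  | succ n ih =>
    exact expand_congr F fun f => ih _ _ fun p hp => h _ (by rw [Quiver.Path.length_cons, hp])

end

/-- Compatibility of a family of maps with the structure of its arguments. -/
structure Multi (U : GrMod A ⥤ GrMod A') (W' : A') (W : A) {P : GrMod A} {Y : GrMod A'}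
    (φ : ∀ ⦃L : GrMod A⦄, Quiver.Path L P → (U.obj L ⟶ Y)) : Prop where
  map_add : ∀ ⦃L M N : GrMod A⦄ (p : Quiver.Path L M) (f g : M ⟶ N) (q : Quiver.Path N P),
    φ ((p.cons (f + g)).comp q) = φ ((p.cons f).comp q) + φ ((p.cons g).comp q)
  map_smul : ∀ ⦃L M N : GrMod A⦄ (p : Quiver.Path L M) (c : ℂ) (f : M ⟶ N) (q : Quiver.Path N P),
    φ ((p.cons (c • f)).comp q) = c • φ ((p.cons f).comp q)
  map_one : ∀ ⦃L M : GrMod A⦄ (p : Quiver.Path L M) (q : Quiver.Path M P),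
    φ ((p.cons (𝟙 M)).comp q) = 0
  map_potential : ∀ ⦃L M N : GrMod A⦄ (p : Quiver.Path L M) (f : M ⟶ N) (q : Quiver.Path N P),
    φ ((p.cons (W • f)).comp q) = W' • φ ((p.cons f).comp q)
  map_slide : ∀ ⦃L M N S : GrMod A⦄ (p : Quiver.Path L M) (f : M ⟶ N) (g : N ⟶ S)
    (q : Quiver.Path S P),
    φ (((p.cons (f ≫ N.sgn)).cons g).comp q) = φ (((p.cons f).cons (N.sgn ≫ g)).comp q)
  map_first : ∀ ⦃M N : GrMod A⦄ (f : M ⟶ N) (q : Quiver.Path N P),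
    φ ((Quiver.Path.nil.cons (M.sgn ≫ f)).comp q) =
      U.map M.sgn ≫ φ ((Quiver.Path.nil.cons f).comp q)

theorem IsFusionMorphism.multi {U V : GrMod A ⥤ GrMod A'} {W' : A'} {W : A} {φ : Cochain U V}
    (h : IsFusionMorphism W' W φ) (P : GrMod A) :
    Multi U W' W (P := P) (fun L p => φ (M := L) p) where
  map_add _ _ _ p f g q := h.map_add p f g q
  map_smul _ _ _ p c f q := h.map_smul p c f q
  map_one _ _ p q := h.map_one p q
  map_potential _ _ _ p f q := h.map_potential p f q
  map_slide _ _ _ _ p f g q := h.map_slide p f g q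
  map_first _ _ f q := h.map_first f q

theorem Multi.cons {U : GrMod A ⥤ GrMod A'} {W' : A'} {W : A} {P P' : GrMod A} {Y : GrMod A'}
    {φ : ∀ ⦃L : GrMod A⦄, Quiver.Path L P' → (U.obj L ⟶ Y)} (h : Multi U W' W φ) (a : P ⟶ P') :
    Multi U W' W (fun L p => φ (L := L) (p.cons a)) where
  map_add _ _ _ p f g q := h.map_add p f g (q.cons a)
  map_smul _ _ _ p c f q := h.map_smul p c f (q.cons a)
  map_one _ _ p q := h.map_one p (q.cons a)
  map_potential _ _ _ p f q := h.map_potential p f (q.cons a)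
  map_slide _ _ _ _ p f g q := h.map_slide p f g (q.cons a)
  map_first _ _ f q := h.map_first f (q.cons a)

end Expansion

section Contraction

open Polynomial

variable {A' : Type} [CommRing A'] [Algebra ℂ A']
variable {U V T : GrMod ℂ[X] ⥤ GrMod A'} {W' : A'} {W : ℂ[X]}

theorem coeffs_IW_sgn (W : ℂ[X]) (k : ℕ) :
    MI.sgn ≫ coeffs (IW W) k = - (coeffs (IW W) k ≫ MI.sgn) := by
  have h1 := coeffs_bi_comp (IW W) MI.sgn k
  have h2 := coeffs_comp_bi (IW W) MI.sgn k
  have h3 : coeffs (IW W ∘ₗ bi MI.sgn) + coeffs (bi MI.sgn ∘ₗ IW W) = 0 := by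
    rw [← coeffs_add, IW_odd, add_neg_cancel]
    have := coeffs_add (0 : Bi MI →ₗ[ℂ[X] ⊗[ℂ] ℂ[X]] Bi MI) 0
    simpa using this
  have h4 := DFunLike.congr_fun h3 k
  rw [Finsupp.add_apply, h1, h2] at h4
  exact eq_neg_of_add_eq_zero_left h4

theorem expand_IW_sq {Z : Type} [AddCommGroup Z] [Module (A' ⊗[ℂ] ℂ[X]) Z] (W : ℂ[X])
    (g : (MI ⟶ MI) → Z) (h0 : g 0 = 0) (hg : ∀ a b, g (a + b) = g a + g b)
    (hs : ∀ (c : ℂ) a, g (c • a) = jL A' (algebraMap ℂ A' c) • g a) :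
    expand (A' := A') (IW W ∘ₗ IW W) g = g (W • 𝟙 MI) - jR A' W • g (𝟙 MI) := by
  rw [IW_sq, expand_add _ _ g h0 hg, expand_bi_left _ g h0, expand_jR_smul_bi _ _ g h0 hg hs,
    map_neg, sub_eq_add_neg]
  exact congrArg _ (neg_smul _ _)

variable {X Y : GrMod A'}

theorem extEval_cons_zero {φ : ∀ ⦃L : GrMod ℂ[X]⦄, Quiver.Path L MI → (U.obj L ⟶ Y)}
    (h : Multi U W' W φ) (n : ℕ) :
    (extEval (IW W) n fun p => φ (p.cons (0 : MI ⟶ MI))) = 0 := by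
  rw [← extEval_zero (IW W) n]
  refine congrArg _ (funext fun p => ?_)
  have := h.map_smul p 0 (0 : MI ⟶ MI) .nil
  rwa [zero_smul, zero_smul] at this

theorem extEval_cons_add {φ : ∀ ⦃L : GrMod ℂ[X]⦄, Quiver.Path L MI → (U.obj L ⟶ Y)}
    (h : Multi U W' W φ) (n : ℕ) (a b : MI ⟶ MI) :
    (extEval (IW W) n fun p => φ (p.cons (a + b))) =
      (extEval (IW W) n fun p => φ (p.cons a)) + (extEval (IW W) n fun p => φ (p.cons b)) := by
  rw [← extEval_add]
  exact congrArg _ (funext fun p => h.map_add p a b .nil)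

theorem extEval_contract {φ : ∀ ⦃L : GrMod ℂ[X]⦄, Quiver.Path L MI → (U.obj L ⟶ Y)}
    (h : Multi U W' W φ) (n : ℕ) :
    expand (A' := A') (IW W ∘ₗ IW W) (fun f => extEval (IW W) n fun p => φ (p.cons f)) = 0 := by
  have h1 : extEval (IW W) n (fun p => φ (p.cons (𝟙 MI))) = 0 := by
    rw [← extEval_zero (IW W) n]
    exact congrArg _ (funext fun p => h.map_one p .nil)
  rw [expand_IW_sq _ _ (extEval_cons_zero h n) (extEval_cons_add h n), h1]
  · rw [smul_zero, sub_zero]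
    have h2 : (fun p : Quiver.Path MI MI => φ (Quiver.Path.cons p (W • 𝟙 MI))) =
        fun p => W' • φ (Quiver.Path.cons p (𝟙 MI)) :=
      funext fun p => h.map_potential p (𝟙 MI) .nil
    rw [h2, extEval_smul, h1]
    exact smul_zero (A := Bi (U.obj MI) →ₗ[A' ⊗[ℂ] ℂ[X]] Bi Y) (jL A' W')
  · intro c a
    rw [← extEval_complex_smul]
    exact congrArg _ (funext fun p => h.map_smul p c a .nil)

/-- The grading involution passes through an extended family with the sign `(-1) ^ n`. -/
theorem extEval_sgn (n : ℕ) {φ : ∀ ⦃L : GrMod ℂ[X]⦄, Quiver.Path L MI → (U.obj L ⟶ Y)}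
    (h : Multi U W' W φ) (φ' : Quiver.Path MI MI → (U.obj MI ⟶ Y))
    (h1 : ∀ (p : Quiver.Path MI MI) (f : MI ⟶ MI), φ (p.cons (f ≫ MI.sgn)) = φ' (p.cons f))
    (h2 : U.map MI.sgn ≫ φ .nil = φ' .nil) :
    extEval (IW W) n (fun p => φ p) ∘ₗ bi (U.map MI.sgn) = (-1 : ℤ) ^ n • extEval (IW W) n φ' := by
  induction n generalizing φ φ' with
  | zero =>
    rw [pow_zero, one_smul]
    simp only [extEval]
    rw [← bi_comp, h2]
  | succ n ih =>
    simp only [extEval]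
    rw [← LinearMap.lcomp_apply' (S := A' ⊗[ℂ] ℂ[X]), map_expand]
    have e : ∀ f : MI ⟶ MI, (extEval (IW W) n fun p => φ (Quiver.Path.cons p f)) ∘ₗ
        bi (U.map MI.sgn) = (-1 : ℤ) ^ n • extEval (IW W) n
          (fun p => φ (Quiver.Path.cons p (MI.sgn ≫ f))) := by
      intro f
      exact ih (h.cons f) _ (fun p g => h.map_slide p g f .nil) (h.map_first f .nil).symm
    have neg : ∀ (p : Quiver.Path MI MI) (f : MI ⟶ MI), φ (p.cons (-f)) = - φ (p.cons f) := by
      intro p f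
      have := h.map_smul p (-1) f .nil
      simpa using this
    rw [pow_succ, mul_neg, mul_one, neg_smul]
    simp only [expand, Finsupp.sum, Finset.smul_sum, ← Finset.sum_neg_distrib]
    refine Finset.sum_congr rfl fun k _ => ?_
    rw [LinearMap.lcomp_apply', e, coeffs_IW_sgn]
    simp only [neg, h1]
    rw [extEval_neg, smul_neg, smul_neg]
    congr 1
    exact smul_comm _ _ _

theorem extEval_lowerTerms (n : ℕ) {φ : ∀ ⦃L : GrMod ℂ[X]⦄, Quiver.Path L MI → (U.obj L ⟶ Y)}
    (h : Multi U W' W φ) :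
    extEval (IW W) (n + 1) (fun p => lowerTerms U p φ) =
      - ((-1 : ℤ) ^ n • (extEval (IW W) n (fun p => φ p) ∘ₗ extMap U (IW W))) := by
  induction n generalizing φ with
  | zero =>
    rw [pow_zero, one_smul]
    simp only [extEval, lowerTerms, extMap]
    rw [← LinearMap.compRight_apply (S := A' ⊗[ℂ] ℂ[X]), map_expand, ← expand_neg_right]
    exact expand_congr _ fun f => by rw [bi_neg, bi_comp]; rfl
  | succ n ih =>
    have e : ∀ f : MI ⟶ MI, extEval (IW W) (n + 1)
        (fun p : Quiver.Path MI MI => lowerTerms U (p.cons f) φ) =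
        - (expand (A' := A') (IW W) fun g => extEval (IW W) n fun p => φ (p.cons (g ≫ f))) +
        (-1 : ℤ) ^ n • (extEval (IW W) n (fun p => φ (p.cons f)) ∘ₗ extMap U (IW W)) := by
      intro f
      have e1 := ih (h.cons f)
      rw [← neg_neg ((-1 : ℤ) ^ n • _), ← e1, ← expand_neg_right]
      simp only [extEval]
      rw [← expand_neg_right, ← expand_add_right]
      refine expand_congr _ fun g => ?_
      rw [← extEval_neg, ← extEval_neg, ← extEval_add]
      refine congrArg _ (funext fun p => ?_)
      simp only [lowerTerms]
      rw [sub_eq_add_neg]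
    have e2 : extEval (IW W) (n + 1 + 1) (fun p => lowerTerms U p φ) =
        expand (A' := A') (IW W) (fun f => extEval (IW W) (n + 1)
          (fun p : Quiver.Path MI MI => lowerTerms U (p.cons f) φ)) := rfl
    rw [e2, expand_congr _ e, expand_add_right, expand_neg_right]
    rw [← expand_comp (IW W) (IW W) (fun f => extEval (IW W) n fun p => φ (p.cons f))
      (extEval_cons_zero h n) (extEval_cons_add h n), extEval_contract h, neg_zero, zero_add]
    rw [pow_succ, mul_neg, mul_one, neg_smul, neg_neg, ← LinearMap.lcomp_apply' (S := A' ⊗[ℂ] ℂ[X])]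
    conv_rhs => rw [extEval, map_expand]
    simp only [expand, Finsupp.sum, Finset.smul_sum]
    refine Finset.sum_congr rfl fun k _ => ?_
    rw [smul_comm]
    rfl

end Contraction
section PiFunctor

open Polynomial

variable {A' : Type} [CommRing A'] [Algebra ℂ A'] {W' : A'} {W : ℂ[X]}

theorem expand_map_comp (U : GrMod ℂ[X] ⥤ GrMod A') [U.Additive] {M N P : GrMod ℂ[X]}
    (F : Bi M →ₗ[ℂ[X] ⊗[ℂ] ℂ[X]] Bi N) (G : Bi N →ₗ[ℂ[X] ⊗[ℂ] ℂ[X]] Bi P) :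
    extMap U (G ∘ₗ F) = extMap U G ∘ₗ extMap U F := by
  rw [extMap, expand_comp F G _ (by rw [U.map_zero, bi_zero])
    (fun a b => by rw [U.map_add, bi_add])]
  rw [extMap, ← LinearMap.lcomp_apply' (S := A' ⊗[ℂ] ℂ[X]), map_expand]
  refine expand_congr _ fun b => ?_
  rw [LinearMap.lcomp_apply', extMap, ← LinearMap.compRight_apply (S := A' ⊗[ℂ] ℂ[X]), map_expand]
  refine expand_congr _ fun a => ?_
  rw [U.map_comp, bi_comp]
  rfl

theorem extMap_bi (U : GrMod ℂ[X] ⥤ GrMod A') [U.Additive] {M N : GrMod ℂ[X]} (f : M ⟶ N) :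
    extMap U (bi f) = bi (U.map f) :=
  expand_bi_left _ _ (by rw [U.map_zero, bi_zero])

/-- The matrix factorization `U (I_W)`: the bimodule `U (M) ⊗ ℂ[x̃]` with the grading `U (σ)` and
the differential `U (I_W)`. -/
noncomputable def piObj (U : FusionFunctor W' W) : MatFact W' W where
  carrier := Bi (U.functor.obj MI)
  σ := bi (U.functor.obj MI).sgn
  σ_sq := by rw [← bi_comp, GrMod.sgn_sgn, bi_id]
  Q := extMap U.functor (IW W)
  odd := by
    rw [← U.map_sgn, ← extMap_bi, ← expand_map_comp, ← expand_map_comp]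
    have h := expand_add (A' := A') (IW W ∘ₗ bi MI.sgn) (bi MI.sgn ∘ₗ IW W)
      (fun f => bi (U.functor.map f)) (by rw [U.functor.map_zero, bi_zero])
      (fun a b => by rw [U.functor.map_add, bi_add])
    refine h.symm.trans ?_
    rw [IW_odd, add_neg_cancel]
    exact expand_zero _ (by rw [U.functor.map_zero, bi_zero])
  sq := by
    rw [← expand_map_comp]
    refine (expand_IW_sq W (fun f => bi (U.functor.map f)) (by rw [U.functor.map_zero, bi_zero])
      (fun a b => by rw [U.functor.map_add, bi_add])
      (fun c a => by rw [U.functor.map_smul, bi_complex_smul])).trans ?_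
    rw [U.map_smul_potential, bi_smul, U.functor.map_id, bi_id]
    exact (sub_smul (jL A' W') (jR A' W) LinearMap.id).symm

/-- `Π (φ) = ∑ₙ φ⁽ⁿ⁾ (I_W, …, I_W)`; the sum is finite for morphisms of fusion functors. -/
noncomputable def piMap {U V : FusionFunctor W' W} (φ : Cochain U.functor V.functor) :
    Bi (U.functor.obj MI) →ₗ[A' ⊗[ℂ] ℂ[X]] Bi (V.functor.obj MI) :=
  ∑ᶠ n : ℕ, extEval (IW W) n fun p => φ p

variable {U V T : FusionFunctor W' W}

theorem piMap_eq_sum {φ : Cochain U.functor V.functor} {k : ℕ}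
    (h : ∀ ⦃M N : GrMod ℂ[X]⦄ (p : Quiver.Path M N), k ≤ p.length → φ p = 0) :
    piMap φ = ∑ n ∈ Finset.range k, extEval (IW W) n fun p => φ p := by
  refine finsum_eq_sum_of_support_subset _ fun n hn => ?_
  rw [Finset.coe_range, Set.mem_Iio]
  by_contra hk
  refine hn ((extEval_of_length _ _ _ _ fun p hp => h p ?_).trans (extEval_zero (IW W) n))
  omega

theorem extEval_large {φ : Cochain U.functor V.functor} {k : ℕ}
    (h : ∀ ⦃M N : GrMod ℂ[X]⦄ (p : Quiver.Path M N), k ≤ p.length → φ p = 0) {n : ℕ}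
    (hn : k ≤ n) : extEval (IW W) n (fun p : Quiver.Path MI MI => φ p) = 0 := by
  rw [← extEval_zero (IW W) n]
  exact extEval_of_length _ _ _ _ fun p hp => h p (by omega)

theorem piMap_add {φ ψ : Cochain U.functor V.functor} (hφ : IsFusionMorphism W' W φ)
    (hψ : IsFusionMorphism W' W ψ) : piMap (φ + ψ) = piMap φ + piMap ψ := by
  obtain ⟨a, ha⟩ := hφ.bounded
  obtain ⟨b, hb⟩ := hψ.bounded
  have ha' : ∀ ⦃M N : GrMod ℂ[X]⦄ (p : Quiver.Path M N), a + b ≤ p.length → φ p = 0 :=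
    fun _ _ p hp => ha p (by omega)
  have hb' : ∀ ⦃M N : GrMod ℂ[X]⦄ (p : Quiver.Path M N), a + b ≤ p.length → ψ p = 0 :=
    fun _ _ p hp => hb p (by omega)
  rw [piMap_eq_sum ha', piMap_eq_sum hb', piMap_eq_sum (φ := φ + ψ) (k := a + b)
    (fun M N p hp => by rw [Pi.add_apply, Pi.add_apply, Pi.add_apply, ha' p hp, hb' p hp, add_zero]),
    ← Finset.sum_add_distrib]
  exact Finset.sum_congr rfl fun n _ => extEval_add _ _ _ _

theorem piMap_smul (c : ℂ) {φ : Cochain U.functor V.functor} (hφ : IsFusionMorphism W' W φ) :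
    piMap (c • φ) = jL A' (algebraMap ℂ A' c) • piMap φ := by
  obtain ⟨a, ha⟩ := hφ.bounded
  rw [piMap_eq_sum ha, piMap_eq_sum (φ := c • φ) (k := a)
    (fun M N p hp => by rw [Pi.smul_apply, Pi.smul_apply, Pi.smul_apply, ha p hp, smul_zero])]
  refine (Finset.sum_congr rfl fun n _ => extEval_complex_smul _ _ _ _).trans ?_
  refine LinearMap.ext fun z => ?_
  simp only [LinearMap.sum_apply, LinearMap.smul_apply, Finset.smul_sum]

theorem piMap_id : piMap (Cochain.id U.functor) = LinearMap.id := by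
  rw [piMap_eq_sum (k := 1) (fun M N p hp => by cases p <;> simp_all [Cochain.id]),
    Finset.sum_range_one]
  exact bi_id _

theorem extEval_compAux (n : ℕ) (φ : Cochain U.functor V.functor) {Y : GrMod A'}
    (ψ : ∀ ⦃L : GrMod ℂ[X]⦄, Quiver.Path L MI → (V.functor.obj L ⟶ Y)) :
    extEval (IW W) n (fun p => compAux φ p ψ) = ∑ i ∈ Finset.range (n + 1),
      extEval (IW W) i (fun p => ψ p) ∘ₗ extEval (IW W) (n - i) (fun p => φ p) := by
  induction n generalizing ψ with
  | zero =>
    rw [zero_add, Finset.sum_range_one]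
    exact bi_comp _ _
  | succ n ih =>
    rw [Finset.sum_range_succ']
    have e : extEval (IW W) (n + 1) (fun p : Quiver.Path MI MI => compAux φ p ψ) =
        expand (A' := A') (IW W) fun f => bi (ψ .nil) ∘ₗ extEval (IW W) n (fun p => φ (p.cons f)) +
          extEval (IW W) n (fun p => compAux φ p fun _ q => ψ (q.cons f)) := by
      simp only [extEval]
      refine expand_congr _ fun f => ?_
      rw [← extEval_comp_right, ← extEval_add]
      rfl
    rw [e, expand_add_right, add_comm]
    congr 1
    · rw [expand_congr _ fun f => ih fun _ q => ψ (q.cons f)]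
      simp only [expand, Finsupp.sum, Finset.smul_sum]
      rw [Finset.sum_comm]
      refine Finset.sum_congr rfl fun i _ => ?_
      rw [Nat.add_sub_add_right, extEval, ← LinearMap.lcomp_apply' (S := A' ⊗[ℂ] ℂ[X]), map_expand]
      rfl
    · rw [Nat.sub_zero]
      conv_rhs => rw [extEval, extEval, ← LinearMap.compRight_apply (S := A' ⊗[ℂ] ℂ[X]), map_expand]
      rfl

theorem piMap_comp {φ : Cochain U.functor V.functor} {ψ : Cochain V.functor T.functor}
    (hφ : IsFusionMorphism W' W φ) (hψ : IsFusionMorphism W' W ψ) :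
    piMap (φ.comp ψ) = piMap ψ ∘ₗ piMap φ := by
  obtain ⟨a, ha⟩ := hφ.bounded
  obtain ⟨b, hb⟩ := hψ.bounded
  obtain ⟨c, hc⟩ := (hφ.comp hψ).bounded
  have ha' : ∀ ⦃M N : GrMod ℂ[X]⦄ (p : Quiver.Path M N), a + b + c ≤ p.length → φ p = 0 :=
    fun _ _ p hp => ha p (by omega)
  have hc' : ∀ ⦃M N : GrMod ℂ[X]⦄ (p : Quiver.Path M N), a + b + c ≤ p.length → φ.comp ψ p = 0 :=
    fun _ _ p hp => hc p (by omega)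
  have hb' : ∀ ⦃M N : GrMod ℂ[X]⦄ (p : Quiver.Path M N), a + b + c ≤ p.length → ψ p = 0 :=
    fun _ _ p hp => hb p (by omega)
  rw [piMap_eq_sum hc', piMap_eq_sum hb', piMap_eq_sum ha]
  refine (Finset.sum_congr rfl fun n _ => extEval_compAux n φ fun _ q => ψ q).trans ?_
  refine (Finset.sum_range_diag_flip (a + b + c) fun i j =>
    extEval (IW W) i (fun p : Quiver.Path MI MI => ψ p) ∘ₗ
      extEval (IW W) j (fun p : Quiver.Path MI MI => φ p)).trans ?_
  have e : ∀ f g : ℕ → _, (∑ i ∈ Finset.range (a + b + c),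
      (f i : Bi (V.functor.obj MI) →ₗ[A' ⊗[ℂ] ℂ[X]] Bi (T.functor.obj MI))) ∘ₗ
      (∑ j ∈ Finset.range a,
        (g j : Bi (U.functor.obj MI) →ₗ[A' ⊗[ℂ] ℂ[X]] Bi (V.functor.obj MI))) =
      ∑ i ∈ Finset.range (a + b + c), ∑ j ∈ Finset.range a, f i ∘ₗ g j := by
    intro f g
    refine LinearMap.ext fun z => ?_
    simp only [LinearMap.sum_apply, LinearMap.comp_apply, map_sum]
    exact Finset.sum_comm
  rw [e]
  refine Finset.sum_congr rfl fun i _ => ?_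
  by_cases hi : b ≤ i
  · rw [extEval_large hb hi]
    simp
  · symm
    refine Finset.sum_subset (Finset.range_mono (by omega)) fun j _ hj => ?_
    rw [extEval_large ha (by simpa using hj), LinearMap.comp_zero]

theorem piMap_d_aux {φ : Cochain U.functor V.functor} (h : IsFusionMorphism W' W φ) :
    piMap (d φ) = extMap V.functor (IW W) ∘ₗ piMap φ -
      (bi (V.functor.obj MI).sgn ∘ₗ piMap φ ∘ₗ bi (U.functor.obj MI).sgn) ∘ₗ
        extMap U.functor (IW W) := by
  obtain ⟨a, ha⟩ := h.bounded
  have hd0 : extEval (IW W) 0 (fun p : Quiver.Path MI MI => d φ p) = 0 := bi_zero _ _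
  have hd : ∀ n, extEval (IW W) (n + 1) (fun p : Quiver.Path MI MI => d φ p) =
      extMap V.functor (IW W) ∘ₗ extEval (IW W) n (fun p => φ p) -
        (bi (V.functor.obj MI).sgn ∘ₗ extEval (IW W) n (fun p => φ p) ∘ₗ
          bi (U.functor.obj MI).sgn) ∘ₗ extMap U.functor (IW W) := by
    intro n
    have h1 : extEval (IW W) (n + 1) (fun p : Quiver.Path MI MI => d φ p) =
        extMap V.functor (IW W) ∘ₗ extEval (IW W) n (fun p => φ p) +
          extEval (IW W) (n + 1) (fun p => lowerTerms U.functor p fun _ q => φ q) := by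
      simp only [extEval]
      rw [extMap, ← LinearMap.lcomp_apply' (S := A' ⊗[ℂ] ℂ[X]), map_expand, ← expand_add_right]
      refine expand_congr _ fun f => ?_
      rw [LinearMap.lcomp_apply', ← extEval_comp_right, ← extEval_add]
      rfl
    have h2 := extEval_sgn n (h.multi MI) (fun p => φ p ≫ V.functor.map MI.sgn)
      (fun p f => h.map_last p f) (h.map_nil MI)
    rw [extEval_comp_right, U.map_sgn, V.map_sgn] at h2
    have h3 : bi (V.functor.obj MI).sgn ∘ₗ extEval (IW W) n (fun p => φ p) ∘ₗ
        bi (U.functor.obj MI).sgn = (-1 : ℤ) ^ n • extEval (IW W) n (fun p => φ p) := by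
      rw [h2]
      refine LinearMap.ext fun z => ?_
      rw [LinearMap.comp_apply, LinearMap.smul_apply, map_zsmul, ← LinearMap.comp_apply,
        ← LinearMap.comp_assoc, ← bi_comp, GrMod.sgn_sgn, bi_id]
      rfl
    rw [h1, extEval_lowerTerms n (h.multi MI), h3, sub_eq_add_neg]
    rfl
  have hd' : ∀ n, a + 1 ≤ n → extEval (IW W) n (fun p : Quiver.Path MI MI => d φ p) = 0 := by
    intro n hn
    obtain ⟨n, rfl⟩ : ∃ l, n = l + 1 := ⟨n - 1, by omega⟩
    rw [hd, extEval_large ha (by omega)]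
    simp
  have e : piMap (d φ) = ∑ n ∈ Finset.range (a + 1),
      extEval (IW W) n (fun p : Quiver.Path MI MI => d φ p) := by
    refine finsum_eq_sum_of_support_subset _ fun n hn => ?_
    rw [Finset.coe_range, Set.mem_Iio]
    by_contra hk
    exact hn (hd' n (by omega))
  rw [e, Finset.sum_range_succ', hd0, add_zero, piMap_eq_sum ha, Finset.sum_congr rfl fun n _ => hd n,
    Finset.sum_sub_distrib]
  refine LinearMap.ext fun z => ?_
  simp only [LinearMap.sub_apply, LinearMap.sum_apply, LinearMap.comp_apply, map_sum]

/-- `Π` is a morphism of complexes. -/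
theorem piMap_d {φ : Cochain U.functor V.functor} (h : IsFusionMorphism W' W φ) :
    piMap (d φ) = MatFact.δ (piObj U) (piObj V) (piMap φ) :=
  piMap_d_aux h

/-- `Π` on closed morphisms. -/
noncomputable def piCocycle (φ : fusionCocycles U V) :
    LinearMap.ker (MatFact.δ (piObj U) (piObj V)) :=
  ⟨piMap φ.1, by
    have h : d φ.1 = 0 := φ.2.2
    have h2 := piMap_d φ.2.1
    have h3 := piMap_smul 0 φ.2.1
    rw [h] at h2
    rw [zero_smul] at h3
    refine LinearMap.mem_ker.2 (h2.symm.trans (h3.trans ?_))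
    rw [map_zero, map_zero]
    exact LinearMap.ext fun z => zero_smul (A' ⊗[ℂ] ℂ[X]) (piMap φ.1 z)⟩

/-- The functor `Π` from the cohomology category of fusion functors to the cohomology category
of matrix factorizations. -/
noncomputable def PiFunctor (W' : A') (W : ℂ[X]) : HFF W' W ⥤ Hmf W' W where
  obj U := piObj (W' := W') (W := W) U
  map {U V} := Quotient.map (piCocycle (U := U) (V := V)) (by
    intro φ ψ h
    replace h := (Submodule.quotientRel_def _).1 h
    refine (Submodule.quotientRel_def _).2 ?_
    obtain ⟨χ, hχ, e⟩ := h
    replace e : d χ = φ.1 - ψ.1 := e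
    refine ⟨piMap χ, (piMap_d hχ).symm.trans ?_⟩
    have h1 := piMap_smul (-1) ψ.2.1
    have h2 := piMap_add φ.2.1 (ψ.2.1.smul (-1))
    rw [e]
    rw [h1] at h2
    have h3 : φ.1 - ψ.1 = φ.1 + (-1 : ℂ) • ψ.1 := by rw [neg_one_smul, sub_eq_add_neg]
    rw [h3, h2, map_neg, map_neg, map_one, map_one]
    change _ + (-1 : A' ⊗[ℂ] ℂ[X]) • piMap ψ.1 = piMap φ.1 - piMap ψ.1
    refine LinearMap.ext fun z => ?_
    rw [LinearMap.add_apply, LinearMap.smul_apply, neg_one_smul, LinearMap.sub_apply,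
      sub_eq_add_neg])
  map_id U := congrArg (Quotient.mk _) (Subtype.ext piMap_id)
  map_comp := by
    rintro U V T ⟨φ⟩ ⟨ψ⟩
    exact congrArg (Quotient.mk _) (Subtype.ext (piMap_comp φ.2.1 ψ.2.1))

end PiFunctor
section Formulas

open Polynomial

/-- The free module of rank one, purely even. -/
noncomputable def R1 : GrMod ℂ[X] where
  carrier := ℂ[X]
  σ := LinearMap.id
  σ_sq := rfl

/-- Multiplication by a polynomial. -/
noncomputable def mulBy (p : ℂ[X]) : R1 ⟶ R1 := p • 𝟙 R1

/-- The inclusion `a ↦ (a, 0)`. -/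
noncomputable def in0 : R1 ⟶ MI := GrMod.ofLin (LinearMap.inl ℂ[X] ℂ[X] ℂ[X])

/-- The inclusion `b ↦ (0, b)`. -/
noncomputable def in1 : R1 ⟶ MI := GrMod.ofLin (LinearMap.inr ℂ[X] ℂ[X] ℂ[X])

/-- The projection `(a, b) ↦ a`. -/
noncomputable def pr0 : MI ⟶ R1 := GrMod.ofLin (LinearMap.fst ℂ[X] ℂ[X] ℂ[X])

/-- The `i`-th coordinate of a basis. -/
noncomputable def coordHom {M : GrMod ℂ[X]} {ι : Type} (b : Module.Basis ι ℂ[X] M.carrier) (i : ι) :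
    M ⟶ R1 := GrMod.ofLin (b.coord i)

/-- The homomorphism `p ↦ p • bᵢ`. -/
noncomputable def vecHom {M : GrMod ℂ[X]} {ι : Type} (b : Module.Basis ι ℂ[X] M.carrier) (i : ι) :
    R1 ⟶ M := GrMod.ofLin (LinearMap.toSpanSingleton ℂ[X] M.carrier (b i))

/-- A basis of even and odd vectors. -/
def IsHomogeneousBasis {M : GrMod ℂ[X]} {ι : Type} (b : Module.Basis ι ℂ[X] M.carrier) : Prop :=
  ∀ i, M.σ (b i) = b i ∨ M.σ (b i) = - b i

variable {A' : Type} [CommRing A'] [Algebra ℂ A'] {W' : A'} {W : ℂ[X]}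

/-- The homomorphism `u ↦ V (μ) (G (u ⊗ 1))`, for the multiplication `μ : R ⊗ R → R`, that is,
`V (μ) (v ⊗ x̃ ^ k) = V (x ^ k) v`. -/
noncomputable def muHom (V : GrMod ℂ[X] ⥤ GrMod A') {Y : GrMod A'}
    (G : Bi Y →ₗ[A' ⊗[ℂ] ℂ[X]] Bi (V.obj R1)) : Y ⟶ V.obj R1 :=
  (coeffs G).sum fun k g => g ≫ V.map (mulBy (X ^ k))

variable {U V : FusionFunctor W' W}

/-- The component `U (R) ⊗ R → V (R) ⊗ R` of `φ` from the even to the even summand. -/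
noncomputable def comp00 (φ : MatFact.Hom (piObj U) (piObj V)) :
    Bi (U.functor.obj R1) →ₗ[A' ⊗[ℂ] ℂ[X]] Bi (V.functor.obj R1) :=
  bi (V.functor.map pr0) ∘ₗ φ ∘ₗ bi (U.functor.map in0)

/-- The component `U (R) ⊗ R → V (R) ⊗ R` of `ψ` from the odd to the even summand. -/
noncomputable def comp01 (ψ : MatFact.Hom (piObj U) (piObj V)) :
    Bi (U.functor.obj R1) →ₗ[A' ⊗[ℂ] ℂ[X]] Bi (V.functor.obj R1) :=
  bi (V.functor.map pr0) ∘ₗ ψ ∘ₗ bi (U.functor.map in1)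

/-- `φ_UV (M) = (V (μ) ⊗ 1) (φ⁽⁰⁾ ⊗ 1) U (ι_M)`, written in a basis of `M`. -/
noncomputable def evenLift (φ : MatFact.Hom (piObj U) (piObj V)) {M : GrMod ℂ[X]} {ι : Type}
    [Fintype ι] (b : Module.Basis ι ℂ[X] M.carrier) : U.functor.obj M ⟶ V.functor.obj M :=
  ∑ i, U.functor.map (coordHom b i) ≫ muHom V.functor (comp00 φ) ≫ V.functor.map (vecHom b i)

/-- `V (μ) ψ⁽¹⁾ U ((p (x) - p (x̃)) / (x - x̃))` on `U (R) ⊗ 1`. -/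
noncomputable def oddEntry (ψ : MatFact.Hom (piObj U) (piObj V)) (p : ℂ[X]) :
    U.functor.obj R1 ⟶ V.functor.obj R1 :=
  muHom V.functor (comp01 ψ ∘ₗ extMap U.functor (divDiff p • (LinearMap.id : Bi R1 →ₗ[_] Bi R1)))

/-- `φ_UV (f) = (V (μ) ψ⁽¹⁾ ⊗ 1) U ((f (x) - f (x̃)) / (x - x̃) ι_M)`, where the divided difference
is that of the matrix entries of `f` in bases of `M` and `N`. -/
noncomputable def oddLift (ψ : MatFact.Hom (piObj U) (piObj V)) {M N : GrMod ℂ[X]} {ι κ : Type}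
    [Fintype ι] [Fintype κ] (b : Module.Basis ι ℂ[X] M.carrier) (c : Module.Basis κ ℂ[X] N.carrier)
    (f : M ⟶ N) : U.functor.obj M ⟶ V.functor.obj N :=
  ∑ i, ∑ j, U.functor.map (coordHom b i) ≫ oddEntry ψ (c.repr (GrMod.lin f (b i)) j) ≫
    V.functor.map (vecHom c j)

end Formulas
end LGFusion

open LGFusion Polynomial

/-!
The point is that the entry `x - x̃` of `I_W` becomes `s = V (x) - x̃` on `V (R) ⊗ ℂ[x̃]`, which is
injective (it is monic in `x̃`) and whose cokernel is the restriction `V (μ)` to the diagonal: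
`V (μ)` kills multiples of `s`, and every homomorphism `G` differs from `V (μ) G ⊗ 1` by a multiple of `s`
(`muHom_diagEq_comp`, `exists_diagEq_comp_eq_bi_muHom_sub`). Consequently, a closed even
homomorphism `U (I_W) → V (I_W)` is exact as soon as its even-to-even block is divisible by `s`, and
a closed odd one as soon as its odd-to-even block is: closedness and the injectivity of `s`
determine the other block from the quotient (`exact_of_even`, `exact_of_odd`).

For even closed `φ`, closedness gives that `h₀ = V (μ) φ⁽⁰⁾` commutes with `x`
(`muHom_comp00_comm`), so the maps built from `h₀` in bases form a natural transformation and do not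
depend on the bases. Its image under `Π` has the even-to-even block `h₀ ⊗ 1`, which differs from
`φ⁽⁰⁾` by a multiple of `s`.

For odd closed `ψ`, the Leibniz rule for divided differences makes `h` a derivation
(`oddEntry_mul`) that vanishes on constants, and closedness gives `h (W) = 0`
(`oddEntry_potential`). Applied to matrix entries it yields a Hochschild cocycle of degree one; the
grading conditions follow from the Leibniz rule, since the involution has constant entries in
homogeneous bases. Since `I_W` has the entry `x - x̃` there, the odd-to-even block of the image
under `Π` is `h (x) ⊗ 1 - x̃ h (1) = V (μ) ψ⁽¹⁾ ⊗ 1`, which differs from `ψ⁽¹⁾` by a multiple of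
`s`. The choice of homogeneous basis of `R ⊕ R` does not matter because all of them consist of constant
multiples of the two standard vectors (`exists_const_of_basis`).

Fullness follows since a closed homomorphism is the sum of a closed even and a closed odd one.
-/

namespace LGFusion

/-! ### Homomorphisms of bimodules as polynomials in the second variable -/

section Coefficients

variable {A A' : Type} [CommRing A] [CommRing A'] [Algebra ℂ A] [Algebra ℂ A']

section Scalars

-- The module laws are restated for homomorphisms of bimodules because rewriting with the general
-- lemmas does not recognize the instances in question.

variable {M N : GrMod A} (r t : A ⊗[ℂ] ℂ[X]) (F G : Bi M →ₗ[A ⊗[ℂ] ℂ[X]] Bi N)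

theorem biHom_smul_zero : r • (0 : Bi M →ₗ[A ⊗[ℂ] ℂ[X]] Bi N) = 0 :=
  LinearMap.ext fun _ => smul_zero r

theorem biHom_smul_add : r • (F + G) = r • F + r • G :=
  LinearMap.ext fun m => smul_add r (F m) (G m)

theorem biHom_smul_sub : r • (F - G) = r • F - r • G :=
  LinearMap.ext fun m => smul_sub r (F m) (G m)

theorem biHom_add_smul : (r + t) • F = r • F + t • F :=
  LinearMap.ext fun m => add_smul r t (F m)

theorem biHom_smul_smul : r • t • F = (r * t) • F :=
  LinearMap.ext fun m => smul_smul r t (F m)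

theorem biHom_one_smul : (1 : A ⊗[ℂ] ℂ[X]) • F = F :=
  LinearMap.ext fun m => one_smul (A ⊗[ℂ] ℂ[X]) (F m)

end Scalars

/-- Every homomorphism of bimodules is a finite sum of terms `x̃ ^ k • (g ⊗ 1)`. -/
theorem biHom_induction {M N : GrMod A} {motive : (Bi M →ₗ[A ⊗[ℂ] ℂ[X]] Bi N) → Prop}
    (zero : motive 0) (add : ∀ F G, motive F → motive G → motive (F + G))
    (term : ∀ k (g : M ⟶ N), motive (xt A k • bi g)) (G) : motive G := by
  rw [← expand_bi G]
  unfold expand Finsupp.sum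
  exact Finset.sum_induction (fun k => xt A k • bi (coeffs G k)) motive add zero
    fun k _ => term k _

theorem coeffs_zero {M N : GrMod A} : coeffs (0 : Bi M →ₗ[A ⊗[ℂ] ℂ[X]] Bi N) = 0 := by
  have := coeffs_add (0 : Bi M →ₗ[A ⊗[ℂ] ℂ[X]] Bi N) 0
  simpa using this

theorem coeffs_xt_smul {M N : GrMod A} (F : Bi M →ₗ[A ⊗[ℂ] ℂ[X]] Bi N) (k : ℕ) :
    coeffs (xt A 1 • F) (k + 1) = coeffs F k := by
  induction F using biHom_induction with
  | zero => rw [biHom_smul_zero, coeffs_zero]; rfl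
  | add F G hF hG =>
    rw [biHom_smul_add, coeffs_add, coeffs_add, Finsupp.add_apply, Finsupp.add_apply, hF, hG]
  | term l g =>
    rw [biHom_smul_smul, ← xt_add, coeffs_xt_smul_bi, coeffs_xt_smul_bi, add_comm 1 l,
      Finsupp.single_apply, Finsupp.single_apply]
    simp only [Nat.add_right_cancel_iff]

/-- The homomorphism `a - x̃` has monic leading coefficient in `x̃`, so it is injective. -/
theorem eq_zero_of_bi_sub_xt_comp {M N : GrMod A} (a : N ⟶ N) (F : Bi M →ₗ[A ⊗[ℂ] ℂ[X]] Bi N)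
    (h : bi a ∘ₗ F - xt A 1 • F = 0) : F = 0 := by
  have step : ∀ k, coeffs F k = coeffs F (k + 1) ≫ a := by
    intro k
    have h' := DFunLike.congr_fun (congrArg coeffs (sub_eq_zero.1 h)) (k + 1)
    rw [coeffs_bi_comp, coeffs_xt_smul] at h'
    exact h'.symm
  obtain ⟨n, hn⟩ := exists_coeffHom_bound F
  have top : ∀ j k, n ≤ k + j → coeffs F k = 0 := by
    intro j
    induction j with
    | zero =>
      intro k hk
      by_contra hne
      have := Finset.mem_range.1 (hn k hne)
      omega
    | succ j ih =>
      intro k hk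
      rw [step, ih (k + 1) (by omega), Limits.zero_comp]
  have h0 : coeffs F = 0 := Finsupp.ext fun k => top n k (by omega)
  rw [← expand_bi F, expand, h0, Finsupp.sum_zero_index]

theorem eq_of_bi_sub_xt_comp {M N : GrMod A} (a : N ⟶ N) {F G : Bi M →ₗ[A ⊗[ℂ] ℂ[X]] Bi N}
    (h : (bi a - xt A 1 • LinearMap.id) ∘ₗ F = (bi a - xt A 1 • LinearMap.id) ∘ₗ G) : F = G := by
  refine sub_eq_zero.1 (eq_zero_of_bi_sub_xt_comp a _ ?_)
  have h' : (bi a - xt A 1 • LinearMap.id) ∘ₗ (F - G) = 0 := by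
    rw [LinearMap.comp_sub, h, sub_self]
  exact h'

end Coefficients

/-! ### Restriction to the diagonal -/

section Diagonal

variable {A' : Type} [CommRing A'] [Algebra ℂ A'] (V : GrMod ℂ[X] ⥤ GrMod A')

theorem mulBy_mul (p q : ℂ[X]) : mulBy (p * q) = mulBy p ≫ mulBy q := by
  rw [mulBy, mulBy, mulBy, Linear.smul_comp, Linear.comp_smul, Category.id_comp, smul_smul]

theorem mulBy_comm (p q : ℂ[X]) : mulBy p ≫ mulBy q = mulBy q ≫ mulBy p := by
  rw [← mulBy_mul, ← mulBy_mul, mul_comm]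

theorem mulBy_one : mulBy 1 = 𝟙 R1 := one_smul _ _

theorem mulBy_add (p q : ℂ[X]) : mulBy (p + q) = mulBy p + mulBy q := add_smul _ _ _

theorem mulBy_C (c : ℂ) : mulBy (C c) = c • 𝟙 R1 := rfl

theorem mulBy_C_mul (c : ℂ) (p : ℂ[X]) : mulBy (C c * p) = c • mulBy p := mul_smul (C c) p (𝟙 R1)

variable {V} {Y Z : GrMod A'}

theorem muHom_zero : muHom V (0 : Bi Y →ₗ[A' ⊗[ℂ] ℂ[X]] Bi (V.obj R1)) = 0 := by
  rw [muHom, coeffs_zero, Finsupp.sum_zero_index]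

theorem muHom_add (F G : Bi Y →ₗ[A' ⊗[ℂ] ℂ[X]] Bi (V.obj R1)) :
    muHom V (F + G) = muHom V F + muHom V G := by
  rw [muHom, coeffs_add]
  exact Finsupp.sum_add_index' (fun _ => Limits.zero_comp) fun _ _ _ =>
    Preadditive.add_comp _ _ _ _ _ _

theorem muHom_neg (F : Bi Y →ₗ[A' ⊗[ℂ] ℂ[X]] Bi (V.obj R1)) :
    muHom V (-F) = - muHom V F := by
  rw [eq_neg_iff_add_eq_zero, ← muHom_add, neg_add_cancel, muHom_zero]

theorem muHom_sub (F G : Bi Y →ₗ[A' ⊗[ℂ] ℂ[X]] Bi (V.obj R1)) :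
    muHom V (F - G) = muHom V F - muHom V G := by
  rw [sub_eq_add_neg, muHom_add, muHom_neg, sub_eq_add_neg]

theorem muHom_xt_smul_bi (k : ℕ) (g : Y ⟶ V.obj R1) :
    muHom V (xt A' k • bi g) = g ≫ V.map (mulBy (X ^ k)) := by
  rw [muHom, coeffs_xt_smul_bi]
  exact Finsupp.sum_single_index Limits.zero_comp

theorem muHom_comp_bi (f : Z ⟶ Y) (F : Bi Y →ₗ[A' ⊗[ℂ] ℂ[X]] Bi (V.obj R1)) :
    muHom V (F ∘ₗ bi f) = f ≫ muHom V F := by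
  induction F using biHom_induction with
  | zero => rw [LinearMap.zero_comp, muHom_zero, muHom_zero, Limits.comp_zero]
  | add F G hF hG => rw [LinearMap.add_comp, muHom_add, muHom_add, hF, hG, Preadditive.comp_add]
  | term k g =>
    rw [LinearMap.smul_comp, ← bi_comp, muHom_xt_smul_bi, muHom_xt_smul_bi, Category.assoc]

theorem muHom_bi_map_comp (p : ℂ[X]) (F : Bi Y →ₗ[A' ⊗[ℂ] ℂ[X]] Bi (V.obj R1)) :
    muHom V (bi (V.map (mulBy p)) ∘ₗ F) = muHom V F ≫ V.map (mulBy p) := by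
  induction F using biHom_induction with
  | zero => rw [LinearMap.comp_zero, muHom_zero, Limits.zero_comp]
  | add F G hF hG => rw [LinearMap.comp_add, muHom_add, muHom_add, hF, hG, Preadditive.add_comp]
  | term k g =>
    rw [LinearMap.comp_smul, ← bi_comp, muHom_xt_smul_bi, muHom_xt_smul_bi, Category.assoc,
      Category.assoc, ← V.map_comp, mulBy_comm, V.map_comp]

theorem muHom_jR_smul [V.Additive] [V.Linear ℂ] (p : ℂ[X])
    (F : Bi Y →ₗ[A' ⊗[ℂ] ℂ[X]] Bi (V.obj R1)) :
    muHom V (jR A' p • F) = muHom V F ≫ V.map (mulBy p) := by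
  induction p using Polynomial.induction_on' with
  | add p q hp hq =>
    rw [map_add, biHom_add_smul, muHom_add, hp, hq, mulBy_add, V.map_add, Preadditive.comp_add]
  | monomial n c =>
    induction F using biHom_induction with
    | zero => rw [biHom_smul_zero, muHom_zero, Limits.zero_comp]
    | add F G hF hG => rw [biHom_smul_add, muHom_add, muHom_add, hF, hG, Preadditive.add_comp]
    | term k g =>
      have e : jR A' (monomial n c) • xt A' k • bi g = xt A' (k + n) • bi (c • g) := by
        rw [bi_complex_smul, biHom_smul_smul, biHom_smul_smul, ← jR_C, ← C_mul_X_pow_eq_monomial,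
          map_mul, ← xt_eq, xt_add]
        congr 1
        ring
      rw [e, muHom_xt_smul_bi, muHom_xt_smul_bi, ← C_mul_X_pow_eq_monomial, Category.assoc,
        ← V.map_comp, ← mulBy_mul, mul_left_comm, ← pow_add, mulBy_C_mul, V.map_smul,
        Linear.comp_smul, Linear.smul_comp]

/-- The endomorphism `V (x) - x̃` of `V (R) ⊗ ℂ[x̃]`. -/
noncomputable def diagEq (V : GrMod ℂ[X] ⥤ GrMod A') :
    Bi (V.obj R1) →ₗ[A' ⊗[ℂ] ℂ[X]] Bi (V.obj R1) :=
  bi (V.map (mulBy X)) - xt A' 1 • LinearMap.id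

theorem diagEq_comp (F : Bi Y →ₗ[A' ⊗[ℂ] ℂ[X]] Bi (V.obj R1)) :
    diagEq V ∘ₗ F = bi (V.map (mulBy X)) ∘ₗ F - xt A' 1 • F := rfl

theorem comp_diagEq (F : Bi (V.obj R1) →ₗ[A' ⊗[ℂ] ℂ[X]] Bi Y) :
    F ∘ₗ diagEq V = F ∘ₗ bi (V.map (mulBy X)) - xt A' 1 • F := by
  rw [diagEq, LinearMap.comp_sub, LinearMap.comp_smul, LinearMap.comp_id]

theorem muHom_diagEq_comp [V.Additive] [V.Linear ℂ] (F : Bi Y →ₗ[A' ⊗[ℂ] ℂ[X]] Bi (V.obj R1)) :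
    muHom V (diagEq V ∘ₗ F) = 0 := by
  rw [diagEq_comp, muHom_sub, muHom_bi_map_comp, xt_eq, muHom_jR_smul, pow_one, sub_self]

/-- A homomorphism agrees with its restriction to the diagonal up to a multiple of `V (x) - x̃`. -/
theorem exists_diagEq_comp_eq_bi_muHom_sub (F : Bi Y →ₗ[A' ⊗[ℂ] ℂ[X]] Bi (V.obj R1)) :
    ∃ c, bi (muHom V F) - F = diagEq V ∘ₗ c := by
  induction F using biHom_induction with
  | zero => exact ⟨0, by rw [muHom_zero, bi_zero, sub_zero, LinearMap.comp_zero]⟩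
  | add F G hF hG =>
    obtain ⟨c, hc⟩ := hF
    obtain ⟨e, he⟩ := hG
    exact ⟨c + e, by rw [LinearMap.comp_add, ← hc, ← he, muHom_add, bi_add]; abel⟩
  | term k g =>
    rw [muHom_xt_smul_bi]
    -- The factorization `a ^ (k + 1) - b ^ (k + 1) = (a - b) * a ^ k + b * (a ^ k - b ^ k)`.
    induction k with
    | zero =>
      exact ⟨0, by rw [xt_zero, biHom_one_smul, pow_zero, mulBy_one, V.map_id, Category.comp_id,
        sub_self, LinearMap.comp_zero]⟩
    | succ k ih =>
      obtain ⟨c, hc⟩ := ih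
      refine ⟨bi (g ≫ V.map (mulBy (X ^ k))) + xt A' 1 • c, ?_⟩
      rw [LinearMap.comp_add, LinearMap.comp_smul, ← hc, diagEq_comp, ← bi_comp, Category.assoc,
        ← V.map_comp, ← mulBy_mul, ← pow_succ, biHom_smul_sub, biHom_smul_smul, ← xt_add,
          add_comm 1 k]
      abel

theorem eq_of_diagEq_comp {F G : Bi Y →ₗ[A' ⊗[ℂ] ℂ[X]] Bi (V.obj R1)}
    (h : diagEq V ∘ₗ F = diagEq V ∘ₗ G) : F = G :=
  eq_of_bi_sub_xt_comp _ h

end Diagonal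

/-! ### Divided differences -/

section DividedDifferences

/-- Under `ℂ[x] ⊗ ℂ[x̃] ≃ ℂ[x][x̃]`, the ring of polynomials in two variables is a domain. -/
theorem isDomain_tensor : IsDomain (ℂ[X] ⊗[ℂ] ℂ[X]) :=
  (polyEquivTensor ℂ ℂ[X]).symm.toMulEquiv.isDomain _

theorem jL_X_sub_jR_X_ne_zero : jL ℂ[X] X - jR ℂ[X] X ≠ 0 := by
  intro h
  have h1 : (polyEquivTensor ℂ ℂ[X]).symm (jL ℂ[X] X - jR ℂ[X] X) = C X - X := by
    rw [map_sub]
    change (polyEquivTensor ℂ ℂ[X]).symm (X ⊗ₜ 1) - (polyEquivTensor ℂ ℂ[X]).symm (1 ⊗ₜ X) = _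
    simp [smul_eq_C_mul]
  rw [h, map_zero] at h1
  have h2 := congrArg (fun p : ℂ[X][X] => p.coeff 1) h1
  simp at h2

/-- The divided difference is the only solution of `(x - x̃) q = p (x) - p (x̃)`. -/
theorem divDiff_eq_of_mul_eq {p : ℂ[X]} {q : ℂ[X] ⊗[ℂ] ℂ[X]}
    (h : (jL ℂ[X] X - jR ℂ[X] X) * q = jL ℂ[X] p - jR ℂ[X] p) : divDiff p = q := by
  have := isDomain_tensor
  exact mul_left_cancel₀ jL_X_sub_jR_X_ne_zero ((mul_divDiff p).trans h.symm)

theorem divDiff_add (p q : ℂ[X]) : divDiff (p + q) = divDiff p + divDiff q :=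
  divDiff_eq_of_mul_eq (by
    rw [mul_add, mul_divDiff, mul_divDiff, map_add, map_add]
    ring)

theorem divDiff_C (c : ℂ) : divDiff (C c) = 0 :=
  divDiff_eq_of_mul_eq (by
    have e : jR ℂ[X] (C c) = jL ℂ[X] (C c) := jR_C c
    rw [mul_zero, e, sub_self])

theorem divDiff_X : divDiff X = 1 :=
  divDiff_eq_of_mul_eq (mul_one _)

/-- The Leibniz rule for divided differences. -/
theorem divDiff_mul (p q : ℂ[X]) :
    divDiff (p * q) = divDiff p * jL ℂ[X] q + jR ℂ[X] p * divDiff q :=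
  divDiff_eq_of_mul_eq (by
    have h1 := mul_divDiff p
    have h2 := mul_divDiff q
    rw [map_mul, map_mul]
    linear_combination jL ℂ[X] q * h1 + jR ℂ[X] p * h2)

end DividedDifferences

/-! ### Functors on polynomials in two variables -/

section ExtendedScalars

variable {A' : Type} [CommRing A'] [Algebra ℂ A']

/-- The action `U (q)` of a polynomial `q (x, x̃)` on `U (R) ⊗ ℂ[x̃]`. -/
noncomputable def extScalar (U : GrMod ℂ[X] ⥤ GrMod A') (q : ℂ[X] ⊗[ℂ] ℂ[X]) :
    Bi (U.obj R1) →ₗ[A' ⊗[ℂ] ℂ[X]] Bi (U.obj R1) :=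
  extMap U (q • (LinearMap.id : Bi R1 →ₗ[_] Bi R1))

variable (U : GrMod ℂ[X] ⥤ GrMod A') [U.Additive]

theorem extMap_add {M N : GrMod ℂ[X]} (F G : Bi M →ₗ[ℂ[X] ⊗[ℂ] ℂ[X]] Bi N) :
    extMap U (F + G) = extMap U F + extMap U G :=
  expand_add (A' := A') F G _ (by rw [U.map_zero, bi_zero]) fun a b => by rw [U.map_add, bi_add]

theorem extScalar_add (p q : ℂ[X] ⊗[ℂ] ℂ[X]) :
    extScalar U (p + q) = extScalar U p + extScalar U q := by
  rw [extScalar, biHom_add_smul, extMap_add]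
  rfl

theorem extScalar_mul (p q : ℂ[X] ⊗[ℂ] ℂ[X]) :
    extScalar U (p * q) = extScalar U p ∘ₗ extScalar U q := by
  rw [extScalar, extScalar, extScalar, ← expand_map_comp, LinearMap.smul_comp, LinearMap.id_comp,
    biHom_smul_smul]

theorem extScalar_zero : extScalar U 0 = 0 := by
  have := extScalar_add U 0 0
  simpa using this

theorem extScalar_jL (p : ℂ[X]) : extScalar U (jL ℂ[X] p) = bi (U.map (mulBy p)) := by
  rw [extScalar, ← extMap_bi, mulBy, bi_smul, bi_id]

theorem extScalar_jR [U.Linear ℂ] (p : ℂ[X]) :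
    extScalar U (jR ℂ[X] p) = jR A' p • LinearMap.id := by
  rw [extScalar, ← bi_id, extMap,
    expand_jR_smul_bi p (𝟙 R1) (fun f => bi (U.map f)) (by rw [U.map_zero, bi_zero])
      (fun a b => by rw [U.map_add, bi_add]) (fun c a => by rw [U.map_smul, bi_complex_smul]),
    U.map_id, bi_id]

theorem extScalar_one : extScalar U 1 = LinearMap.id := by
  rw [extScalar, biHom_one_smul, ← bi_id, extMap_bi, U.map_id, bi_id]

theorem extScalar_X_sub [U.Linear ℂ] : extScalar U (jL ℂ[X] X - jR ℂ[X] X) = diagEq U := by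
  have h := extScalar_add U (jL ℂ[X] X - jR ℂ[X] X) (jR ℂ[X] X)
  rw [sub_add_cancel, extScalar_jL, extScalar_jR] at h
  rw [diagEq, h, xt_eq, pow_one, add_sub_cancel_right]

theorem extMap_smul_bi_comp {M N : GrMod ℂ[X]} (q : ℂ[X] ⊗[ℂ] ℂ[X]) (f : M ⟶ R1) (g : R1 ⟶ N) :
    extMap U (q • bi (f ≫ g)) = bi (U.map g) ∘ₗ extScalar U q ∘ₗ bi (U.map f) := by
  have e : q • bi (f ≫ g) = bi g ∘ₗ (q • (LinearMap.id : Bi R1 →ₗ[_] Bi R1)) ∘ₗ bi f := by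
    rw [bi_comp, LinearMap.smul_comp, LinearMap.comp_smul, LinearMap.id_comp]
  rw [e, expand_map_comp, expand_map_comp, extMap_bi, extMap_bi]
  rfl

end ExtendedScalars

/-! ### The derivation attached to an odd homomorphism -/

section Derivation

variable {A' : Type} [CommRing A'] [Algebra ℂ A'] {W' : A'} {W : ℂ[X]} {U V : FusionFunctor W' W}
variable (ψ : MatFact.Hom (piObj U) (piObj V))

theorem oddEntry_eq (p : ℂ[X]) :
    oddEntry ψ p = muHom V.functor (comp01 ψ ∘ₗ extScalar U.functor (divDiff p)) := rfl

theorem oddEntry_add (p q : ℂ[X]) : oddEntry ψ (p + q) = oddEntry ψ p + oddEntry ψ q := by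
  rw [oddEntry_eq, divDiff_add, extScalar_add, LinearMap.comp_add, muHom_add]
  rfl

theorem oddEntry_C (c : ℂ) : oddEntry ψ (C c) = 0 := by
  rw [oddEntry_eq, divDiff_C, extScalar_zero, LinearMap.comp_zero, muHom_zero]

theorem oddEntry_X : oddEntry ψ X = muHom V.functor (comp01 ψ) := by
  rw [oddEntry_eq, divDiff_X, extScalar_one, LinearMap.comp_id]

/-- `h (p q) = h (p) U (q) + V (p) h (q)`. -/
theorem oddEntry_mul (p q : ℂ[X]) :
    oddEntry ψ (p * q) = U.functor.map (mulBy q) ≫ oddEntry ψ p +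
      oddEntry ψ q ≫ V.functor.map (mulBy p) := by
  rw [oddEntry_eq, divDiff_mul, extScalar_add, extScalar_mul, extScalar_mul, extScalar_jL,
    extScalar_jR, LinearMap.smul_comp, LinearMap.id_comp, LinearMap.comp_add, LinearMap.comp_smul,
    muHom_add, muHom_jR_smul, ← LinearMap.comp_assoc, muHom_comp_bi]
  rfl

theorem oddEntry_C_mul (c : ℂ) (p : ℂ[X]) : oddEntry ψ (C c * p) = c • oddEntry ψ p := by
  rw [oddEntry_mul, oddEntry_C, Limits.comp_zero, zero_add, mulBy_C, V.functor.map_smul,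
    V.functor.map_id, Linear.comp_smul, Category.comp_id]

end Derivation

/-! ### Matrices of homomorphisms -/

section Matrices

variable {M N P : GrMod ℂ[X]} {ι κ l : Type} [Fintype ι] [Fintype κ] [Fintype l]
variable (b : Module.Basis ι ℂ[X] M.carrier) (c : Module.Basis κ ℂ[X] N.carrier)
variable (e : Module.Basis l ℂ[X] P.carrier)

/-- Matrix entries of a homomorphism. -/
noncomputable def entry {M N : GrMod ℂ[X]} {ι κ : Type} (b : Module.Basis ι ℂ[X] M.carrier)
    (c : Module.Basis κ ℂ[X] N.carrier) (f : M ⟶ N) (j : κ) (i : ι) : ℂ[X] :=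
  c.repr (GrMod.lin f (b i)) j

theorem lin_sum {s : Finset ι} (f : ι → (M ⟶ N)) (m : M.carrier) :
    GrMod.lin (∑ i ∈ s, f i) m = ∑ i ∈ s, GrMod.lin (f i) m := by
  induction s using Finset.cons_induction with
  | empty => rfl
  | cons i s hi ih =>
    rw [Finset.sum_cons, Finset.sum_cons, ← ih]
    rfl

theorem comp_coordHom (f : M ⟶ N) (j : κ) :
    f ≫ coordHom c j = ∑ i, coordHom b i ≫ mulBy (entry b c f j i) := by
  refine b.ext fun i => ?_
  refine Eq.trans ?_ (lin_sum _ _).symm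
  change entry b c f j i = ∑ k, entry b c f j k * b.repr (b i) k
  classical
  simp [Finsupp.single_apply]

theorem vecHom_comp (g : M ⟶ N) (i : ι) :
    vecHom b i ≫ g = ∑ j, mulBy (entry b c g j i) ≫ vecHom c j := by
  refine LinearMap.ext_ring ?_
  refine Eq.trans ?_ (lin_sum _ _).symm
  change GrMod.lin g ((1 : ℂ[X]) • b i) = ∑ j, (entry b c g j i * 1) • c j
  simp only [one_smul, mul_one]
  exact (c.sum_repr _).symm

theorem entry_comp (f : M ⟶ N) (g : N ⟶ P) (k : l) (i : ι) :
    entry b e (f ≫ g) k i = ∑ j, entry c e g k j * entry b c f j i := by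
  change e.repr (GrMod.lin g (GrMod.lin f (b i))) k = _
  conv_lhs => rw [← c.sum_repr (GrMod.lin f (b i))]
  simp only [map_sum, map_smul, Finsupp.coe_finsetSum, Finset.sum_apply, Finsupp.smul_apply,
    smul_eq_mul]
  exact Finset.sum_congr rfl fun j _ => mul_comm _ _

theorem entry_add (f g : M ⟶ N) (j : κ) (i : ι) :
    entry b c (f + g) j i = entry b c f j i + entry b c g j i := by
  change c.repr (GrMod.lin f (b i) + GrMod.lin g (b i)) j = _
  rw [map_add]
  rfl

theorem entry_smul (p : ℂ[X]) (f : M ⟶ N) (j : κ) (i : ι) :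
    entry b c (p • f) j i = p * entry b c f j i := by
  change c.repr (p • GrMod.lin f (b i)) j = _
  rw [map_smul]
  rfl

end Matrices

/-! ### The degree-zero and degree-one families -/

section Lifts

variable {A' : Type} [CommRing A'] [Algebra ℂ A'] {W' : A'} {W : ℂ[X]} {U V : FusionFunctor W' W}
variable {M N P : GrMod ℂ[X]} {ι κ l : Type} [Fintype ι] [Fintype κ] [Fintype l]
variable (b : Module.Basis ι ℂ[X] M.carrier) (c : Module.Basis κ ℂ[X] N.carrier)
variable (e : Module.Basis l ℂ[X] P.carrier)

theorem oddLift_eq (ψ : MatFact.Hom (piObj U) (piObj V)) (f : M ⟶ N) :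
    oddLift ψ b c f = ∑ i, ∑ j, U.functor.map (coordHom b i) ≫ oddEntry ψ (entry b c f j i) ≫
      V.functor.map (vecHom c j) := rfl

theorem oddEntry_sum (ψ : MatFact.Hom (piObj U) (piObj V)) (s : Finset ι) (p : ι → ℂ[X]) :
    oddEntry ψ (∑ i ∈ s, p i) = ∑ i ∈ s, oddEntry ψ (p i) :=
  map_sum (AddMonoidHom.mk' (oddEntry ψ) (oddEntry_add ψ)) p s

/-- The Leibniz rule; different bases may be used for every occurrence of a module. -/
theorem oddLift_comp (ψ : MatFact.Hom (piObj U) (piObj V)) (f : M ⟶ N) (g : N ⟶ P) :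
    oddLift ψ b e (f ≫ g) = U.functor.map f ≫ oddLift ψ c e g +
      oddLift ψ b c f ≫ V.functor.map g := by
  have h1 : U.functor.map f ≫ oddLift ψ c e g = ∑ i, ∑ k, ∑ j, U.functor.map (coordHom b i) ≫
      (U.functor.map (mulBy (entry b c f j i)) ≫ oddEntry ψ (entry c e g k j)) ≫
        V.functor.map (vecHom e k) := by
    simp only [oddLift_eq, Preadditive.comp_sum]
    simp only [← Category.assoc (U.functor.map f), ← U.functor.map_comp, comp_coordHom b c,
      U.functor.map_sum, Preadditive.sum_comp, Category.assoc]
    simp only [U.functor.map_comp, Category.assoc]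
    rw [Finset.sum_comm_cycle]
    exact Finset.sum_congr rfl fun i _ => Finset.sum_comm
  have h2 : oddLift ψ b c f ≫ V.functor.map g = ∑ i, ∑ k, ∑ j, U.functor.map (coordHom b i) ≫
      (oddEntry ψ (entry b c f j i) ≫ V.functor.map (mulBy (entry c e g k j))) ≫
        V.functor.map (vecHom e k) := by
    simp only [oddLift_eq, Preadditive.sum_comp, Category.assoc]
    simp only [← V.functor.map_comp, vecHom_comp c e, V.functor.map_sum, Preadditive.comp_sum]
    exact Finset.sum_congr rfl fun i _ => Finset.sum_comm
  rw [h1, h2, oddLift_eq]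
  simp only [entry_comp b c e, oddEntry_sum, oddEntry_mul, Preadditive.sum_comp,
    Preadditive.comp_sum, Preadditive.add_comp, Preadditive.comp_add, Finset.sum_add_distrib]

theorem oddLift_add (ψ : MatFact.Hom (piObj U) (piObj V)) (f g : M ⟶ N) :
    oddLift ψ b c (f + g) = oddLift ψ b c f + oddLift ψ b c g := by
  simp only [oddLift_eq, entry_add, oddEntry_add, Preadditive.add_comp, Preadditive.comp_add,
    Finset.sum_add_distrib]

theorem oddLift_smul (ψ : MatFact.Hom (piObj U) (piObj V)) (z : ℂ) (f : M ⟶ N) :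
    oddLift ψ b c (z • f) = z • oddLift ψ b c f := by
  have h : ∀ j i, entry b c (z • f) j i = C z * entry b c f j i := entry_smul b c (C z) f
  simp only [oddLift_eq, h, oddEntry_C_mul, Linear.smul_comp, Linear.comp_smul, Finset.smul_sum]

/-- The derivation vanishes on homomorphisms with constant matrix entries. -/
theorem oddLift_of_const (ψ : MatFact.Hom (piObj U) (piObj V)) {f : M ⟶ N}
    (h : ∀ j i, ∃ z, entry b c f j i = C z) : oddLift ψ b c f = 0 := by
  rw [oddLift_eq]
  refine Finset.sum_eq_zero fun i _ => Finset.sum_eq_zero fun j _ => ?_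
  obtain ⟨z, hz⟩ := h j i
  rw [hz, oddEntry_C, Limits.zero_comp, Limits.comp_zero]

theorem oddLift_id (ψ : MatFact.Hom (piObj U) (piObj V)) : oddLift ψ b b (𝟙 M) = 0 := by
  classical
  refine oddLift_of_const b b ψ fun j i => ⟨if i = j then 1 else 0, ?_⟩
  change b.repr (b i) j = _
  rw [b.repr_self, Finsupp.single_apply]
  split_ifs <;> simp

theorem oddLift_sgn (ψ : MatFact.Hom (piObj U) (piObj V)) (hb : IsHomogeneousBasis b) :
    oddLift ψ b b M.sgn = 0 := by
  classical
  refine oddLift_of_const b b ψ fun j i => ?_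
  change ∃ z, b.repr (M.σ (b i)) j = C z
  rcases hb i with h | h
  · refine ⟨if i = j then 1 else 0, ?_⟩
    rw [h, b.repr_self, Finsupp.single_apply]
    split_ifs <;> simp
  · refine ⟨if i = j then -1 else 0, ?_⟩
    rw [h, map_neg, b.repr_self, Finsupp.neg_apply, Finsupp.single_apply]
    split_ifs <;> simp

/-- If `h (W) = 0`, the derivation is compatible with multiplication by the potentials. -/
theorem oddLift_potential_smul (ψ : MatFact.Hom (piObj U) (piObj V)) (hW : oddEntry ψ W = 0)
    (f : M ⟶ N) : oddLift ψ b c (W • f) = W' • oddLift ψ b c f := by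
  have h : ∀ p, oddEntry ψ (W * p) = W' • oddEntry ψ p := by
    intro p
    rw [mul_comm, oddEntry_mul, hW, Limits.zero_comp, add_zero, mulBy, U.map_smul_potential,
      U.functor.map_id, Linear.smul_comp, Category.id_comp]
  simp only [oddLift_eq, entry_smul, h, Linear.smul_comp, Linear.comp_smul, Finset.smul_sum]

/-- An endomorphism commuting with `x` commutes with all polynomials. -/
theorem comm_mulBy_of_comm_X {h : U.functor.obj R1 ⟶ V.functor.obj R1}
    (hX : U.functor.map (mulBy X) ≫ h = h ≫ V.functor.map (mulBy X)) (p : ℂ[X]) :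
    U.functor.map (mulBy p) ≫ h = h ≫ V.functor.map (mulBy p) := by
  induction p using Polynomial.induction_on with
  | C a =>
    rw [mulBy_C, U.functor.map_smul, V.functor.map_smul, U.functor.map_id, V.functor.map_id,
      Linear.smul_comp, Linear.comp_smul, Category.id_comp, Category.comp_id]
  | add p q hp hq =>
    rw [mulBy_add, U.functor.map_add, V.functor.map_add, Preadditive.add_comp,
      Preadditive.comp_add, hp, hq]
  | monomial n a ih =>
    rw [pow_succ, ← mul_assoc, mulBy_mul, U.functor.map_comp, V.functor.map_comp, Category.assoc,
      hX, ← Category.assoc, ih, Category.assoc]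

/-- If `h₀` commutes with `x`, the maps written with `h₀` in bases are natural. -/
theorem evenLift_naturality (φ : MatFact.Hom (piObj U) (piObj V))
    (hX : U.functor.map (mulBy X) ≫ muHom V.functor (comp00 φ) =
      muHom V.functor (comp00 φ) ≫ V.functor.map (mulBy X)) (f : M ⟶ N) :
    U.functor.map f ≫ evenLift φ c = evenLift φ b ≫ V.functor.map f := by
  have h := comm_mulBy_of_comm_X hX
  simp only [evenLift, Preadditive.comp_sum, Preadditive.sum_comp, Category.assoc]
  simp only [← Category.assoc (U.functor.map f), ← U.functor.map_comp, ← V.functor.map_comp,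
    comp_coordHom b c, vecHom_comp b c, U.functor.map_sum, V.functor.map_sum,
    Preadditive.sum_comp, Preadditive.comp_sum]
  simp only [U.functor.map_comp, V.functor.map_comp, Category.assoc]
  rw [Finset.sum_comm]
  refine Finset.sum_congr rfl fun i _ => Finset.sum_congr rfl fun j _ => ?_
  rw [← Category.assoc (U.functor.map (mulBy _)), h, Category.assoc]

end Lifts

/-! ### Homogeneous bases -/

section HomogeneousBasis

theorem algebraMap_half_mul_two (R : Type) [CommRing R] [Algebra ℂ R] :
    algebraMap ℂ R (1 / 2) * 2 = 1 := by
  rw [← map_ofNat (algebraMap ℂ R) 2, ← map_mul, one_div, inv_mul_cancel₀ two_ne_zero, map_one]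

/-- Both eigenspaces of the involution are submodules of a free module over a principal ideal
domain, so they are free, and their bases together form a basis of the module. -/
theorem exists_isHomogeneousBasis (M : GrMod ℂ[X]) :
    ∃ b : Module.Basis (Fin (Module.finrank ℂ[X] M.carrier)) ℂ[X] M.carrier,
      IsHomogeneousBasis b := by
  have hσ : ∀ m, M.σ (M.σ m) = m := fun m => LinearMap.congr_fun M.σ_sq m
  let E := LinearMap.ker (M.σ - LinearMap.id)
  let O := LinearMap.ker (M.σ + LinearMap.id)
  have hE : ∀ m ∈ E, M.σ m = m := fun m hm => sub_eq_zero.1 hm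
  have hO : ∀ m ∈ O, M.σ m = -m := fun m hm => eq_neg_of_add_eq_zero_left hm
  have hc : C (1 / 2 : ℂ) * 2 = 1 := algebraMap_half_mul_two ℂ[X]
  have hhalf : ∀ m : M.carrier, C (1 / 2 : ℂ) • (m + m) = m := by
    intro m
    rw [← two_smul ℂ[X] m, smul_smul, hc, one_smul]
  have hEO : IsCompl E O := by
    refine IsCompl.of_eq ?_ ?_
    · rw [eq_bot_iff]
      rintro m ⟨h1, h2⟩
      have h3 : m + m = 0 := by
        nth_rewrite 1 [← hE m h1]
        rw [hO m h2, neg_add_cancel]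
      have := hhalf m
      rw [h3, smul_zero] at this
      exact this.symm
    · rw [eq_top_iff]
      intro m _
      refine Submodule.mem_sup.2 ⟨C (1 / 2 : ℂ) • (m + M.σ m), ?_,
        C (1 / 2 : ℂ) • (m - M.σ m), ?_, ?_⟩
      · refine E.smul_mem _ (sub_eq_zero.2 ?_)
        rw [map_add, hσ, add_comm]
        rfl
      · refine O.smul_mem _ (eq_neg_iff_add_eq_zero.1 ?_)
        rw [map_sub, hσ]
        exact (neg_sub _ _).symm
      · rw [← smul_add, add_add_sub_cancel, hhalf]
  let b := ((Module.finBasis ℂ[X] E).prod (Module.finBasis ℂ[X] O)).map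
    (Submodule.prodEquivOfIsCompl E O hEO)
  refine ⟨b.reindex (Fintype.equivOfCardEq ?_), fun i => ?_⟩
  · rw [Fintype.card_fin, Module.finrank_eq_card_basis b]
  · rw [Module.Basis.reindex_apply]
    rcases (Fintype.equivOfCardEq _).symm i with j | j
    · left
      refine hE _ ?_
      simp [b]
    · right
      refine hO _ ?_
      simp [b]

end HomogeneousBasis

/-! ### Block matrices on the identity factorization -/

section Blocks

/-- The projection `(a, b) ↦ b`. -/
noncomputable def pr1 : MI ⟶ R1 := GrMod.ofLin (LinearMap.snd ℂ[X] ℂ[X] ℂ[X])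

theorem in0_pr0 : in0 ≫ pr0 = 𝟙 R1 := rfl

theorem in1_pr1 : in1 ≫ pr1 = 𝟙 R1 := rfl

theorem in0_pr1 : in0 ≫ pr1 = 0 := rfl

theorem in1_pr0 : in1 ≫ pr0 = 0 := rfl

theorem pr_in_add : pr0 ≫ in0 + pr1 ≫ in1 = 𝟙 MI :=
  LinearMap.ext fun m => Prod.ext (add_zero m.1) (zero_add m.2)

theorem E01_eq : E01 = pr1 ≫ in0 := rfl

theorem E10_eq : E10 = pr0 ≫ in1 := rfl

theorem in0_sgn : in0 ≫ MI.sgn = in0 :=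
  LinearMap.ext fun m => Prod.ext (rfl : m = m) (neg_zero : -(0 : ℂ[X]) = 0)

theorem in1_sgn : in1 ≫ MI.sgn = -in1 :=
  LinearMap.ext fun m => Prod.ext (neg_zero.symm : (0 : ℂ[X]) = -0) (rfl : -m = -m)

theorem sgn_pr0 : MI.sgn ≫ pr0 = pr0 := rfl

theorem sgn_pr1 : MI.sgn ≫ pr1 = -pr1 := rfl

variable {A' : Type} [CommRing A'] [Algebra ℂ A'] (U : GrMod ℂ[X] ⥤ GrMod A') [U.Additive]

theorem bi_map_apply {L M N : GrMod ℂ[X]} (f : L ⟶ M) (g : M ⟶ N) (z : Bi (U.obj L)) :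
    bi (U.map g) (bi (U.map f) z) = bi (U.map (f ≫ g)) z := by
  rw [U.map_comp, bi_comp]
  rfl

theorem pr0_in0_apply (z : Bi (U.obj R1)) : bi (U.map pr0) (bi (U.map in0) z) = z := by
  rw [bi_map_apply, in0_pr0, U.map_id, bi_id]
  rfl

theorem pr1_in1_apply (z : Bi (U.obj R1)) : bi (U.map pr1) (bi (U.map in1) z) = z := by
  rw [bi_map_apply, in1_pr1, U.map_id, bi_id]
  rfl

theorem pr1_in0_apply (z : Bi (U.obj R1)) : bi (U.map pr1) (bi (U.map in0) z) = 0 := by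
  rw [bi_map_apply, in0_pr1, U.map_zero, bi_zero]
  rfl

theorem pr0_in1_apply (z : Bi (U.obj R1)) : bi (U.map pr0) (bi (U.map in1) z) = 0 := by
  rw [bi_map_apply, in1_pr0, U.map_zero, bi_zero]
  rfl

theorem pr_in_add_apply (z : Bi (U.obj MI)) :
    bi (U.map in0) (bi (U.map pr0) z) + bi (U.map in1) (bi (U.map pr1) z) = z := by
  rw [bi_map_apply, bi_map_apply, ← LinearMap.add_apply, ← bi_add, ← U.map_add, pr_in_add,
    U.map_id, bi_id]
  rfl

theorem bi_MI_ext {x y : Bi (U.obj MI)} (h0 : bi (U.map pr0) x = bi (U.map pr0) y)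
    (h1 : bi (U.map pr1) x = bi (U.map pr1) y) : x = y := by
  rw [← pr_in_add_apply U x, h0, h1, pr_in_add_apply]

theorem hom_MI_ext {Z : GrMod A'} {F G : Bi (U.obj MI) →ₗ[A' ⊗[ℂ] ℂ[X]] Bi Z}
    (h0 : ∀ z, F (bi (U.map in0) z) = G (bi (U.map in0) z))
    (h1 : ∀ z, F (bi (U.map in1) z) = G (bi (U.map in1) z)) : F = G := by
  refine LinearMap.ext fun z => ?_
  rw [← pr_in_add_apply U z, map_add, map_add, h0, h1]

theorem sgn_in0_apply (z : Bi (U.obj R1)) :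
    bi (U.map MI.sgn) (bi (U.map in0) z) = bi (U.map in0) z := by
  rw [bi_map_apply, in0_sgn]

theorem sgn_in1_apply (z : Bi (U.obj R1)) :
    bi (U.map MI.sgn) (bi (U.map in1) z) = -bi (U.map in1) z := by
  rw [bi_map_apply, in1_sgn, U.map_neg, bi_neg]
  rfl

theorem pr0_sgn_apply (z : Bi (U.obj MI)) :
    bi (U.map pr0) (bi (U.map MI.sgn) z) = bi (U.map pr0) z := by
  rw [bi_map_apply, sgn_pr0]

theorem pr1_sgn_apply (z : Bi (U.obj MI)) :
    bi (U.map pr1) (bi (U.map MI.sgn) z) = -bi (U.map pr1) z := by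
  rw [bi_map_apply, sgn_pr1, U.map_neg, bi_neg]
  rfl

variable [U.Linear ℂ] (W : ℂ[X])

theorem extMap_IW : extMap U (IW W) =
    bi (U.map in0) ∘ₗ diagEq U ∘ₗ bi (U.map pr1) +
      bi (U.map in1) ∘ₗ extScalar U (divDiff W) ∘ₗ bi (U.map pr0) := by
  rw [IW, extMap_add, E01_eq, E10_eq, extMap_smul_bi_comp, extMap_smul_bi_comp, extScalar_X_sub]

theorem extMap_IW_apply (z : Bi (U.obj MI)) : extMap U (IW W) z =
    bi (U.map in0) (diagEq U (bi (U.map pr1) z)) +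
      bi (U.map in1) (extScalar U (divDiff W) (bi (U.map pr0) z)) := by
  rw [extMap_IW]
  rfl

end Blocks

/-! ### Exactness of closed homomorphisms -/

section Exactness

variable {A' : Type} [CommRing A'] [Algebra ℂ A']

theorem eq_zero_of_eq_neg {Z : GrMod A'} {z : Bi Z} (h : z = -z) : z = 0 := by
  have h2 : (2 : A' ⊗[ℂ] ℂ[X]) • z = 0 := by
    rw [two_smul]
    nth_rewrite 1 [h]
    exact neg_add_cancel z
  have e := algebraMap_half_mul_two (A' ⊗[ℂ] ℂ[X])
  have h3 := congrArg (algebraMap ℂ (A' ⊗[ℂ] ℂ[X]) (1 / 2) • ·) h2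
  simp only [smul_smul, e, one_smul, smul_zero] at h3
  exact h3

variable (U V : GrMod ℂ[X] ⥤ GrMod A') [U.Additive] [V.Additive] [U.Linear ℂ] [V.Linear ℂ]
variable {W : ℂ[X]} {Θ : Bi (U.obj MI) →ₗ[A' ⊗[ℂ] ℂ[X]] Bi (V.obj MI)}

/-- A closed even homomorphism whose even block is divisible by `x - x̃` is exact; a primitive has
the quotient as its only block. -/
theorem exact_of_even (he : ∀ z, bi (V.map MI.sgn) (Θ z) = Θ (bi (U.map MI.sgn) z))
    (hc : ∀ z, extMap V (IW W) (Θ z) = Θ (extMap U (IW W) z))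
    (c : Bi (U.obj R1) →ₗ[A' ⊗[ℂ] ℂ[X]] Bi (V.obj R1))
    (h : ∀ z, bi (V.map pr0) (Θ (bi (U.map in0) z)) = diagEq V (c z)) :
    ∃ χ : Bi (U.obj MI) →ₗ[A' ⊗[ℂ] ℂ[X]] Bi (V.obj MI),
      (∀ z, bi (V.map MI.sgn) (χ z) = -χ (bi (U.map MI.sgn) z)) ∧
      ∀ z, Θ z = extMap V (IW W) (χ z) + χ (extMap U (IW W) z) := by
  have h10 : ∀ z, bi (V.map pr1) (Θ (bi (U.map in0) z)) = 0 := by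
    intro z
    refine eq_zero_of_eq_neg ?_
    rw [← pr1_sgn_apply, he, sgn_in0_apply]
  have h01 : ∀ z, bi (V.map pr0) (Θ (bi (U.map in1) z)) = 0 := by
    intro z
    refine eq_zero_of_eq_neg ?_
    conv_lhs => rw [← pr0_sgn_apply, he, sgn_in1_apply, map_neg, map_neg]
  have h11 : ∀ z, bi (V.map pr1) (Θ (bi (U.map in1) z)) = c (diagEq U z) := by
    have e : diagEq V ∘ₗ (bi (V.map pr1) ∘ₗ Θ ∘ₗ bi (U.map in1)) =
        diagEq V ∘ₗ (c ∘ₗ diagEq U) := by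
      refine LinearMap.ext fun z => ?_
      have h1 := congrArg (bi (V.map pr0)) (hc (bi (U.map in1) z))
      rw [extMap_IW_apply, extMap_IW_apply, map_add, pr0_in0_apply, pr0_in1_apply, add_zero,
        pr1_in1_apply, pr0_in1_apply, map_zero, map_zero, add_zero, h] at h1
      exact h1
    exact LinearMap.congr_fun (eq_of_diagEq_comp e)
  refine ⟨bi (V.map in1) ∘ₗ c ∘ₗ bi (U.map pr0), fun z => ?_, LinearMap.congr_fun (f := Θ)
    (g := extMap V (IW W) ∘ₗ (bi (V.map in1) ∘ₗ c ∘ₗ bi (U.map pr0)) +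
      (bi (V.map in1) ∘ₗ c ∘ₗ bi (U.map pr0)) ∘ₗ extMap U (IW W)) ?_⟩
  · simp only [LinearMap.comp_apply, pr0_sgn_apply, sgn_in1_apply]
  · refine hom_MI_ext U (fun z => bi_MI_ext V ?_ ?_) fun z => bi_MI_ext V ?_ ?_ <;>
    simp only [LinearMap.comp_apply, LinearMap.add_apply, extMap_IW_apply, map_zero,
      pr0_in0_apply, pr0_in1_apply, pr1_in0_apply, pr1_in1_apply, add_zero, zero_add, h, h10, h01,
      h11]

/-- A closed odd homomorphism whose block from the odd to the even summand is divisible by `x - x̃`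
is exact; a primitive has the quotient as its only block. -/
theorem exact_of_odd (ho : ∀ z, bi (V.map MI.sgn) (Θ z) = -Θ (bi (U.map MI.sgn) z))
    (hc : ∀ z, extMap V (IW W) (Θ z) = -Θ (extMap U (IW W) z))
    (c : Bi (U.obj R1) →ₗ[A' ⊗[ℂ] ℂ[X]] Bi (V.obj R1))
    (h : ∀ z, bi (V.map pr0) (Θ (bi (U.map in1) z)) = diagEq V (c z)) :
    ∃ χ : Bi (U.obj MI) →ₗ[A' ⊗[ℂ] ℂ[X]] Bi (V.obj MI),
      (∀ z, bi (V.map MI.sgn) (χ z) = χ (bi (U.map MI.sgn) z)) ∧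
      ∀ z, Θ z = extMap V (IW W) (χ z) - χ (extMap U (IW W) z) := by
  have h00 : ∀ z, bi (V.map pr0) (Θ (bi (U.map in0) z)) = 0 := by
    intro z
    refine eq_zero_of_eq_neg ?_
    conv_lhs => rw [← pr0_sgn_apply, ho, sgn_in0_apply, map_neg]
  have h11 : ∀ z, bi (V.map pr1) (Θ (bi (U.map in1) z)) = 0 := by
    intro z
    refine eq_zero_of_eq_neg ?_
    rw [← pr1_sgn_apply, ho, sgn_in1_apply, map_neg, map_neg, map_neg, neg_neg]
  have h10 : ∀ z, bi (V.map pr1) (Θ (bi (U.map in0) z)) =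
      -c (extScalar U (divDiff W) z) := by
    have e : diagEq V ∘ₗ (bi (V.map pr1) ∘ₗ Θ ∘ₗ bi (U.map in0)) =
        diagEq V ∘ₗ (-(c ∘ₗ extScalar U (divDiff W))) := by
      refine LinearMap.ext fun z => ?_
      have h1 := congrArg (bi (V.map pr0)) (hc (bi (U.map in0) z))
      rw [extMap_IW_apply, extMap_IW_apply, map_add, map_neg, pr0_in0_apply, pr0_in1_apply,
        add_zero, pr1_in0_apply, pr0_in0_apply, map_zero, map_zero, zero_add, h] at h1
      rw [LinearMap.comp_apply, LinearMap.comp_apply, LinearMap.comp_apply, h1,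
        LinearMap.comp_apply, LinearMap.neg_apply, map_neg, LinearMap.comp_apply]
    exact LinearMap.congr_fun (eq_of_diagEq_comp e)
  refine ⟨bi (V.map in1) ∘ₗ c ∘ₗ bi (U.map pr1), fun z => ?_, LinearMap.congr_fun (f := Θ)
    (g := extMap V (IW W) ∘ₗ (bi (V.map in1) ∘ₗ c ∘ₗ bi (U.map pr1)) -
      (bi (V.map in1) ∘ₗ c ∘ₗ bi (U.map pr1)) ∘ₗ extMap U (IW W)) ?_⟩
  · simp only [LinearMap.comp_apply, pr1_sgn_apply, sgn_in1_apply, map_neg]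
  · refine hom_MI_ext U (fun z => bi_MI_ext V ?_ ?_) fun z => bi_MI_ext V ?_ ?_ <;>
    simp only [LinearMap.comp_apply, LinearMap.sub_apply, extMap_IW_apply, map_zero,
      map_neg, neg_zero, pr0_in0_apply, pr0_in1_apply, pr1_in0_apply, pr1_in1_apply, add_zero,
      zero_add, sub_zero, zero_sub, h, h10, h00, h11]

end Exactness

/-! ### Families concentrated in degrees zero and one -/

section Families

variable {A A' : Type} [CommRing A] [CommRing A'] [Algebra ℂ A] [Algebra ℂ A']
variable {U V : GrMod A ⥤ GrMod A'} {W' : A'} {W : A}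

theorem lowerTerms_zero {Y : GrMod A'} {M N : GrMod A} (p : Quiver.Path M N) :
    lowerTerms U p (fun L (_ : Quiver.Path L N) => (0 : U.obj L ⟶ Y)) = 0 := by
  simpa using lowerTerms_smul p (0 : ℂ) (fun L (_ : Quiver.Path L N) => (0 : U.obj L ⟶ Y))

/-- The family of degree `0` with the given components. -/
def degreeZero (φ : ∀ M, U.obj M ⟶ V.obj M) : Cochain U V
  | M, _, .nil => φ M
  | _, _, .cons _ _ => 0

theorem degreeZero_isHomogeneous (φ : ∀ M, U.obj M ⟶ V.obj M) :
    (degreeZero φ).IsHomogeneous 0 := by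
  intro M N p hp
  cases p with
  | nil => exact absurd rfl hp
  | cons p f => rfl

theorem degreeZero_isFusionMorphism {φ : ∀ M, U.obj M ⟶ V.obj M}
    (hφ : ∀ ⦃M N⦄ (f : M ⟶ N), U.map f ≫ φ N = φ M ≫ V.map f) :
    IsFusionMorphism W' W (degreeZero φ) where
  bounded := ⟨1, fun _ _ p hp => degreeZero_isHomogeneous φ p (by omega)⟩
  map_add _ _ _ _ _ _ _ q := by cases q <;> simp [degreeZero]
  map_smul _ _ _ _ _ _ _ q := by cases q <;> simp [degreeZero]
  map_one _ _ _ _ q := by cases q <;> simp [degreeZero]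
  map_potential _ _ _ _ _ _ q := by cases q <;> simp [degreeZero]
  map_slide _ _ _ _ _ _ _ _ q := by cases q <;> simp [degreeZero]
  map_last _ _ _ _ _ := by simp [degreeZero]
  map_first _ _ _ _ q := by cases q <;> simp [degreeZero]
  map_nil M := hφ M.sgn

theorem d_degreeZero {φ : ∀ M, U.obj M ⟶ V.obj M}
    (hφ : ∀ ⦃M N⦄ (f : M ⟶ N), U.map f ≫ φ N = φ M ≫ V.map f) : d (degreeZero φ) = 0 := by
  funext M N p
  cases p with
  | nil => rfl
  | cons p f =>
    cases p with
    | nil =>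
      simp only [d, lowerTerms, degreeZero, hφ, add_neg_cancel]
      rfl
    | cons p g =>
      simp only [d, lowerTerms, degreeZero, lowerTerms_zero, Limits.zero_comp, neg_zero, sub_zero,
        add_zero]
      rfl

/-- The family of degree `1` with the given components. -/
def degreeOne (D : ∀ ⦃M N : GrMod A⦄, (M ⟶ N) → (U.obj M ⟶ V.obj N)) : Cochain U V
  | _, _, .nil => 0
  | _, _, .cons .nil f => D f
  | _, _, .cons (.cons _ _) _ => 0

variable {D : ∀ ⦃M N : GrMod A⦄, (M ⟶ N) → (U.obj M ⟶ V.obj N)}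

theorem degreeOne_isHomogeneous : (degreeOne D).IsHomogeneous 1 := by
  intro M N p hp
  cases p with
  | nil => rfl
  | cons p f =>
    cases p with
    | nil => exact absurd rfl hp
    | cons p g => rfl

theorem degreeOne_of_two_le {M N : GrMod A} (p : Quiver.Path M N) (hp : 2 ≤ p.length) :
    degreeOne D p = 0 :=
  degreeOne_isHomogeneous p (by omega)

/-- A derivation compatible with the potentials is a morphism of fusion functors of degree `1` if it
vanishes on identities and involutions; the grading conditions then follow from the Leibniz rule. -/
theorem degreeOne_isFusionMorphism
    (map_add : ∀ ⦃M N⦄ (f g : M ⟶ N), D (f + g) = D f + D g)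
    (map_smul : ∀ ⦃M N⦄ (c : ℂ) (f : M ⟶ N), D (c • f) = c • D f)
    (map_potential : ∀ ⦃M N⦄ (f : M ⟶ N), D (W • f) = W' • D f)
    (map_comp : ∀ ⦃M N P⦄ (f : M ⟶ N) (g : N ⟶ P),
      D (f ≫ g) = U.map f ≫ D g + D f ≫ V.map g)
    (map_one : ∀ M, D (𝟙 M) = 0) (map_sgn : ∀ M : GrMod A, D M.sgn = 0) :
    IsFusionMorphism W' W (degreeOne D) where
  bounded := ⟨2, fun _ _ p hp => degreeOne_of_two_le p hp⟩
  map_add L M N P p f g q := by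
    rcases q with _ | ⟨q, e⟩
    · rcases p with _ | ⟨p, e⟩
      · exact map_add f g
      · exact (add_zero _).symm
    · iterate 3 rw [degreeOne_of_two_le _ (by simp; omega)]
      rw [add_zero]
  map_smul L M N P p c f q := by
    rcases q with _ | ⟨q, e⟩
    · rcases p with _ | ⟨p, e⟩
      · exact map_smul c f
      · exact (smul_zero _).symm
    · iterate 2 rw [degreeOne_of_two_le _ (by simp; omega)]
      rw [smul_zero]
  map_one L M P p q := by
    rcases q with _ | ⟨q, e⟩
    · rcases p with _ | ⟨p, e⟩
      · exact map_one L
      · rfl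
    · exact degreeOne_of_two_le _ (by simp; omega)
  map_potential L M N P p f q := by
    rcases q with _ | ⟨q, e⟩
    · rcases p with _ | ⟨p, e⟩
      · exact map_potential f
      · exact (smul_zero _).symm
    · iterate 2 rw [degreeOne_of_two_le _ (by simp; omega)]
      rw [smul_zero]
  map_slide L M N P S p f g q := by
    iterate 2 rw [degreeOne_of_two_le _ (by simp; omega)]
  map_last L M N p f := by
    rcases p with _ | ⟨p, e⟩
    · change D (f ≫ N.sgn) = D f ≫ V.map N.sgn
      rw [map_comp, map_sgn, Limits.comp_zero, zero_add]
    · exact Limits.zero_comp.symm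
  map_first M N P f q := by
    rcases q with _ | ⟨q, e⟩
    · change D (M.sgn ≫ f) = U.map M.sgn ≫ D f
      rw [map_comp, map_sgn, Limits.zero_comp, add_zero]
    · iterate 2 rw [degreeOne_of_two_le _ (by simp)]
      rw [Limits.comp_zero]
  map_nil M := Limits.comp_zero.trans Limits.zero_comp.symm

theorem d_degreeOne (map_comp : ∀ ⦃M N P⦄ (f : M ⟶ N) (g : N ⟶ P),
    D (f ≫ g) = U.map f ≫ D g + D f ≫ V.map g) : d (degreeOne D) = 0 := by
  funext M N p
  rcases p with _ | ⟨p, f⟩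
  · rfl
  rcases p with _ | ⟨p, g⟩
  · simp only [d, lowerTerms, degreeOne, Limits.zero_comp, Limits.comp_zero, neg_zero, add_zero]
    rfl
  rcases p with _ | ⟨p, h⟩
  · simp only [d, lowerTerms, degreeOne, map_comp, Pi.zero_apply]
    abel
  · simp only [d, lowerTerms, degreeOne, lowerTerms_zero, Limits.zero_comp, neg_zero, sub_zero,
      add_zero]
    rfl

end Families

/-! ### Parity -/

section Parity

variable {A' : Type} [CommRing A'] [Algebra ℂ A'] {W' : A'} {W : ℂ[X]} {U V : FusionFunctor W' W}

theorem isEven_iff {φ : MatFact.Hom (piObj U) (piObj V)} : MatFact.IsEven φ ↔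
    ∀ z, bi (V.functor.map MI.sgn) (φ z) = φ (bi (U.functor.map MI.sgn) z) := by
  rw [U.map_sgn, V.map_sgn]
  exact LinearMap.ext_iff

theorem isOdd_iff {φ : MatFact.Hom (piObj U) (piObj V)} : MatFact.IsOdd φ ↔
    ∀ z, bi (V.functor.map MI.sgn) (φ z) = -φ (bi (U.functor.map MI.sgn) z) := by
  rw [U.map_sgn, V.map_sgn]
  exact LinearMap.ext_iff

theorem δ_apply_of_isEven {A B : Type} [CommRing A] [CommRing B] [Algebra ℂ A] [Algebra ℂ B]
    {W' : A} {W : B} {M N : MatFact W' W} {φ : M.Hom N} (h : MatFact.IsEven φ) (z : M.carrier) :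
    MatFact.δ M N φ z = N.Q (φ z) - φ (M.Q z) := by
  have h' := LinearMap.congr_fun h (M.σ (M.Q z))
  rw [LinearMap.comp_apply, LinearMap.comp_apply, MatFact.σσ] at h'
  rw [MatFact.δ_apply, h']

theorem δ_apply_of_isOdd {A B : Type} [CommRing A] [CommRing B] [Algebra ℂ A] [Algebra ℂ B]
    {W' : A} {W : B} {M N : MatFact W' W} {φ : M.Hom N} (h : MatFact.IsOdd φ) (z : M.carrier) :
    MatFact.δ M N φ z = N.Q (φ z) + φ (M.Q z) := by
  have h' := LinearMap.congr_fun h (M.σ (M.Q z))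
  rw [LinearMap.comp_apply, LinearMap.neg_apply, LinearMap.comp_apply, MatFact.σσ] at h'
  rw [MatFact.δ_apply, h', sub_neg_eq_add]

theorem isEven_closed_sub {A B : Type} [CommRing A] [CommRing B] [Algebra ℂ A] [Algebra ℂ B]
    {W' : A} {W : B} {M N : MatFact W' W} {φ ψ : M.Hom N} (hφ : MatFact.IsEven φ)
    (hcφ : MatFact.δ M N φ = 0) (hψ : MatFact.IsEven ψ) (hcψ : MatFact.δ M N ψ = 0) :
    MatFact.IsEven (φ - ψ) ∧ MatFact.δ M N (φ - ψ) = 0 := by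
  refine ⟨?_, by rw [map_sub, hcφ, hcψ, sub_zero]⟩
  rw [MatFact.IsEven, LinearMap.comp_sub, LinearMap.sub_comp, hφ, hψ]

theorem isOdd_closed_sub {A B : Type} [CommRing A] [CommRing B] [Algebra ℂ A] [Algebra ℂ B]
    {W' : A} {W : B} {M N : MatFact W' W} {φ ψ : M.Hom N} (hφ : MatFact.IsOdd φ)
    (hcφ : MatFact.δ M N φ = 0) (hψ : MatFact.IsOdd ψ) (hcψ : MatFact.δ M N ψ = 0) :
    MatFact.IsOdd (φ - ψ) ∧ MatFact.δ M N (φ - ψ) = 0 := by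
  refine ⟨?_, by rw [map_sub, hcφ, hcψ, sub_zero]⟩
  rw [MatFact.IsOdd, LinearMap.comp_sub, LinearMap.sub_comp, hφ, hψ]
  abel

/-- The even and the odd part of a closed homomorphism are closed. -/
theorem exists_even_add_odd {A B : Type} [CommRing A] [CommRing B] [Algebra ℂ A] [Algebra ℂ B]
    {W' : A} {W : B} {M N : MatFact W' W} (φ : M.Hom N) (h : MatFact.δ M N φ = 0) :
    ∃ φ₀ φ₁ : M.Hom N, MatFact.IsEven φ₀ ∧ MatFact.δ M N φ₀ = 0 ∧ MatFact.IsOdd φ₁ ∧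
      MatFact.δ M N φ₁ = 0 ∧ φ = φ₀ + φ₁ := by
  let t : A ⊗[ℂ] B := algebraMap ℂ _ (1 / 2)
  have ht : t * 2 = 1 := algebraMap_half_mul_two _
  have hσ : MatFact.δ M N (N.σ ∘ₗ φ ∘ₗ M.σ) = 0 := by
    rw [MatFact.δ_conj, h]
    simp
  refine ⟨t • (φ + N.σ ∘ₗ φ ∘ₗ M.σ), t • (φ - N.σ ∘ₗ φ ∘ₗ M.σ), ?_, ?_, ?_, ?_, ?_⟩
  · refine LinearMap.ext fun m => ?_
    simp [MatFact.σσ, add_comm]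
  · rw [map_smul, map_add, h, hσ, add_zero, smul_zero]
  · refine LinearMap.ext fun m => ?_
    simp [MatFact.σσ, ← smul_neg]
  · rw [map_smul, map_sub, h, hσ, sub_zero, smul_zero]
  · refine LinearMap.ext fun m => ?_
    simp only [LinearMap.add_apply, LinearMap.smul_apply, LinearMap.sub_apply]
    rw [← smul_add, add_add_sub_cancel, ← two_smul (A ⊗[ℂ] B), smul_smul, ht, one_smul]

theorem piMap_of_isHomogeneous {Φ : Cochain U.functor V.functor} {n : ℕ}
    (h : Φ.IsHomogeneous n) : piMap Φ = extEval (IW W) n fun p => Φ p := by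
  refine finsum_eq_single _ n fun k hk => ?_
  rw [← extEval_zero (IW W) k]
  exact extEval_of_length _ _ _ _ fun p hp => h p (by omega)

theorem piMap_sgn {Φ : Cochain U.functor V.functor} {n : ℕ} (hΦ : IsFusionMorphism W' W Φ)
    (h : Φ.IsHomogeneous n) (z : Bi (U.functor.obj MI)) :
    piMap Φ (bi (U.functor.map MI.sgn) z) =
      (-1 : ℤ) ^ n • bi (V.functor.map MI.sgn) (piMap Φ z) := by
  have h2 := extEval_sgn n (hΦ.multi MI) (fun p => Φ p ≫ V.functor.map MI.sgn)
    (fun p f => hΦ.map_last p f) (hΦ.map_nil MI)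
  rw [extEval_comp_right, ← piMap_of_isHomogeneous h] at h2
  exact LinearMap.congr_fun h2 z

theorem piMap_isEven {Φ : Cochain U.functor V.functor} (hΦ : IsFusionMorphism W' W Φ)
    (h : Φ.IsHomogeneous 0) : MatFact.IsEven (M := piObj U) (N := piObj V) (piMap Φ) :=
  isEven_iff.2 fun z => by
    have e := piMap_sgn hΦ h z
    rw [pow_zero, one_smul] at e
    exact e.symm

theorem piMap_isOdd {Φ : Cochain U.functor V.functor} (hΦ : IsFusionMorphism W' W Φ)
    (h : Φ.IsHomogeneous 1) : MatFact.IsOdd (M := piObj U) (N := piObj V) (piMap Φ) :=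
  isOdd_iff.2 fun z => by
    have e := piMap_sgn hΦ h z
    rw [pow_one, neg_one_smul] at e
    exact (neg_eq_iff_eq_neg.2 e).symm

/-- `Π` sends closed families to closed homomorphisms. -/
theorem δ_piMap {Φ : Cochain U.functor V.functor} (hΦ : IsFusionMorphism W' W Φ) (h : d Φ = 0) :
    MatFact.δ (piObj U) (piObj V) (piMap Φ) = 0 :=
  (piCocycle ⟨Φ, hΦ, h⟩).2

end Parity

/-! ### Homogeneous bases of the identity factorization -/

section BasesOfMI

/-- The basis `1` of `ℂ[x]`. -/
noncomputable def oneBasis : Module.Basis Unit ℂ[X] R1.carrier :=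
  Module.Basis.singleton Unit ℂ[X]

theorem coordHom_oneBasis (i : Unit) : coordHom oneBasis i = 𝟙 R1 :=
  LinearMap.ext fun q => Module.Basis.singleton_repr Unit ℂ[X] q i

theorem vecHom_oneBasis (i : Unit) : vecHom oneBasis i = 𝟙 R1 := by
  have h : ∀ q : ℂ[X], q • Module.Basis.singleton Unit ℂ[X] i = q := by simp
  exact LinearMap.ext h

/-- Suppose that every vector of a basis of `M` either has vanishing coordinate along a split
summand `R` or lies in it. Then one basis vector spans the summand, hence it is a unit of `ℂ[x]`,
that is, a nonzero constant. -/
theorem exists_const_of_basis {M : GrMod ℂ[X]} {ι : Type} [Fintype ι]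
    (b : Module.Basis ι ℂ[X] M.carrier) (s : R1 ⟶ M) (r : M ⟶ R1) (hsr : s ≫ r = 𝟙 R1)
    (h : ∀ i, GrMod.lin r (b i) = 0 ∨ GrMod.lin s (GrMod.lin r (b i)) = b i) :
    (∀ j i, ∃ z, entry oneBasis b s j i = C z) ∧ ∀ j i, ∃ z, entry b oneBasis r j i = C z := by
  classical
  let e : R1.carrier := (1 : ℂ[X])
  let p : ι → ℂ[X] := fun i => GrMod.lin r (b i)
  have key : ∀ i, p i ≠ 0 → ∀ j, p i * b.repr (GrMod.lin s e) j = if i = j then 1 else 0 := by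
    intro i hi j
    have h1 : p i • GrMod.lin s e = b i := by
      rw [← map_smul]
      refine Eq.trans (congrArg (GrMod.lin s) ?_) ((h i).resolve_left hi)
      exact mul_one (p i)
    have h2 := congrArg (fun m => b.repr m j) h1
    simp only [map_smul, Finsupp.smul_apply, smul_eq_mul, b.repr_self, Finsupp.single_apply] at h2
    exact h2
  have one_entry : ∀ j i, entry oneBasis b s j i = b.repr (GrMod.lin s e) j := fun j i =>
    congrArg (fun m => b.repr (GrMod.lin s m) j) (Module.Basis.singleton_apply Unit ℂ[X] i)
  have entry_one : ∀ j i, entry b oneBasis r j i = p i := fun j i =>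
    Module.Basis.singleton_repr Unit ℂ[X] _ j
  have const_of_unit : ∀ p : ℂ[X], IsUnit p → ∃ z, p = C z := fun p hp => by
    obtain ⟨z, -, hz⟩ := Polynomial.isUnit_iff.1 hp
    exact ⟨z, hz.symm⟩
  refine ⟨fun j i => ?_, fun j i => ?_⟩
  · rw [one_entry]
    obtain ⟨k, hk⟩ : ∃ k, p k ≠ 0 := by
      by_contra! hr
      have hr0 : GrMod.lin r = 0 := b.ext hr
      have h1 : GrMod.lin r (GrMod.lin s e) = e := LinearMap.congr_fun hsr e
      rw [hr0] at h1
      exact zero_ne_one (α := ℂ[X]) h1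
    have hkj := key k hk j
    split_ifs at hkj with hij
    · exact const_of_unit _ (IsUnit.of_mul_eq_one_right _ hkj)
    · exact ⟨0, by rw [C_0]; exact (mul_eq_zero.1 hkj).resolve_left hk⟩
  · rw [entry_one]
    by_cases hi : p i = 0
    · exact ⟨0, by rw [hi, C_0]⟩
    · have hii := key i hi i
      rw [if_pos rfl] at hii
      exact const_of_unit _ (IsUnit.of_mul_eq_one _ hii)

variable {ι : Type} [Fintype ι] (b : Module.Basis ι ℂ[X] MI.carrier)

theorem entry_in0_pr0_const (hb : IsHomogeneousBasis b) :
    (∀ j i, ∃ z, entry oneBasis b in0 j i = C z) ∧ ∀ j i, ∃ z, entry b oneBasis pr0 j i = C z := by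
  refine exists_const_of_basis b in0 pr0 in0_pr0 fun i => ?_
  rcases hb i with h | h
  · right
    have h2 : (b i).2 = -(b i).2 := (congrArg Prod.snd h).symm
    exact Prod.ext rfl (self_eq_neg (G := ℂ[X]) |>.1 h2).symm
  · left
    have h1 : (b i).1 = -(b i).1 := congrArg Prod.fst h
    exact self_eq_neg (G := ℂ[X]) |>.1 h1

theorem entry_in1_pr1_const (hb : IsHomogeneousBasis b) :
    (∀ j i, ∃ z, entry oneBasis b in1 j i = C z) ∧ ∀ j i, ∃ z, entry b oneBasis pr1 j i = C z := by
  refine exists_const_of_basis b in1 pr1 in1_pr1 fun i => ?_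
  rcases hb i with h | h
  · left
    have h2 : (b i).2 = -(b i).2 := (congrArg Prod.snd h).symm
    exact self_eq_neg (G := ℂ[X]) |>.1 h2
  · right
    have h1 : (b i).1 = -(b i).1 := congrArg Prod.fst h
    exact Prod.ext (self_eq_neg (G := ℂ[X]) |>.1 h1).symm rfl

end BasesOfMI

/-! ### Lifting closed homomorphisms -/

section Lifting

variable {A' : Type} [CommRing A'] [Algebra ℂ A'] {W' : A'} {W : ℂ[X]} {U V : FusionFunctor W' W}

/-- The restriction of the even block of a closed even homomorphism to the diagonal commutes with
the variable, because `V (x) - x̃` vanishes on the diagonal. -/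
theorem muHom_comp00_comm {φ : MatFact.Hom (piObj U) (piObj V)} (he : MatFact.IsEven φ)
    (hc : MatFact.δ (piObj U) (piObj V) φ = 0) :
    U.functor.map (mulBy X) ≫ muHom V.functor (comp00 φ) =
      muHom V.functor (comp00 φ) ≫ V.functor.map (mulBy X) := by
  let F : Bi (U.functor.obj MI) →ₗ[A' ⊗[ℂ] ℂ[X]] Bi (V.functor.obj MI) := φ
  have hc' : ∀ z, extMap V.functor (IW W) (F z) = F (extMap U.functor (IW W) z) := fun z =>
    sub_eq_zero.1 ((δ_apply_of_isEven he z).symm.trans (LinearMap.congr_fun hc z))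
  have e : comp00 φ ∘ₗ diagEq U.functor = diagEq V.functor ∘ₗ
      (bi (V.functor.map pr1) ∘ₗ F ∘ₗ bi (U.functor.map in1)) := by
    refine LinearMap.ext fun z => ?_
    have h1 := congrArg (bi (V.functor.map pr0)) (hc' (bi (U.functor.map in1) z))
    rw [extMap_IW_apply, extMap_IW_apply, map_add, pr0_in0_apply, pr0_in1_apply, add_zero,
      pr1_in1_apply, pr0_in1_apply, map_zero, map_zero, add_zero] at h1
    exact h1.symm
  have h := congrArg (muHom V.functor) e
  rw [muHom_diagEq_comp, comp_diagEq, muHom_sub, muHom_comp_bi, xt_eq, muHom_jR_smul,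
    pow_one] at h
  exact sub_eq_zero.1 h

/-- For a closed odd homomorphism, `ψ⁽¹⁾ U ((W (x) - W (x̃)) / (x - x̃)) = -(V (x) - x̃) ψ⁽⁰⁾`
vanishes on the diagonal. -/
theorem oddEntry_potential {ψ : MatFact.Hom (piObj U) (piObj V)} (ho : MatFact.IsOdd ψ)
    (hc : MatFact.δ (piObj U) (piObj V) ψ = 0) : oddEntry ψ W = 0 := by
  let F : Bi (U.functor.obj MI) →ₗ[A' ⊗[ℂ] ℂ[X]] Bi (V.functor.obj MI) := ψ
  have hc' : ∀ z, extMap V.functor (IW W) (F z) + F (extMap U.functor (IW W) z) = 0 := fun z =>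
    (δ_apply_of_isOdd ho z).symm.trans (LinearMap.congr_fun hc z)
  have e : comp01 ψ ∘ₗ extScalar U.functor (divDiff W) = diagEq V.functor ∘ₗ
      (-(bi (V.functor.map pr1) ∘ₗ F ∘ₗ bi (U.functor.map in0))) := by
    refine LinearMap.ext fun z => ?_
    have h1 := congrArg (bi (V.functor.map pr0)) (hc' (bi (U.functor.map in0) z))
    rw [extMap_IW_apply, extMap_IW_apply, map_add, map_add, pr0_in0_apply, pr0_in1_apply, add_zero,
      pr1_in0_apply, pr0_in0_apply, map_zero, map_zero, zero_add, map_zero] at h1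
    rw [LinearMap.comp_apply, LinearMap.comp_apply, LinearMap.neg_apply, map_neg]
    exact eq_neg_of_add_eq_zero_right h1
  rw [oddEntry_eq, e, muHom_diagEq_comp]

theorem expand_bi_comp_comp {L M N P : GrMod ℂ[X]} (F : Bi M →ₗ[ℂ[X] ⊗[ℂ] ℂ[X]] Bi N)
    (a : L ⟶ M) (c : N ⟶ P) {Z : Type} [AddCommGroup Z] [Module (A' ⊗[ℂ] ℂ[X]) Z]
    (g : (L ⟶ P) → Z) (h0 : g 0 = 0) (hg : ∀ a b, g (a + b) = g a + g b) :
    expand (A' := A') (bi c ∘ₗ F ∘ₗ bi a) g = expand (A' := A') F fun f => g (a ≫ f ≫ c) := by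
  rw [expand_comp _ _ g h0 hg, expand_bi_left]
  · rw [expand_comp _ _ _ (by rw [Limits.zero_comp, h0])
      fun x y => by rw [Preadditive.add_comp, hg]]
    refine expand_congr _ fun f => ?_
    rw [expand_bi_left _ _ (by rw [Limits.zero_comp, Limits.zero_comp, h0]), Category.assoc]
  · simp [expand, h0]

theorem pr0_IW_in1 (W : ℂ[X]) : bi pr0 ∘ₗ IW W ∘ₗ bi in1 =
    bi (mulBy X) + jR ℂ[X] (-X) • bi (𝟙 R1) := by
  refine bi_hom_ext fun m => ?_
  have h0 : GrMod.lin pr0 (GrMod.lin E01 (GrMod.lin in1 m)) = m := rfl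
  have h1 : GrMod.lin pr0 (GrMod.lin E10 (GrMod.lin in1 m)) = 0 := rfl
  rw [LinearMap.comp_apply, LinearMap.comp_apply, bi_incl, IW_incl, map_add, map_smul, map_smul,
    bi_incl, bi_incl, h0, h1, map_zero, smul_zero, add_zero, LinearMap.add_apply, mulBy, bi_smul,
    bi_id, LinearMap.smul_apply, LinearMap.smul_apply, LinearMap.id_apply, map_neg,
    sub_eq_add_neg, add_smul]

/-- The block of `Π` of the derivation from the odd to the even summand: since
`x - x̃` is linear in `x`, it is the restriction of `ψ⁽¹⁾` to the diagonal. -/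
theorem comp01_expand_oddLift (ψ : MatFact.Hom (piObj U) (piObj V)) {ι : Type} [Fintype ι]
    (b : Module.Basis ι ℂ[X] MI.carrier) (hb : IsHomogeneousBasis b) :
    bi (V.functor.map pr0) ∘ₗ (expand (A' := A') (IW W) fun f => bi (oddLift ψ b b f)) ∘ₗ
      bi (U.functor.map in1) = bi (muHom V.functor (comp01 ψ)) := by
  -- The derivation vanishes on the inclusions and projections, hence commutes with taking blocks.
  have h1 : ∀ f : MI ⟶ MI, U.functor.map in1 ≫ oddLift ψ b b f ≫ V.functor.map pr0 =
      oddLift ψ oneBasis oneBasis (in1 ≫ f ≫ pr0) := by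
    intro f
    rw [oddLift_comp oneBasis b oneBasis, oddLift_comp b b oneBasis,
      oddLift_of_const oneBasis b ψ (entry_in1_pr1_const b hb).1,
      oddLift_of_const b oneBasis ψ (entry_in0_pr0_const b hb).2, Limits.zero_comp,
      Limits.comp_zero, zero_add, add_zero]
  have h2 : oddLift ψ oneBasis oneBasis (mulBy X) = oddEntry ψ X := by
    have he : entry oneBasis oneBasis (mulBy X) () () = X :=
      (entry_smul oneBasis oneBasis X (𝟙 R1) () ()).trans ((congrArg (X * ·)
        ((Module.Basis.singleton_repr Unit ℂ[X] _ ()).trans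
          (Module.Basis.singleton_apply Unit ℂ[X] ()))).trans (mul_one X))
    rw [oddLift_eq, Finset.univ_unique, Finset.sum_singleton, Finset.sum_singleton,
      coordHom_oneBasis, vecHom_oneBasis, U.functor.map_id, V.functor.map_id, Category.id_comp,
      Category.comp_id]
    exact congrArg _ he
  let g : (R1 ⟶ R1) → (Bi (U.functor.obj R1) →ₗ[A' ⊗[ℂ] ℂ[X]] Bi (V.functor.obj R1)) :=
    fun f => bi (oddLift ψ oneBasis oneBasis f)
  have g0 : g 0 = 0 := by
    have := oddLift_smul oneBasis oneBasis ψ 0 (0 : R1 ⟶ R1)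
    rw [zero_smul, zero_smul] at this
    simp only [g, this, bi_zero]
  have gadd : ∀ a b, g (a + b) = g a + g b := fun a b => by
    simp only [g, oddLift_add, bi_add]
  have gsmul : ∀ (c : ℂ) a, g (c • a) = jL A' (algebraMap ℂ A' c) • g a := fun c a => by
    simp only [g, oddLift_smul, bi_complex_smul]
  have g1 : g (𝟙 R1) = 0 := by simp only [g, oddLift_id, bi_zero]
  have h3 : bi (V.functor.map pr0) ∘ₗ (expand (A' := A') (IW W) fun f => bi (oddLift ψ b b f)) ∘ₗ
      bi (U.functor.map in1) = expand (A' := A') (IW W) fun f => g (in1 ≫ f ≫ pr0) := by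
    rw [← LinearMap.compRight_apply (S := A' ⊗[ℂ] ℂ[X]),
      ← LinearMap.lcomp_apply' (S := A' ⊗[ℂ] ℂ[X]), map_expand, map_expand]
    refine expand_congr _ fun f => ?_
    simp only [g, ← h1, bi_comp]
    rfl
  rw [h3, ← expand_bi_comp_comp _ _ _ g g0 gadd, pr0_IW_in1, expand_add _ _ g g0 gadd,
    expand_bi_left _ g g0, expand_jR_smul_bi _ _ g g0 gadd gsmul, g1, biHom_smul_zero, add_zero,
    ← oddEntry_X, ← h2]

end Lifting

/-! ### Lifts with prescribed image, and fullness -/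

section MainResults

variable {A' : Type} [CommRing A'] [Algebra ℂ A'] {W' : A'} {W : ℂ[X]}

theorem exists_evenLift (U V : FusionFunctor W' W) (φ : MatFact.Hom (piObj U) (piObj V))
    (he : MatFact.IsEven φ) (hc : MatFact.δ (piObj U) (piObj V) φ = 0) :
    ∃ Φ ∈ fusionHom U V, Φ.IsHomogeneous 0 ∧ d Φ = 0 ∧
      (∀ (M : GrMod ℂ[X])
        (b : Module.Basis (Fin (Module.finrank ℂ[X] M.carrier)) ℂ[X] M.carrier),
        Φ (Quiver.Path.nil : Quiver.Path M M) = evenLift φ b) ∧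
      ∃ χ : MatFact.Hom (piObj U) (piObj V), MatFact.IsOdd χ ∧
        piMap Φ = φ + MatFact.δ (piObj U) (piObj V) χ := by
  have hX := muHom_comp00_comm he hc
  have hindep : ∀ (M : GrMod ℂ[X]) {ι κ : Type} [Fintype ι] [Fintype κ]
      (b : Module.Basis ι ℂ[X] M.carrier) (c : Module.Basis κ ℂ[X] M.carrier),
      evenLift φ b = evenLift φ c := fun M _ _ _ _ b c => by
    have h := evenLift_naturality b c φ hX (𝟙 M)
    rw [U.functor.map_id, V.functor.map_id, Category.id_comp, Category.comp_id] at h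
    exact h.symm
  let η : ∀ M, U.functor.obj M ⟶ V.functor.obj M := fun M =>
    evenLift φ (Module.finBasis ℂ[X] M.carrier)
  have hη : ∀ ⦃M N⦄ (f : M ⟶ N), U.functor.map f ≫ η N = η M ≫ V.functor.map f := fun M N f =>
    evenLift_naturality _ _ φ hX f
  have hmem : IsFusionMorphism W' W (degreeZero η) := degreeZero_isFusionMorphism hη
  have hd := d_degreeZero hη
  have hhom := degreeZero_isHomogeneous η
  refine ⟨degreeZero η, hmem, hhom, hd, fun M b => hindep M _ b, ?_⟩
  let F : Bi (U.functor.obj MI) →ₗ[A' ⊗[ℂ] ℂ[X]] Bi (V.functor.obj MI) := φ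
  have hΦ : piMap (degreeZero η) = bi (η MI) := piMap_of_isHomogeneous hhom
  have hη1 : η R1 = muHom V.functor (comp00 φ) := by
    refine (hindep R1 _ oneBasis).trans ?_
    rw [evenLift, Finset.univ_unique, Finset.sum_singleton, coordHom_oneBasis, vecHom_oneBasis,
      U.functor.map_id, V.functor.map_id, Category.id_comp, Category.comp_id]
  have h00 : U.functor.map in0 ≫ η MI ≫ V.functor.map pr0 = η R1 := by
    rw [← Category.assoc, hη, Category.assoc, ← V.functor.map_comp, in0_pr0, V.functor.map_id,
      Category.comp_id]
  obtain ⟨c, hc00⟩ := exists_diagEq_comp_eq_bi_muHom_sub (comp00 φ)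
  obtain ⟨he', hc'⟩ := isEven_closed_sub (piMap_isEven hmem hhom) (δ_piMap hmem hd) he hc
  obtain ⟨χ, hχ, e⟩ := exact_of_even U.functor V.functor (Θ := piMap (degreeZero η) - F)
    (isEven_iff.1 he')
    (fun z => sub_eq_zero.1 ((δ_apply_of_isEven he' z).symm.trans (LinearMap.congr_fun hc' z))) c
    (fun z => by
      refine Eq.trans ?_ (LinearMap.congr_fun hc00 z)
      rw [hΦ, LinearMap.sub_apply, LinearMap.sub_apply, map_sub, ← hη1, ← h00, bi_comp, bi_comp]
      rfl)
  refine ⟨χ, isOdd_iff.2 hχ, LinearMap.ext fun z => ?_⟩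
  refine (sub_eq_iff_eq_add'.1 ((e z).trans ?_))
  exact (δ_apply_of_isOdd (M := piObj U) (N := piObj V) (isOdd_iff.2 hχ) z).symm

theorem exists_oddLift
    (b : ∀ M : GrMod ℂ[X], Module.Basis (Fin (Module.finrank ℂ[X] M.carrier)) ℂ[X] M.carrier)
    (hb : ∀ M, IsHomogeneousBasis (b M)) (U V : FusionFunctor W' W)
    (ψ : MatFact.Hom (piObj U) (piObj V)) (ho : MatFact.IsOdd ψ)
    (hc : MatFact.δ (piObj U) (piObj V) ψ = 0) :
    ∃ Φ ∈ fusionHom U V, Φ.IsHomogeneous 1 ∧ d Φ = 0 ∧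
      (∀ ⦃M N : GrMod ℂ[X]⦄ (f : M ⟶ N),
        Φ (Quiver.Path.nil.cons f) = oddLift ψ (b M) (b N) f) ∧
      (∀ ⦃M N : GrMod ℂ[X]⦄ (f : M ⟶ N),
        Φ (Quiver.Path.nil.cons (W • f)) = W' • Φ (Quiver.Path.nil.cons f)) ∧
      ∃ χ : MatFact.Hom (piObj U) (piObj V), MatFact.IsEven χ ∧
        piMap Φ = ψ + MatFact.δ (piObj U) (piObj V) χ := by
  let D : ∀ ⦃M N : GrMod ℂ[X]⦄, (M ⟶ N) → (U.functor.obj M ⟶ V.functor.obj N) :=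
    fun M N f => oddLift ψ (b M) (b N) f
  have hcomp : ∀ ⦃M N P⦄ (f : M ⟶ N) (g : N ⟶ P),
      D (f ≫ g) = U.functor.map f ≫ D g + D f ≫ V.functor.map g := fun M N P f g =>
    oddLift_comp (b M) (b N) (b P) ψ f g
  have hpot : ∀ ⦃M N⦄ (f : M ⟶ N), D (W • f) = W' • D f := fun M N f =>
    oddLift_potential_smul (b M) (b N) ψ (oddEntry_potential ho hc) f
  have hmem : IsFusionMorphism W' W (degreeOne D) := degreeOne_isFusionMorphism
    (fun M N f g => oddLift_add (b M) (b N) ψ f g) (fun M N z f => oddLift_smul (b M) (b N) ψ z f)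
    hpot hcomp (fun M => oddLift_id (b M) ψ) fun M => oddLift_sgn (b M) ψ (hb M)
  have hd := d_degreeOne hcomp
  have hhom : (degreeOne D).IsHomogeneous 1 := degreeOne_isHomogeneous
  refine ⟨degreeOne D, hmem, hhom, hd, fun _ _ _ => rfl, hpot, ?_⟩
  let F : Bi (U.functor.obj MI) →ₗ[A' ⊗[ℂ] ℂ[X]] Bi (V.functor.obj MI) := ψ
  have hΦ : piMap (degreeOne D) =
      expand (A' := A') (IW W) fun f => bi (oddLift ψ (b MI) (b MI) f) :=
    piMap_of_isHomogeneous hhom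
  have h01 := comp01_expand_oddLift ψ (b MI) (hb MI)
  rw [← hΦ] at h01
  obtain ⟨c, hc01⟩ := exists_diagEq_comp_eq_bi_muHom_sub (comp01 ψ)
  obtain ⟨ho', hc'⟩ := isOdd_closed_sub (piMap_isOdd hmem hhom) (δ_piMap hmem hd) ho hc
  obtain ⟨χ, hχ, e⟩ := exact_of_odd U.functor V.functor (Θ := piMap (degreeOne D) - F)
    (isOdd_iff.1 ho')
    (fun z => eq_neg_of_add_eq_zero_left
      ((δ_apply_of_isOdd ho' z).symm.trans (LinearMap.congr_fun hc' z))) c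
    (fun z => by
      refine Eq.trans ?_ (LinearMap.congr_fun hc01 z)
      rw [LinearMap.sub_apply, LinearMap.sub_apply, map_sub, ← h01]
      rfl)
  refine ⟨χ, isEven_iff.2 hχ, LinearMap.ext fun z => ?_⟩
  refine (sub_eq_iff_eq_add'.1 ((e z).trans ?_))
  exact (δ_apply_of_isEven (M := piObj U) (N := piObj V) (isEven_iff.2 hχ) z).symm

/-- Every cohomology class is the sum of an even and an odd one. -/
theorem piFunctor_full (W' : A') (W : ℂ[X]) : (PiFunctor W' W).Full where
  map_surjective := by
    rintro U V ⟨φ, hφ⟩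
    change FusionFunctor W' W at U V
    obtain ⟨φ₀, φ₁, he, hc₀, ho, hc₁, rfl⟩ := exists_even_add_odd (M := piObj U) (N := piObj V) φ hφ
    choose b hb using exists_isHomogeneousBasis
    obtain ⟨Φ₀, hΦ₀, -, hd₀, -, χ₀, -, e₀⟩ := exists_evenLift U V φ₀ he hc₀
    obtain ⟨Φ₁, hΦ₁, -, hd₁, -, -, χ₁, -, e₁⟩ := exists_oddLift b hb U V φ₁ ho hc₁
    let Φ : fusionCocycles U V := ⟨Φ₀, hΦ₀, hd₀⟩ + ⟨Φ₁, hΦ₁, hd₁⟩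
    refine ⟨Submodule.Quotient.mk Φ, Quotient.sound ((Submodule.quotientRel_def _).2 ?_)⟩
    let F : MatFact.Hom (piObj U) (piObj V) := piMap (Φ₀ + Φ₁)
    have hF : F = (φ₀ + MatFact.δ (piObj U) (piObj V) χ₀) +
        (φ₁ + MatFact.δ (piObj U) (piObj V) χ₁) :=
      (piMap_add hΦ₀ hΦ₁).trans (congrArg₂ (· + ·) e₀ e₁)
    have e : MatFact.δ (piObj U) (piObj V) (χ₀ + χ₁) = F - (φ₀ + φ₁) := by
      rw [hF, map_add]
      abel
    exact ⟨χ₀ + χ₁, e⟩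

end MainResults
end LGFusion

theorem mainTheorem1 {m : ℕ} (W' : MvPolynomial (Fin m) ℂ) (W : ℂ[X]) :
    (∀ (U V : FusionFunctor W' W) (φ : MatFact.Hom (piObj U) (piObj V)),
      MatFact.IsEven φ → MatFact.δ (piObj U) (piObj V) φ = 0 →
      ∃ Φ ∈ fusionHom U V, Φ.IsHomogeneous 0 ∧ d Φ = 0 ∧
        (∀ (M : GrMod ℂ[X])
          (b : Module.Basis (Fin (Module.finrank ℂ[X] M.carrier)) ℂ[X] M.carrier),
          Φ (Quiver.Path.nil : Quiver.Path M M) = evenLift φ b) ∧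
        ∃ χ : MatFact.Hom (piObj U) (piObj V), MatFact.IsOdd χ ∧
          piMap Φ = φ + MatFact.δ (piObj U) (piObj V) χ) ∧
    (∀ M : GrMod ℂ[X], ∃ b : Module.Basis (Fin (Module.finrank ℂ[X] M.carrier)) ℂ[X] M.carrier,
      IsHomogeneousBasis b) ∧
    (∀ (b : ∀ M : GrMod ℂ[X],
        Module.Basis (Fin (Module.finrank ℂ[X] M.carrier)) ℂ[X] M.carrier),
      (∀ M, IsHomogeneousBasis (b M)) →
      ∀ (U V : FusionFunctor W' W) (ψ : MatFact.Hom (piObj U) (piObj V)),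
      MatFact.IsOdd ψ → MatFact.δ (piObj U) (piObj V) ψ = 0 →
      ∃ Φ ∈ fusionHom U V, Φ.IsHomogeneous 1 ∧ d Φ = 0 ∧
        (∀ ⦃M N : GrMod ℂ[X]⦄ (f : M ⟶ N),
          Φ (Quiver.Path.nil.cons f) = oddLift ψ (b M) (b N) f) ∧
        (∀ ⦃M N : GrMod ℂ[X]⦄ (f : M ⟶ N),
          Φ (Quiver.Path.nil.cons (W • f)) = W' • Φ (Quiver.Path.nil.cons f)) ∧
        ∃ χ : MatFact.Hom (piObj U) (piObj V), MatFact.IsEven χ ∧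
          piMap Φ = ψ + MatFact.δ (piObj U) (piObj V) χ) ∧
    (PiFunctor W' W).Full := by
  exact ⟨exists_evenLift, exists_isHomogeneousBasis, exists_oddLift, piFunctor_full W' W⟩
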